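/- **Theorem 2.6.** Let $G$ be a compact connected Lie group with Lie algebra $\mathfrak g$, and let $W$ be a compact smooth $G$-manifold, possibly with boundary, such that $G$ acts locally freely on some open subset of $W$ that contains $\partial W$. Let $W^s\subset W$ be the set of points whose stabilizer has positive dimension and let $W^0=W\setminus W^s$. Let $f:W\to[0,1]$ be a $G$-invariant smooth function that vanishes on a neighbourhood of $W^s$. Choose a basis $\xi_a$ of $\mathfrak g$ with dual basis $\Theta^a$ of $\mathfrak g^*$, regarded as generators of the symmetric algebra $S(\mathfrak g^*)$. For $\xi\in\mathfrak g$ let $X_\xi$ be the fundamental vector field $X_\xi(x)=\frac{d}{dt}\big|_{t=0}\exp(-t\xi)x$ on $W$, and let $\iota_a$ be the contraction with $X_{\xi_a}$. Let $G$ act on $S(\mathfrak g^*)$ by the coadjoint action and on $\Omega(W)$ by $g\cdot\alpha=(g^{-1})^*\alpha$, and let $$\Omega_G(W)=(S(\mathfrak g^*)\otimes\Omega(W))^G,\qquad D=1\otimes d-\sum_a\Theta^a\otimes\iota_a ,$$ with cohomology $H_G^*(W)$ (the Cartan model). Let $\omega$ be a connection on $W^0$, that is, a smooth $\mathfrak g$-valued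 one-form on $W^0$ with $g^*\omega=\mathrm{Ad}_g\,\omega$ for all $g\in G$ and $\omega(X_\xi)=\xi$ for all $\xi\in\mathfrak g$. Let $\omega_f=f\omega$, extended by zero to $W$, and $$\Omega_f^G=d\omega_f+\tfrac12[\omega_f,\omega_f]-(-1+f)\sum_a\xi_a\Theta^a ,$$ with components $(\Omega_f^G)^a\in S(\mathfrak g^*)\otimes\Omega(W)$ in the basis $\xi_a$. These components have even form degree, hence commute, and we let $CW_f:S(\mathfrak g^*)\to S(\mathfrak g^*)\otimes\Omega(W)$ be the homomorphism of algebras $F\mapsto F(\Omega_f^G)$, that is, $\Theta^a\mapsto(\Omega_f^G)^a$. Let $i^c:S(\mathfrak g^*)\to S(\mathfrak g^*)\otimes\Omega(W)$ be the inclusion $F\mapsto F\otimes1$. Then for every $F\in S(\mathfrak g^*)^G$ both $CW_f(F)$ and $i^c(F)$ are $D$-closed elements of $\Omega_G(W)$, and the induced maps $cw_f,\ i^c_*:S(\mathfrak g^*)^G\to H_G^*(W)$ are equal: $$cw_f=i^c_* .$$ -/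

import Mathlib

set_option linter.unusedSectionVars false

open scoped Manifold ContDiff Bundle TensorProduct

namespace DegCW

noncomputable section

/-! ### Differential forms over a Lie-Rinehart pair -/

/-- Differential forms over a pair `(A, L)`. For `A = C^∞(W)` and `L` the `C^∞(W)`-module of smooth
vector fields on a manifold `W`, a smooth `k`-form is the same thing as an alternating
`C^∞(W)`-multilinear map `L^k → C^∞(W)`. A form is the family of its homogeneous components; the
product over all degrees is the direct sum, as forms of degree above the dimension of `W` vanish. -/
structure Form (A L : Type*) [CommRing A] [AddCommGroup L] [Module A L] where
  /-- The component of degree `k`. -/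
  comp : ∀ k : ℕ, L [⋀^Fin k]→ₗ[A] A

namespace Form

section Exterior

variable {A L : Type*} [CommRing A] [AddCommGroup L] [Module A L]

instance : CoeFun (Form A L) (fun _ => ∀ k : ℕ, L [⋀^Fin k]→ₗ[A] A) := ⟨Form.comp⟩

@[ext] theorem ext {α β : Form A L} (h : ∀ k v, α k v = β k v) : α = β := by
  cases α; cases β
  exact congrArg Form.mk (funext fun k => AlternatingMap.ext (h k))

theorem comp_injective : Function.Injective (Form.comp : Form A L → _) :=
  fun α β h => ext fun k v => by rw [h]

instance : Zero (Form A L) := ⟨⟨0⟩⟩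
instance : Add (Form A L) := ⟨fun α β => ⟨α.comp + β.comp⟩⟩
instance : Neg (Form A L) := ⟨fun α => ⟨-α.comp⟩⟩
instance : Sub (Form A L) := ⟨fun α β => ⟨α.comp - β.comp⟩⟩
instance {S : Type*} [Monoid S] [DistribMulAction S A] [SMulCommClass A S A] :
    SMul S (Form A L) := ⟨fun c α => ⟨fun k => c • α k⟩⟩

instance : AddCommGroup (Form A L) :=
  comp_injective.addCommGroup Form.comp rfl (fun _ _ => rfl) (fun _ => rfl) (fun _ _ => rfl)
    (fun _ _ => rfl) (fun _ _ => rfl)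

/-- `comp` as an additive map. -/
def compHom : Form A L →+ ∀ k : ℕ, L [⋀^Fin k]→ₗ[A] A where
  toFun := Form.comp
  map_zero' := rfl
  map_add' _ _ := rfl

instance {S : Type*} [Semiring S] [Module S A] [SMulCommClass A S A] : Module S (Form A L) :=
  comp_injective.module S compHom (fun _ _ => rfl)

@[simp] theorem add_apply (α β : Form A L) (k : ℕ) (v : Fin k → L) :
    (α + β) k v = α k v + β k v := rfl
@[simp] theorem sub_apply (α β : Form A L) (k : ℕ) (v : Fin k → L) :
    (α - β) k v = α k v - β k v := rfl
@[simp] theorem neg_apply (α : Form A L) (k : ℕ) (v : Fin k → L) : (-α) k v = -(α k v) := rfl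
@[simp] theorem zero_apply (k : ℕ) (v : Fin k → L) : (0 : Form A L) k v = 0 := rfl
@[simp] theorem smul_apply {S : Type*} [Monoid S] [DistribMulAction S A] [SMulCommClass A S A]
    (c : S) (α : Form A L) (k : ℕ) (v : Fin k → L) : (c • α) k v = c • α k v := rfl

/-- The contraction `ι_X`, with `(ι_X α)(X₁, …, X_k) = α(X, X₁, …, X_k)`. -/
def contract (x : L) : Form A L →ₗ[A] Form A L where
  toFun α := ⟨fun k => (α (k + 1)).curryLeft x⟩
  map_add' _ _ := rfl
  map_smul' _ _ := rfl

@[simp] theorem contract_apply (x : L) (α : Form A L) (k : ℕ) (v : Fin k → L) :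
    contract x α k v = α (k + 1) (Matrix.vecCons x v) := rfl

/-- The grading involution: multiplication by `(-1)^k` on `k`-forms. -/
def sgn : Form A L →ₗ[A] Form A L where
  toFun α := ⟨fun k => (-1 : A) ^ k • α k⟩
  map_add' _ _ := ext fun _ _ => mul_add _ _ _
  map_smul' _ _ := ext fun _ _ => mul_left_comm _ _ _

@[simp] theorem sgn_apply (α : Form A L) (k : ℕ) (v : Fin k → L) :
    sgn α k v = (-1) ^ k * α k v := rfl

@[simp] theorem sgn_sgn (α : Form A L) : sgn (sgn α) = α := by
  ext k v
  rw [sgn_apply, sgn_apply, ← mul_assoc, ← mul_pow]; simp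

theorem contract_sgn (x : L) (α : Form A L) : contract x (sgn α) = -sgn (contract x α) := by
  ext k v; simp [pow_succ]

theorem contract_self (x : L) (α : Form A L) : contract x (contract x α) = 0 := by
  ext k v
  exact (α (k + 2)).map_eq_zero_of_eq _ (i := 0) (j := 1) (by simp) (by simp)

theorem contract_add_left (x y : L) (α : Form A L) :
    contract (x + y) α = contract x α + contract y α := by
  exact comp_injective (funext fun k => map_add (α (k + 1)).curryLeft x y)

theorem contract_smul_left (a : A) (x : L) (α : Form A L) :
    contract (a • x) α = a • contract x α := by
  exact comp_injective (funext fun k => map_smul (α (k + 1)).curryLeft a x)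

theorem contract_zero_left (α : Form A L) : contract (0 : L) α = 0 := by
  simpa using contract_smul_left (0 : A) (0 : L) α

theorem contract_neg_left (x : L) (α : Form A L) : contract (-x) α = -contract x α := by
  simpa using contract_smul_left (-1 : A) x α

theorem contract_comm (x y : L) (α : Form A L) :
    contract x (contract y α) = -contract y (contract x α) := by
  have h := contract_self (x + y) α
  simp only [contract_add_left, map_add, contract_self, zero_add, add_zero] at h
  exact eq_neg_of_add_eq_zero_right (by rwa [add_comm] at h ⊢)

theorem ext_contract {α β : Form A L} (h0 : α 0 ![] = β 0 ![])
    (h : ∀ x, contract x α = contract x β) : α = β := by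
  ext k v
  cases k with
  | zero => rw [Subsingleton.elim v ![]]; exact h0
  | succ k =>
    rw [← Matrix.cons_head_tail v]
    exact congrArg (fun γ : Form A L => γ k (Matrix.vecTail v)) (h (Matrix.vecHead v))

/-! The exterior product and the ring structure -/

/-- The component of degree `n` of `α ∧ β`, that is the sum over all `(p, q)`-shuffles `σ`, with
`p + q = n`, of `sign σ * α(v_{σ 1}, …, v_{σ p}) * β(v_{σ (p+1)}, …, v_{σ n})`. The shuffles are
enumerated by recursion: the first argument is taken either by `α`, or by `β` after moving past `α`.
No factorials: `(α ∧ β)(X, Y) = α(X) β(Y) - α(Y) β(X)` for one-forms. -/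
def wedgeFun : (n : ℕ) → Form A L → Form A L → (Fin n → L) → A
  | 0, α, β, _ => α 0 ![] * β 0 ![]
  | n + 1, α, β, v =>
      wedgeFun n (contract (v 0) α) β (fun i => v i.succ) +
        wedgeFun n (sgn α) (contract (v 0) β) (fun i => v i.succ)

theorem wedgeFun_add_left (n : ℕ) (α α' β : Form A L) (v : Fin n → L) :
    wedgeFun n (α + α') β v = wedgeFun n α β v + wedgeFun n α' β v := by
  induction n generalizing α α' β with
  | zero => simp [wedgeFun, add_mul]
  | succ n ih => simp only [wedgeFun, map_add, ih]; abel

theorem wedgeFun_add_right (n : ℕ) (α β β' : Form A L) (v : Fin n → L) :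
    wedgeFun n α (β + β') v = wedgeFun n α β v + wedgeFun n α β' v := by
  induction n generalizing α β β' with
  | zero => simp [wedgeFun, mul_add]
  | succ n ih => simp only [wedgeFun, map_add, ih]; abel

theorem wedgeFun_smul_left (n : ℕ) (a : A) (α β : Form A L) (v : Fin n → L) :
    wedgeFun n (a • α) β v = a * wedgeFun n α β v := by
  induction n generalizing α β with
  | zero => simp [wedgeFun, mul_assoc]
  | succ n ih => simp only [wedgeFun, map_smul, ih]; ring

theorem wedgeFun_smul_right (n : ℕ) (a : A) (α β : Form A L) (v : Fin n → L) :
    wedgeFun n α (a • β) v = a * wedgeFun n α β v := by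
  induction n generalizing α β with
  | zero => simp [wedgeFun, mul_left_comm]
  | succ n ih => simp only [wedgeFun, map_smul, ih]; ring

theorem wedgeFun_zero_left (n : ℕ) (β : Form A L) (v : Fin n → L) : wedgeFun n 0 β v = 0 := by
  simpa using wedgeFun_smul_left n (0 : A) 0 β v

theorem wedgeFun_zero_right (n : ℕ) (α : Form A L) (v : Fin n → L) : wedgeFun n α 0 v = 0 := by
  simpa using wedgeFun_smul_right n (0 : A) α 0 v

theorem wedgeFun_neg_left (n : ℕ) (α β : Form A L) (v : Fin n → L) :
    wedgeFun n (-α) β v = -wedgeFun n α β v := by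
  simpa using wedgeFun_smul_left n (-1 : A) α β v

theorem wedgeFun_neg_right (n : ℕ) (α β : Form A L) (v : Fin n → L) :
    wedgeFun n α (-β) v = -wedgeFun n α β v := by
  simpa using wedgeFun_smul_right n (-1 : A) α β v

theorem wedgeFun_repeat (n : ℕ) (α β : Form A L) (v : Fin n → L) (j : Fin n) :
    wedgeFun n (contract (v j) α) β v + wedgeFun n (sgn α) (contract (v j) β) v = 0 := by
  induction n generalizing α β with
  | zero => exact j.elim0
  | succ n ih =>
    induction j using Fin.cases with
    | zero =>
      simp only [wedgeFun, contract_self, wedgeFun_zero_left, wedgeFun_zero_right, contract_sgn,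
        wedgeFun_neg_left, sgn_sgn]
      abel
    | succ j =>
      have h1 := ih (contract (v 0) α) β (fun i => v i.succ) j
      have h2 := ih (sgn α) (contract (v 0) β) (fun i => v i.succ) j
      simp only [wedgeFun, contract_sgn, wedgeFun_neg_left, sgn_sgn] at h1 h2 ⊢
      simp only [contract_comm (v 0) (v j.succ), wedgeFun_neg_left, wedgeFun_neg_right] at h1 h2 ⊢
      simp only [contract_comm (v j.succ) (v 0), wedgeFun_neg_left, wedgeFun_neg_right] at h1 h2 ⊢
      linear_combination -h1 - h2

theorem wedgeFun_update_add (n : ℕ) (α β : Form A L) (v : Fin n → L) (i : Fin n) (x y : L) :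
    wedgeFun n α β (Function.update v i (x + y)) =
      wedgeFun n α β (Function.update v i x) + wedgeFun n α β (Function.update v i y) := by
  induction n generalizing α β with
  | zero => exact i.elim0
  | succ n ih =>
    induction i using Fin.cases with
    | zero =>
      simp only [wedgeFun, Function.update_self, contract_add_left, wedgeFun_add_left,
        wedgeFun_add_right, Function.update_of_ne (Fin.succ_ne_zero _)]
      abel
    | succ i =>
      have h : ∀ z, (fun k : Fin n => Function.update v i.succ z k.succ) =
          Function.update (fun k => v k.succ) i z := fun z => by
        funext k; simp [Function.update_apply]
      simp only [wedgeFun, h, ih, Function.update_of_ne (Fin.succ_ne_zero _).symm]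
      abel

theorem wedgeFun_update_smul (n : ℕ) (α β : Form A L) (v : Fin n → L) (i : Fin n) (a : A) (x : L) :
    wedgeFun n α β (Function.update v i (a • x)) =
      a * wedgeFun n α β (Function.update v i x) := by
  induction n generalizing α β with
  | zero => exact i.elim0
  | succ n ih =>
    induction i using Fin.cases with
    | zero =>
      simp only [wedgeFun, Function.update_self, contract_smul_left, wedgeFun_smul_left,
        wedgeFun_smul_right, Function.update_of_ne (Fin.succ_ne_zero _)]
      ring
    | succ i =>
      have h : ∀ z, (fun k : Fin n => Function.update v i.succ z k.succ) =
          Function.update (fun k => v k.succ) i z := fun z => by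
        funext k; simp [Function.update_apply]
      simp only [wedgeFun, h, ih, Function.update_of_ne (Fin.succ_ne_zero _).symm]
      ring

theorem wedgeFun_alternating (n : ℕ) (α β : Form A L) (v : Fin n → L) (i j : Fin n)
    (hv : v i = v j) (hij : i ≠ j) : wedgeFun n α β v = 0 := by
  induction n generalizing α β with
  | zero => exact i.elim0
  | succ n ih =>
    induction i using Fin.cases with
    | zero =>
      obtain ⟨j, rfl⟩ := Fin.exists_succ_eq.2 hij.symm
      simp only [wedgeFun, hv]
      exact wedgeFun_repeat n α β (fun k => v k.succ) j
    | succ i =>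
      induction j using Fin.cases with
      | zero =>
        simp only [wedgeFun, ← hv]
        exact wedgeFun_repeat n α β (fun k => v k.succ) i
      | succ j =>
        have hij' : i ≠ j := fun h => hij (by rw [h])
        simp only [wedgeFun, ih _ _ (fun k => v k.succ) i j hv hij', add_zero]

instance : Mul (Form A L) where
  mul α β := ⟨fun n =>
    { toFun := wedgeFun n α β
      map_update_add' := fun {inst} v i x y => by
        obtain rfl : inst = instDecidableEqFin n := Subsingleton.elim _ _
        exact wedgeFun_update_add n α β v i x y
      map_update_smul' := fun {inst} v i a x => by
        obtain rfl : inst = instDecidableEqFin n := Subsingleton.elim _ _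
        exact wedgeFun_update_smul n α β v i a x
      map_eq_zero_of_eq' := wedgeFun_alternating n α β }⟩

theorem mul_apply (α β : Form A L) (n : ℕ) (v : Fin n → L) : (α * β) n v = wedgeFun n α β v := rfl

theorem mul_zero_apply (α β : Form A L) : (α * β) 0 ![] = α 0 ![] * β 0 ![] := rfl

/-- Contraction is an antiderivation of the exterior product. -/
theorem contract_mul (x : L) (α β : Form A L) :
    contract x (α * β) = contract x α * β + sgn α * contract x β := rfl

/-- The functions `C^∞` as forms of degree zero. -/
def ofFun : A →ₗ[A] Form A L where
  toFun a := ⟨fun k =>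
    match k with
    | 0 => AlternatingMap.constOfIsEmpty A L (Fin 0) a
    | _ + 1 => 0⟩
  map_add' a b := by
    refine ext fun k v => ?_
    cases k
    · rfl
    · exact (add_zero (0 : A)).symm
  map_smul' a b := by
    refine ext fun k v => ?_
    cases k
    · rfl
    · exact (mul_zero a).symm

@[simp] theorem ofFun_zero (a : A) (v : Fin 0 → L) : (ofFun a : Form A L) 0 v = a := rfl
@[simp] theorem contract_ofFun (x : L) (a : A) : contract x (ofFun a : Form A L) = 0 := rfl
@[simp] theorem sgn_ofFun (a : A) : sgn (ofFun a : Form A L) = ofFun a :=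
  ext_contract (by simp) fun x => by simp [contract_sgn]

theorem sgn_mul (α β : Form A L) : sgn (α * β) = sgn α * sgn β := by
  have key : ∀ (n : ℕ) (α β : Form A L) (v : Fin n → L),
      sgn (α * β) n v = (sgn α * sgn β) n v := by
    intro n
    induction n with
    | zero => intro α β v; simp [mul_apply, wedgeFun]
    | succ n ih =>
      intro α β v
      have h := ih (contract (v 0) α) β (fun i => v i.succ)
      have h' := ih (sgn α) (contract (v 0) β) (fun i => v i.succ)
      simp only [sgn_apply, mul_apply, wedgeFun, contract_sgn, wedgeFun_neg_left,
        wedgeFun_neg_right, pow_succ] at h h' ⊢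
      linear_combination -h - h'
  exact ext (key · α β)

instance : One (Form A L) := ⟨ofFun 1⟩

theorem one_def : (1 : Form A L) = ofFun 1 := rfl

theorem add_mul' (α β γ : Form A L) : (α + β) * γ = α * γ + β * γ :=
  ext fun n v => wedgeFun_add_left n α β γ v

theorem mul_add' (α β γ : Form A L) : α * (β + γ) = α * β + α * γ :=
  ext fun n v => wedgeFun_add_right n α β γ v

theorem ofFun_mul (a : A) (β : Form A L) : ofFun a * β = a • β := by
  ext n v
  induction n generalizing β with
  | zero => rw [Subsingleton.elim v ![]]; simp [mul_apply, wedgeFun]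
  | succ n ih =>
    have h := ih (contract (v 0) β) (fun i => v i.succ)
    simp only [mul_apply, wedgeFun, contract_ofFun, wedgeFun_zero_left, sgn_ofFun, zero_add] at h ⊢
    rw [h]
    simp only [smul_apply, contract_apply]
    congr 2
    exact Matrix.cons_head_tail v

theorem mul_ofFun (a : A) (β : Form A L) : β * ofFun a = a • β := by
  ext n v
  induction n generalizing β with
  | zero => rw [Subsingleton.elim v ![]]; simp [mul_apply, wedgeFun, mul_comm]
  | succ n ih =>
    have h := ih (contract (v 0) β) (fun i => v i.succ)
    simp only [mul_apply, wedgeFun, contract_ofFun, wedgeFun_zero_right, add_zero] at h ⊢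
    rw [h]
    simp only [smul_apply, contract_apply]
    congr 2
    exact Matrix.cons_head_tail v

theorem mul_assoc' (α β γ : Form A L) : α * β * γ = α * (β * γ) := by
  have key : ∀ (n : ℕ) (α β γ : Form A L) (v : Fin n → L),
      (α * β * γ) n v = (α * (β * γ)) n v := by
    intro n
    induction n with
    | zero => intro α β γ v; simp [mul_apply, wedgeFun, mul_assoc]
    | succ n ih =>
      intro α β γ v
      have e : ∀ δ : Form A L, δ (n + 1) v = contract (v 0) δ n (fun i => v i.succ) :=
        fun δ => congrArg (δ (n + 1)) (Matrix.cons_head_tail v).symm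
      simp only [e, contract_mul, add_mul', mul_add', add_apply, ih, sgn_mul]
      ring
  exact ext (key · α β γ)

instance : Ring (Form A L) :=
  { (inferInstance : AddCommGroup (Form A L)) with
    mul := (· * ·)
    one := 1
    left_distrib := mul_add'
    right_distrib := add_mul'
    zero_mul := fun α => ext fun n v => wedgeFun_zero_left n α v
    mul_zero := fun α => ext fun n v => wedgeFun_zero_right n α v
    mul_assoc := mul_assoc'
    one_mul := fun α => by rw [one_def, ofFun_mul, one_smul]
    mul_one := fun α => by rw [one_def, mul_ofFun, one_smul] }

theorem smul_mul' (a : A) (α β : Form A L) : a • α * β = a • (α * β) :=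
  ext fun n v => wedgeFun_smul_left n a α β v

theorem mul_smul' (a : A) (α β : Form A L) : α * a • β = a • (α * β) :=
  ext fun n v => wedgeFun_smul_right n a α β v

/-- Graded commutativity, for `α` even or odd. -/
theorem mul_comm_of_even_odd (n : ℕ) (α β : Form A L) :
    (sgn α = α → ∀ v, (α * β) n v = (β * α) n v) ∧
      (sgn α = -α → ∀ v, (α * β) n v = (sgn β * α) n v) := by
  induction n generalizing α β with
  | zero =>
    refine ⟨fun _ v => ?_, fun _ v => ?_⟩ <;> simp [mul_apply, wedgeFun, mul_comm]
  | succ n ih =>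
    have e : ∀ (δ : Form A L) (v : Fin (n + 1) → L),
        δ (n + 1) v = contract (v 0) δ n (fun i => v i.succ) :=
      fun δ v => congrArg (δ (n + 1)) (Matrix.cons_head_tail v).symm
    refine ⟨fun hα v => ?_, fun hα v => ?_⟩
    · have h1 : sgn (contract (v 0) α) = -contract (v 0) α := by
        rw [← neg_eq_iff_eq_neg, ← contract_sgn, hα]
      rw [e, e, contract_mul, contract_mul, hα, add_apply, add_apply, (ih _ _).2 h1, (ih _ _).1 hα,
        add_comm]
    · have h1 : sgn (contract (v 0) α) = contract (v 0) α := by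
        rw [← neg_inj, ← contract_sgn, hα, map_neg]
      have h2 := (ih α (contract (v 0) β)).2 hα (fun i => v i.succ)
      rw [e, e, contract_mul, contract_mul, hα, add_apply, add_apply, (ih _ _).1 h1, sgn_sgn,
        contract_sgn, neg_mul, neg_mul, neg_apply, neg_apply, h2, add_comm]

/-- Forms of even degree are central. -/
theorem commute_of_even {α : Form A L} (hα : sgn α = α) (β : Form A L) : Commute α β :=
  ext fun n => (mul_comm_of_even_odd n α β).1 hα

/-- A `C^∞`-linear functional on vector fields as a form of degree one. -/
def ofOne (ℓ : L →ₗ[A] A) : Form A L := ⟨fun k =>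
  match k with
  | 1 => AlternatingMap.ofSubsingleton A L A (0 : Fin 1) ℓ
  | _ => 0⟩

@[simp] theorem ofOne_apply (ℓ : L →ₗ[A] A) (x : L) : (ofOne ℓ) 1 ![x] = ℓ x := rfl

theorem contract_ofOne (x : L) (ℓ : L →ₗ[A] A) : contract x (ofOne ℓ) = ofFun (ℓ x) := by
  refine ext fun k v => ?_
  rcases k with _ | k <;> rfl

theorem sgn_ofOne (ℓ : L →ₗ[A] A) : sgn (ofOne ℓ) = -ofOne ℓ := by
  refine ext_contract ?_ fun x => ?_
  · exact (mul_zero _).trans neg_zero.symm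
  · rw [contract_sgn, map_neg, contract_ofOne, sgn_ofFun]

theorem mul_apply_two (α β : Form A L) (hα : α 0 ![] = 0) (hβ : β 0 ![] = 0) (x y : L) :
    (α * β) 2 ![x, y] = α 1 ![x] * β 1 ![y] - α 1 ![y] * β 1 ![x] := by
  simp [mul_apply, wedgeFun, hα, hβ, contract_sgn]
  ring

end Exterior

section Scalars

variable {K A L : Type*} [CommRing K] [CommRing A] [Algebra K A] [AddCommGroup L] [Module A L]

theorem algebraMap_smul' (c : K) (α : Form A L) : c • α = algebraMap K A c • α :=
  ext fun k v => Algebra.smul_def c (α k v)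

instance : Algebra K (Form A L) :=
  Algebra.ofModule
    (fun c α β => by rw [algebraMap_smul' c, smul_mul', ← algebraMap_smul'])
    (fun c α β => by rw [algebraMap_smul' c, mul_smul', ← algebraMap_smul'])

instance : IsScalarTower K A (Form A L) :=
  IsScalarTower.of_algebraMap_smul fun c α => (algebraMap_smul' c α).symm

end Scalars

section Lie

variable {A L : Type*} [CommRing A] [LieRing L] [Module A L] [LieRingModule L A]
  [LieRinehartRing A L]

/-- The Lie derivative, by the recursion `ι_v L_x = L_x ι_v - ι_[x,v]`; see `lieD_apply`. -/
def lieFun (x : L) : (n : ℕ) → Form A L → (Fin n → L) → A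
  | 0, α, _ => ⁅x, α 0 ![]⁆
  | n + 1, α, v => lieFun x n (contract (v 0) α) (fun i => v i.succ) -
      contract ⁅x, v 0⁆ α n (fun i => v i.succ)

theorem lieFun_add (x : L) (n : ℕ) (α β : Form A L) (v : Fin n → L) :
    lieFun x n (α + β) v = lieFun x n α v + lieFun x n β v := by
  induction n generalizing α β with
  | zero => simp [lieFun]
  | succ n ih => simp only [lieFun, map_add, ih, add_apply]; ring

theorem lieFun_smul (x : L) (n : ℕ) (a : A) (α : Form A L) (v : Fin n → L) :
    lieFun x n (a • α) v = a * lieFun x n α v + ⁅x, a⁆ * α n v := by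
  induction n generalizing α with
  | zero => simp [lieFun, Subsingleton.elim v ![]]
  | succ n ih =>
    have e : α (n + 1) v = contract (v 0) α n (fun i => v i.succ) :=
      congrArg (α (n + 1)) (Matrix.cons_head_tail v).symm
    simp only [lieFun, map_smul, ih, smul_apply, e, smul_eq_mul]; ring

theorem lieFun_neg (x : L) (n : ℕ) (α : Form A L) (v : Fin n → L) :
    lieFun x n (-α) v = -lieFun x n α v := by
  have h := lieFun_add x n α (-α) v
  have h0 := lieFun_add x n (0 : Form A L) 0 v
  rw [add_neg_cancel] at h
  rw [add_zero] at h0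
  linear_combination -h0 - h

theorem lieFun_zero (x : L) (n : ℕ) (v : Fin n → L) : lieFun x n (0 : Form A L) v = 0 := by
  have h0 := lieFun_add x n (0 : Form A L) 0 v
  rw [add_zero] at h0
  linear_combination -h0

theorem lieFun_update_add (x : L) (n : ℕ) (α : Form A L) (v : Fin n → L) (i : Fin n) (y z : L) :
    lieFun x n α (Function.update v i (y + z)) =
      lieFun x n α (Function.update v i y) + lieFun x n α (Function.update v i z) := by
  induction n generalizing α with
  | zero => exact i.elim0
  | succ n ih =>
    induction i using Fin.cases with
    | zero =>
      simp only [lieFun, Function.update_self, lie_add, contract_add_left, lieFun_add, add_apply,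
        Function.update_of_ne (Fin.succ_ne_zero _)]
      ring
    | succ i =>
      have h : ∀ w, (fun k : Fin n => Function.update v i.succ w k.succ) =
          Function.update (fun k => v k.succ) i w := fun w => by
        funext k; simp [Function.update_apply]
      simp only [lieFun, h, ih, Function.update_of_ne (Fin.succ_ne_zero _).symm,
        AlternatingMap.map_update_add]
      ring

theorem lieFun_update_smul (x : L) (n : ℕ) (α : Form A L) (v : Fin n → L) (i : Fin n) (a : A)
    (y : L) :
    lieFun x n α (Function.update v i (a • y)) = a * lieFun x n α (Function.update v i y) := by
  induction n generalizing α with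
  | zero => exact i.elim0
  | succ n ih =>
    induction i using Fin.cases with
    | zero =>
      simp only [lieFun, Function.update_self, LieRinehartRing.leibniz_smul_right,
        contract_add_left, contract_smul_left, lieFun_smul, add_apply, smul_apply, smul_eq_mul,
        Function.update_of_ne (Fin.succ_ne_zero _)]
      ring
    | succ i =>
      have h : ∀ w, (fun k : Fin n => Function.update v i.succ w k.succ) =
          Function.update (fun k => v k.succ) i w := fun w => by
        funext k; simp [Function.update_apply]
      simp only [lieFun, h, ih, Function.update_of_ne (Fin.succ_ne_zero _).symm,
        AlternatingMap.map_update_smul, smul_eq_mul]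
      ring

theorem contract_repeat (n : ℕ) (α : Form A L) (v : Fin n → L) (j : Fin n) :
    contract (v j) α n v = 0 :=
  (α (n + 1)).map_eq_zero_of_eq _ (i := 0) (j := j.succ) (by simp) (Fin.succ_ne_zero j).symm

theorem lieFun_repeat (x : L) (n : ℕ) (α : Form A L) (v : Fin n → L) (j : Fin n) :
    lieFun x n (contract (v j) α) v = contract ⁅x, v j⁆ α n v := by
  induction n generalizing α with
  | zero => exact j.elim0
  | succ n ih =>
    have e : ∀ β : Form A L, β (n + 1) v = contract (v 0) β n (fun i => v i.succ) := fun β =>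
      congrArg (β (n + 1)) (Matrix.cons_head_tail v).symm
    induction j using Fin.cases with
    | zero =>
      rw [e, contract_comm]
      simp [lieFun, contract_self, lieFun_zero]
    | succ j =>
      have h := ih (contract (v 0) α) (fun i => v i.succ) j
      have h2 := contract_repeat n (contract ⁅x, v 0⁆ α) (fun i => v i.succ) j
      rw [e, contract_comm (v 0)]
      simp only [lieFun]
      rw [contract_comm (v 0) (v j.succ), lieFun_neg, h, contract_comm ⁅x, v 0⁆, neg_apply, neg_apply,
        h2]
      ring

theorem lieFun_alternating (x : L) (n : ℕ) (α : Form A L) (v : Fin n → L) (i j : Fin n)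
    (hv : v i = v j) (hij : i ≠ j) : lieFun x n α v = 0 := by
  induction n generalizing α with
  | zero => exact i.elim0
  | succ n ih =>
    induction i using Fin.cases with
    | zero =>
      obtain ⟨j, rfl⟩ := Fin.exists_succ_eq.2 hij.symm
      simp only [lieFun, hv]
      exact sub_eq_zero.2 (lieFun_repeat x n α (fun k => v k.succ) j)
    | succ i =>
      induction j using Fin.cases with
      | zero =>
        simp only [lieFun, ← hv]
        exact sub_eq_zero.2 (lieFun_repeat x n α (fun k => v k.succ) i)
      | succ j =>
        have hij' : i ≠ j := fun h => hij (by rw [h])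
        simp only [lieFun, ih _ (fun k => v k.succ) i j hv hij',
          AlternatingMap.map_eq_zero_of_eq _ (fun k : Fin n => v k.succ) hv hij', sub_zero]

/-- The Lie derivative `L_x` of forms along `x`; `lieD_apply` is the usual formula. -/
def lieD (x : L) : Form A L →+ Form A L where
  toFun α := ⟨fun n =>
    { toFun := lieFun x n α
      map_update_add' := fun {inst} v i y z => by
        obtain rfl : inst = instDecidableEqFin n := Subsingleton.elim _ _
        exact lieFun_update_add x n α v i y z
      map_update_smul' := fun {inst} v i a y => by
        obtain rfl : inst = instDecidableEqFin n := Subsingleton.elim _ _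
        exact lieFun_update_smul x n α v i a y
      map_eq_zero_of_eq' := lieFun_alternating x n α }⟩
  map_zero' := ext fun n v => lieFun_zero x n v
  map_add' α β := ext fun n v => lieFun_add x n α β v

theorem lieD_apply' (x : L) (α : Form A L) (n : ℕ) (v : Fin n → L) :
    lieD x α n v = lieFun x n α v := rfl

theorem lieD_apply (x : L) (α : Form A L) (n : ℕ) (v : Fin n → L) :
    lieD x α n v = ⁅x, α n v⁆ - ∑ i, α n (Function.update v i ⁅x, v i⁆) := by
  rw [lieD_apply']
  induction n generalizing α with
  | zero => simp [lieFun, Subsingleton.elim v ![]]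
  | succ n ih =>
    have e : ∀ w : Fin (n + 1) → L,
        α (n + 1) w = contract (w 0) α n (fun i => w i.succ) := fun w =>
      congrArg (α (n + 1)) (Matrix.cons_head_tail w).symm
    have h : ∀ (i : Fin n) (w : L), (fun k : Fin n => Function.update v i.succ w k.succ) =
        Function.update (fun k => v k.succ) i w := fun i w => by
      funext k; simp [Function.update_apply]
    simp only [lieFun, ih, Fin.sum_univ_succ, e, Function.update_self, h,
      Function.update_of_ne (Fin.succ_ne_zero _), Function.update_of_ne (Fin.succ_ne_zero _).symm]
    ring

/-- `[L_x, ι_y] = ι_[x,y]` -/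
theorem contract_lieD (x y : L) (α : Form A L) :
    contract y (lieD x α) = lieD x (contract y α) - contract ⁅x, y⁆ α := rfl

theorem lieD_smul (x : L) (a : A) (α : Form A L) : lieD x (a • α) = a • lieD x α + ⁅x, a⁆ • α :=
  ext fun n v => lieFun_smul x n a α v

/-- The differential `da` of a function as a one-form, `da(x) = x(a)`. -/
def dFun (a : A) : Form A L :=
  ofOne
    { toFun := fun x => ⁅x, a⁆
      map_add' := fun x y => add_lie x y a
      map_smul' := fun b x => LieRinehartRing.lie_smul_eq_mul b a x }

theorem contract_dFun (x : L) (a : A) : contract x (dFun a : Form A L) = ofFun ⁅x, a⁆ :=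
  contract_ofOne x _

theorem sgn_dFun (a : A) : sgn (dFun a : Form A L) = -dFun a := sgn_ofOne _

theorem lieD_smul_left (x : L) (a : A) (α : Form A L) :
    lieD (a • x) α = a • lieD x α + dFun a * contract x α := by
  refine ext fun n v => ?_
  induction n generalizing α with
  | zero =>
    have h0 : (dFun a : Form A L) 0 ![] = 0 := rfl
    simp [lieD_apply', lieFun, mul_apply, wedgeFun, h0]
  | succ n ih =>
    have e : ∀ β : Form A L, β (n + 1) v = contract (v 0) β n (fun i => v i.succ) := fun β =>
      congrArg (β (n + 1)) (Matrix.cons_head_tail v).symm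
    have hb : ⁅a • x, v 0⁆ = a • ⁅x, v 0⁆ - ⁅v 0, a⁆ • x := by
      rw [← lie_skew, LieRinehartRing.leibniz_smul_right, ← lie_skew x, smul_neg]; abel
    have h := ih (contract (v 0) α) (fun i => v i.succ)
    rw [e, e, map_add, map_smul, contract_lieD, contract_lieD, contract_mul, contract_dFun,
      ofFun_mul, sgn_dFun, contract_comm (v 0) x, neg_mul_neg, sub_apply, h, hb]
    simp only [sub_eq_add_neg, ← neg_smul, contract_add_left, contract_smul_left, add_apply,
      smul_apply, neg_apply, smul_eq_mul]
    ring

/-- The exterior derivative, by the recursion `ι_v d = L_v - d ι_v`, starting from `(dα)_0 = 0`;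
`extD_apply_succ` is the usual formula. -/
def extFun : (n : ℕ) → Form A L → (Fin n → L) → A
  | 0, _, _ => 0
  | n + 1, α, v => lieD (v 0) α n (fun i => v i.succ) -
      extFun n (contract (v 0) α) (fun i => v i.succ)

theorem extFun_add (n : ℕ) (α β : Form A L) (v : Fin n → L) :
    extFun n (α + β) v = extFun n α v + extFun n β v := by
  induction n generalizing α β with
  | zero => simp [extFun]
  | succ n ih => simp only [extFun, map_add, ih, add_apply]; ring

theorem extFun_smul (n : ℕ) (a : A) (α : Form A L) (v : Fin n → L) :
    extFun n (a • α) v = a * extFun n α v + (dFun a * α : Form A L) n v := by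
  induction n generalizing α with
  | zero =>
    have h0 : (dFun a : Form A L) 0 ![] = 0 := rfl
    simp [extFun, mul_apply, wedgeFun, h0]
  | succ n ih =>
    have e : ∀ β : Form A L, β (n + 1) v = contract (v 0) β n (fun i => v i.succ) := fun β =>
      congrArg (β (n + 1)) (Matrix.cons_head_tail v).symm
    rw [e, contract_mul, contract_dFun, ofFun_mul, sgn_dFun]
    simp only [extFun, map_smul, ih, lieD_smul, add_apply, smul_apply, smul_eq_mul, neg_mul,
      neg_apply]
    ring

theorem extFun_zero (n : ℕ) (v : Fin n → L) : extFun n (0 : Form A L) v = 0 := by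
  have h0 := extFun_add n (0 : Form A L) 0 v
  rw [add_zero] at h0
  linear_combination -h0

theorem extFun_neg (n : ℕ) (α : Form A L) (v : Fin n → L) :
    extFun n (-α) v = -extFun n α v := by
  have h := extFun_add n α (-α) v
  rw [add_neg_cancel, extFun_zero] at h
  linear_combination -h

theorem lieD_add_left (x y : L) (α : Form A L) : lieD (x + y) α = lieD x α + lieD y α := by
  refine ext fun n v => ?_
  induction n generalizing α with
  | zero => simp [lieD_apply', lieFun]
  | succ n ih =>
    have h := ih (contract (v 0) α) (fun i => v i.succ)
    simp only [lieD_apply', lieFun, add_apply, add_lie, contract_add_left] at h ⊢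
    rw [h]; ring

theorem extFun_update_add (n : ℕ) (α : Form A L) (v : Fin n → L) (i : Fin n) (y z : L) :
    extFun n α (Function.update v i (y + z)) =
      extFun n α (Function.update v i y) + extFun n α (Function.update v i z) := by
  induction n generalizing α with
  | zero => exact i.elim0
  | succ n ih =>
    induction i using Fin.cases with
    | zero =>
      simp only [extFun, Function.update_self, lieD_add_left, contract_add_left, extFun_add,
        add_apply, Function.update_of_ne (Fin.succ_ne_zero _)]
      ring
    | succ i =>
      have h : ∀ w, (fun k : Fin n => Function.update v i.succ w k.succ) =
          Function.update (fun k => v k.succ) i w := fun w => by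
        funext k; simp [Function.update_apply]
      simp only [extFun, h, ih, Function.update_of_ne (Fin.succ_ne_zero _).symm,
        AlternatingMap.map_update_add]
      ring

theorem extFun_update_smul (n : ℕ) (α : Form A L) (v : Fin n → L) (i : Fin n) (a : A) (y : L) :
    extFun n α (Function.update v i (a • y)) = a * extFun n α (Function.update v i y) := by
  induction n generalizing α with
  | zero => exact i.elim0
  | succ n ih =>
    induction i using Fin.cases with
    | zero =>
      simp only [extFun, Function.update_self, lieD_smul_left, contract_smul_left, extFun_smul,
        add_apply, smul_apply, smul_eq_mul, Function.update_of_ne (Fin.succ_ne_zero _)]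
      ring
    | succ i =>
      have h : ∀ w, (fun k : Fin n => Function.update v i.succ w k.succ) =
          Function.update (fun k => v k.succ) i w := fun w => by
        funext k; simp [Function.update_apply]
      simp only [extFun, h, ih, Function.update_of_ne (Fin.succ_ne_zero _).symm,
        AlternatingMap.map_update_smul, smul_eq_mul]
      ring

theorem extFun_repeat (n : ℕ) (α : Form A L) (v : Fin n → L) (j : Fin n) :
    extFun n (contract (v j) α) v = lieD (v j) α n v := by
  induction n generalizing α with
  | zero => exact j.elim0
  | succ n ih =>
    have e : ∀ β : Form A L, β (n + 1) v = contract (v 0) β n (fun i => v i.succ) := fun β =>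
      congrArg (β (n + 1)) (Matrix.cons_head_tail v).symm
    induction j using Fin.cases with
    | zero =>
      rw [e, contract_lieD]
      simp [extFun, contract_self, extFun_zero, contract_zero_left]
    | succ j =>
      have h := ih (contract (v 0) α) (fun i => v i.succ) j
      have h2 := contract_repeat n (lieD (v 0) α) (fun i => v i.succ) j
      rw [contract_lieD] at h2
      rw [e, contract_lieD, ← lie_skew, sub_apply]
      simp only [extFun]
      rw [contract_comm (v 0) (v j.succ), extFun_neg, h]
      rw [sub_apply] at h2
      rw [contract_neg_left, neg_apply]
      linear_combination h2

theorem extFun_alternating (n : ℕ) (α : Form A L) (v : Fin n → L) (i j : Fin n)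
    (hv : v i = v j) (hij : i ≠ j) : extFun n α v = 0 := by
  induction n generalizing α with
  | zero => exact i.elim0
  | succ n ih =>
    induction i using Fin.cases with
    | zero =>
      obtain ⟨j, rfl⟩ := Fin.exists_succ_eq.2 hij.symm
      simp only [extFun, hv]
      exact sub_eq_zero.2 (extFun_repeat n α (fun k => v k.succ) j).symm
    | succ i =>
      induction j using Fin.cases with
      | zero =>
        simp only [extFun, ← hv]
        exact sub_eq_zero.2 (extFun_repeat n α (fun k => v k.succ) i).symm
      | succ j =>
        have hij' : i ≠ j := fun h => hij (by rw [h])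
        simp only [extFun, ih _ (fun k => v k.succ) i j hv hij',
          AlternatingMap.map_eq_zero_of_eq _ (fun k : Fin n => v k.succ) hv hij', sub_zero]

/-- The exterior derivative as an additive map. -/
def extDAux : Form A L →+ Form A L where
  toFun α := ⟨fun n =>
    { toFun := extFun n α
      map_update_add' := fun {inst} v i y z => by
        obtain rfl : inst = instDecidableEqFin n := Subsingleton.elim _ _
        exact extFun_update_add n α v i y z
      map_update_smul' := fun {inst} v i a y => by
        obtain rfl : inst = instDecidableEqFin n := Subsingleton.elim _ _
        exact extFun_update_smul n α v i a y
      map_eq_zero_of_eq' := extFun_alternating n α }⟩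
  map_zero' := ext fun n v => extFun_zero n v
  map_add' α β := ext fun n v => extFun_add n α β v

variable (K : Type*) [CommRing K] [Algebra K A] [LieAlgebra K L] [LieRinehartAlgebra K A L]

/-- The exterior derivative `d`; see `extD_apply_succ` for the formula of Koszul. -/
def extD : Form A L →ₗ[K] Form A L :=
  { extDAux with
    map_smul' := fun c α => ext fun n v => by
      have h : (dFun (algebraMap K A c) : Form A L) = 0 := by
        refine ext_contract rfl fun x => ?_
        have : ⁅x, algebraMap K A c⁆ = 0 := by
          exact (LieRinehartAlgebra.anchor K A L x).map_algebraMap c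
        rw [contract_dFun, this, map_zero, map_zero]
      have h2 := extFun_smul n (algebraMap K A c) α v
      rw [h, zero_mul, zero_apply, add_zero, ← algebraMap_smul', ← Algebra.smul_def] at h2
      exact h2 }

/-- The formula of Cartan, `ι_x d = L_x - d ι_x`. -/
theorem contract_extD (x : L) (α : Form A L) :
    contract x (extD K α) = lieD x α - extD K (contract x α) := rfl

theorem extD_apply_zero (α : Form A L) (v : Fin 0 → L) : extD K α 0 v = 0 := rfl

theorem extD_apply_one (α : Form A L) (x : L) : extD K α 1 ![x] = ⁅x, α 0 ![]⁆ :=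
  sub_zero _

/-- The formula of Koszul: `dα(v_0, …, v_n)` is the sum of `(-1)^j v_j(α(…))` over `j`, with `v_j`
left out in `α(…)`, and of `(-1)^j α(…, [v_i, v_j], …)` over `i < j`, where `v_j` is left out and the
bracket stands in the place of `v_i`. -/
theorem extD_apply_succ (α : Form A L) (n : ℕ) (v : Fin (n + 1) → L) :
    extD K α (n + 1) v = ∑ j : Fin (n + 1), (-1) ^ (j : ℕ) *
      (⁅v j, α n (j.removeNth v)⁆ + ∑ i : Fin n with i.castSucc < j,
        α n (Function.update (j.removeNth v) i ⁅v i.castSucc, v j⁆)) := by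
  simp only [Finset.sum_filter]
  induction n generalizing α with
  | zero =>
    have hv : v = ![v 0] := by funext i; rw [Fin.fin_one_eq_zero i]; rfl
    rw [hv, extD_apply_one]
    simp [Subsingleton.elim (Fin.removeNth 0 ![v 0]) ![]]
  | succ n ih =>
    have h1 : extD K α (n + 1 + 1) v = lieD (v 0) α (n + 1) (fun i => v i.succ) -
      extD K (contract (v 0) α) (n + 1) (fun i => v i.succ) := rfl
    have hr : ∀ j : Fin (n + 1), j.succ.removeNth v =
        Matrix.vecCons (v 0) (j.removeNth fun i => v i.succ) := fun j => by
      funext k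
      induction k using Fin.cases <;> simp [Fin.removeNth]
    have hu : ∀ (j : Fin (n + 1)) (w : L), α (n + 1) (Function.update (fun i => v i.succ) j w) =
        (-1) ^ (j : ℕ) * α (n + 1) (Matrix.vecCons w (j.removeNth fun i => v i.succ)) := by
      intro j w
      have := (α (n + 1)).map_insertNth j w (j.removeNth fun i => v i.succ)
      rw [Fin.insertNth_removeNth] at this
      rw [this]
      simp
    have h0 : ∀ (x y : L) (w : Fin n → L), Function.update (Matrix.vecCons x w) 0 y =
        Matrix.vecCons y w := fun x y w => by
      funext k
      induction k using Fin.cases <;> simp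
    have hs : ∀ (x y : L) (w : Fin n → L) (i : Fin n),
        Function.update (Matrix.vecCons x w) i.succ y =
        Matrix.vecCons x (Function.update w i y) := fun x y w i => by
      funext k
      induction k using Fin.cases <;>
        simp [Function.update_apply, (Fin.succ_ne_zero _).symm]
    have hT : ∀ j : Fin (n + 1), (-1) ^ (j.succ : ℕ) *
        (⁅v j.succ, α (n + 1) (j.succ.removeNth v)⁆ + ∑ i : Fin (n + 1),
          if i.castSucc < j.succ then
            α (n + 1) (Function.update (j.succ.removeNth v) i ⁅v i.castSucc, v j.succ⁆) else 0) =
        -α (n + 1) (Function.update (fun i => v i.succ) j ⁅v 0, v j.succ⁆) - (-1) ^ (j : ℕ) *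
          (⁅v j.succ, contract (v 0) α n (j.removeNth fun i => v i.succ)⁆ + ∑ i : Fin n,
            if i.castSucc < j then contract (v 0) α n (Function.update
              (j.removeNth fun i => v i.succ) i ⁅v i.castSucc.succ, v j.succ⁆) else 0) := by
      intro j
      rw [hu, hr, Fin.sum_univ_succ, h0]
      simp only [hs, contract_apply, Fin.val_succ, pow_succ, Fin.castSucc_zero, Fin.succ_pos,
        if_true, Fin.castSucc_succ, Fin.succ_lt_succ_iff]
      ring
    rw [h1, ih, lieD_apply, Fin.sum_univ_succ (n := n + 1), Finset.sum_congr rfl fun j _ => hT j,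
      Finset.sum_sub_distrib, Finset.sum_neg_distrib]
    have hz : (Fin.removeNth 0 v : Fin (n + 1) → L) = fun i => v i.succ := by
      funext k; simp [Fin.removeNth]
    simp only [hz, Fin.not_lt_zero, if_false, Finset.sum_const_zero, Fin.val_zero, pow_zero]
    ring

theorem extD_sgn (α : Form A L) : extD K (sgn α) = -sgn (extD K α) := by
  have key : ∀ (n : ℕ) (α : Form A L) (v : Fin n → L),
      extFun n (sgn α) v = -((-1) ^ n * extFun n α v) := by
    intro n
    induction n with
    | zero => intro α v; simp [extFun]
    | succ n ih =>
      intro α v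
      have h : lieD (v 0) (sgn α) n (fun i => v i.succ) =
          (-1) ^ n * lieD (v 0) α n (fun i => v i.succ) := by
        rw [lieD_apply, lieD_apply]
        rcases neg_one_pow_eq_or A n with h | h <;> simp [h] <;> ring
      simp only [extFun, contract_sgn, extFun_neg, ih, h, pow_succ]
      ring
  exact ext (key · α)

end Lie
end Form

/-! ### Smooth functions and vector fields on a manifold -/

section VectorFields

variable {n : ℕ} {H : Type*} [TopologicalSpace H]
  (I : ModelWithCorners ℝ (EuclideanSpace ℝ (Fin n)) H)
  (W : Type*) [TopologicalSpace W] [ChartedSpace H W]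

/-- The ring `C^∞(W)` of smooth real functions. -/
abbrev Fn := C^∞⟮I, W; 𝓘(ℝ, ℝ), ℝ⟯

/-- The smooth vector fields on `W`. -/
abbrev VField [IsManifold I ∞ W] :=
  Cₛ^∞⟮I; EuclideanSpace ℝ (Fin n), (TangentSpace I : W → Type _)⟯

variable {I W} [IsManifold I ∞ W]

instance : IsManifold I (minSmoothness ℝ 3) W := by
  rw [minSmoothness_of_isRCLikeNormedField]; infer_instance

theorem two_le : minSmoothness ℝ 2 ≤ (∞ : WithTop ℕ∞) := by
  rw [minSmoothness_of_isRCLikeNormedField]; exact ENat.LEInfty.out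

namespace VField

instance : SMul (Fn I W) (VField I W) :=
  ⟨fun φ X => ⟨fun x => φ x • X x, φ.contMDiff.smul_section X.contMDiff⟩⟩

@[simp] theorem smul_apply (φ : Fn I W) (X : VField I W) (x : W) : (φ • X) x = φ x • X x := rfl

instance : Module (Fn I W) (VField I W) where
  one_smul X := ContMDiffSection.ext fun x => one_smul ℝ (X x)
  mul_smul φ ψ X := ContMDiffSection.ext fun x => mul_smul (φ x) (ψ x) (X x)
  smul_zero φ := ContMDiffSection.ext fun x => smul_zero (φ x)
  smul_add φ X Y := ContMDiffSection.ext fun x => smul_add (φ x) (X x) (Y x)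
  add_smul φ ψ X := ContMDiffSection.ext fun x => add_smul (φ x) (ψ x) (X x)
  zero_smul X := ContMDiffSection.ext fun x => zero_smul ℝ (X x)

theorem contMDiff_mlieBracket (X Y : VField I W) :
    ContMDiff I I.tangent ∞
      (fun x => (⟨x, VectorField.mlieBracket I X Y x⟩ : TangentBundle I W)) :=
  haveI : IsManifold I ((⊤ : ℕ∞) + 1) W := by
    exact inferInstanceAs (IsManifold I ∞ W)
  ContDiff.mlieBracket_vectorField (n := ⊤) (m := ⊤) X.contMDiff Y.contMDiff
    (by rw [minSmoothness_of_isRCLikeNormedField]; exact le_rfl)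

instance : Bracket (VField I W) (VField I W) :=
  ⟨fun X Y => ⟨VectorField.mlieBracket I X Y, contMDiff_mlieBracket X Y⟩⟩

theorem lie_apply (X Y : VField I W) (x : W) : ⁅X, Y⁆ x = VectorField.mlieBracket I X Y x := rfl

theorem coe_lie (X Y : VField I W) : (⇑⁅X, Y⁆ : ∀ x, TangentSpace I x) =
    VectorField.mlieBracket I X Y := rfl

instance : LieRing (VField I W) where
  add_lie X Y Z := ContMDiffSection.ext fun x =>
    VectorField.mlieBracket_add_left X.mdifferentiableAt Y.mdifferentiableAt
  lie_add X Y Z := ContMDiffSection.ext fun x =>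
    VectorField.mlieBracket_add_right Y.mdifferentiableAt Z.mdifferentiableAt
  lie_self X := ContMDiffSection.ext fun x => by
    rw [lie_apply, VectorField.mlieBracket_self]; rfl
  leibniz_lie X Y Z := ContMDiffSection.ext fun x =>
    VectorField.leibniz_identity_mlieBracket_apply
      (X.contMDiff.contMDiffAt.of_le two_le) (Y.contMDiff.contMDiffAt.of_le two_le)
      (Z.contMDiff.contMDiffAt.of_le two_le)

instance : LieAlgebra ℝ (VField I W) where
  lie_smul _ _ Y := ContMDiffSection.ext fun _ =>
    VectorField.mlieBracket_const_smul_right Y.mdifferentiableAt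

theorem contMDiff_mvfderiv (X : VField I W) (φ : Fn I W) :
    ContMDiff I 𝓘(ℝ, ℝ) ∞ (fun x => mvfderiv I φ x (X x)) :=
  (contMDiff_snd_tangentBundle_modelSpace ℝ 𝓘(ℝ, ℝ)).comp
    ((φ.contMDiff.contMDiff_tangentMap (m := ∞) le_rfl).comp X.contMDiff)

instance : Bracket (VField I W) (Fn I W) :=
  ⟨fun X φ => ⟨fun x => mvfderiv I φ x (X x), contMDiff_mvfderiv X φ⟩⟩

theorem lie_fn_apply (X : VField I W) (φ : Fn I W) (x : W) : ⁅X, φ⁆ x = mvfderiv I φ x (X x) := rfl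

theorem mdiffAt (φ : Fn I W) (x : W) : MDifferentiableAt I 𝓘(ℝ, ℝ) φ x :=
  φ.contMDiff.mdifferentiable (by simp) x

theorem lie_fn_smul (X Y : VField I W) (φ : Fn I W) :
    ⁅X, φ • Y⁆ = φ • ⁅X, Y⁆ + ⁅X, φ⁆ • Y := 
  ContMDiffSection.ext fun x => by
    have := VectorField.mlieBracket_smul_right (V := X) (mdiffAt φ x) (Y.mdifferentiableAt (x := x))
    rw [add_comm] at this
    exact this

theorem lie_fn_add (X : VField I W) (φ ψ : Fn I W) : ⁅X, φ + ψ⁆ = ⁅X, φ⁆ + ⁅X, ψ⁆ :=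
  ContMDiffMap.ext fun x => by
    have := mvfderiv_add (mdiffAt φ x) (mdiffAt ψ x)
    exact congrArg (fun A => A (X x)) this

/-- Brackets of vector fields act on functions by commutators. -/
theorem lie_fn_commutator (X Y : VField I W) (φ : Fn I W) :
    ⁅X, ⁅Y, φ⁆⁆ = ⁅⁅X, Y⁆, φ⁆ + ⁅Y, ⁅X, φ⁆⁆ := by
  have key : ∀ Z : VField I W, ⁅X, ⁅Y, φ⁆⁆ • Z = (⁅⁅X, Y⁆, φ⁆ + ⁅Y, ⁅X, φ⁆⁆) • Z := by
    intro Z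
    have h := leibniz_lie X Y (φ • Z)
    simp only [lie_fn_smul, lie_add] at h
    rw [leibniz_lie X Y Z, smul_add] at h
    rw [add_smul]
    have h' : (⁅X, ⁅Y, φ⁆⁆ • Z + φ • ⁅⁅X, Y⁆, Z⁆ + φ • ⁅Y, ⁅X, Z⁆⁆ + ⁅X, φ⁆ • ⁅Y, Z⁆ +
        ⁅Y, φ⁆ • ⁅X, Z⁆) = ⁅⁅X, Y⁆, φ⁆ • Z + ⁅Y, ⁅X, φ⁆⁆ • Z + φ • ⁅⁅X, Y⁆, Z⁆ +
        φ • ⁅Y, ⁅X, Z⁆⁆ + ⁅X, φ⁆ • ⁅Y, Z⁆ + ⁅Y, φ⁆ • ⁅X, Z⁆ := by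
      refine Eq.trans ?_ (h.trans ?_) <;> abel
    simpa only [add_left_inj] using h'
  refine ContMDiffMap.ext fun x => ?_
  by_cases hX : X x = 0
  · by_cases hY : Y x = 0
    · have hXY : ⁅X, Y⁆ x = 0 := by
        have := VectorField.mlieBracketWithin_eq_zero_of_eq_zero (I := I) (s := Set.univ) hX hY
        rwa [VectorField.mlieBracketWithin_univ] at this
      change mvfderiv I (⁅Y, φ⁆ : Fn I W) x (X x) =
        mvfderiv I φ x (⁅X, Y⁆ x) + mvfderiv I (⁅X, φ⁆ : Fn I W) x (Y x)
      rw [hX, hY, hXY, map_zero, map_zero, map_zero, add_zero]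
    · exact smul_left_injective ℝ hY (congrArg (fun Z : VField I W => Z x) (key Y))
  · exact smul_left_injective ℝ hX (congrArg (fun Z : VField I W => Z x) (key X))

instance : LieRingModule (VField I W) (Fn I W) where
  add_lie X Y φ := ContMDiffMap.ext fun x => map_add (mvfderiv I φ x) (X x) (Y x)
  lie_add := lie_fn_add
  leibniz_lie := lie_fn_commutator

instance : LieRinehartRing (Fn I W) (VField I W) where
  lie_smul_eq_mul' φ ψ X := ContMDiffMap.ext fun x => map_smul (mvfderiv I ψ x) (φ x) (X x)
  leibniz_mul_right' X φ ψ := ContMDiffMap.ext fun x => by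
    have := congrArg (fun A => A (X x)) (mvfderiv_mul (mdiffAt φ x) (mdiffAt ψ x))
    refine Eq.trans this ?_
    change φ x * _ + ψ x * _ = φ x * _ + _ * ψ x
    rw [mul_comm (ψ x)]; rfl
  leibniz_smul_right' X Y φ := lie_fn_smul X Y φ

theorem lie_fn_const_smul (X : VField I W) (c : ℝ) (φ : Fn I W) : ⁅X, c • φ⁆ = c • ⁅X, φ⁆ :=
  ContMDiffMap.ext fun x => by
    have h := congrArg (fun A => A (X x))
      (mvfderiv_mul (mdiffAt (algebraMap ℝ (Fn I W) c) x) (mdiffAt φ x))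
    have h2 : mvfderiv I (algebraMap ℝ (Fn I W) c) x = 0 := mvfderiv_const c
    rw [h2, smul_zero, add_zero] at h
    exact h

instance : LieRinehartAlgebra ℝ (Fn I W) (VField I W) where
  smul_assoc c φ X := ContMDiffSection.ext fun x => smul_assoc c (φ x) (X x)
  smul_lie c X φ := ContMDiffMap.ext fun x => map_smul (mvfderiv I φ x) c (X x)
  lie_smul c X φ := lie_fn_const_smul X c φ

end VField
end VectorFields

/-! ### Smooth actions of a Lie group -/

section Equivariant

variable {d n : ℕ} {H : Type*} [TopologicalSpace H]
  (I : ModelWithCorners ℝ (EuclideanSpace ℝ (Fin n)) H)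
  (G : Type*) [Group G] [TopologicalSpace G] [ChartedSpace (EuclideanSpace ℝ (Fin d)) G]
  [LieGroup (𝓡 d) ∞ G]
  (W : Type*) [TopologicalSpace W] [ChartedSpace H W] [IsManifold I ∞ W]
  [MulAction G W] [ContMDiffSMul (𝓡 d) I ∞ G W]

instance : LieGroup (𝓡 d) (minSmoothness ℝ 3) G := by
  rw [minSmoothness_of_isRCLikeNormedField]; infer_instance

variable {G}

/-- The adjoint representation of `G` on its Lie algebra `g = T_1 G`. -/
def Ad (g : G) : GroupLieAlgebra (𝓡 d) G →ₗ[ℝ] GroupLieAlgebra (𝓡 d) G where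
  toFun ξ := mfderiv (𝓡 d) (𝓡 d) (fun h : G => g * h * g⁻¹) 1 ξ
  map_add' ξ η := map_add (mfderiv (𝓡 d) (𝓡 d) (fun h : G => g * h * g⁻¹) 1) ξ η
  map_smul' c ξ := map_smul (mfderiv (𝓡 d) (𝓡 d) (fun h : G => g * h * g⁻¹) 1) c ξ

variable {W}

/-- The value at `x` of the fundamental vector field of `ξ`, which is the derivative at `t = 0` of
`exp(-tξ) • x`. With this sign `ξ ↦ X_ξ` is a homomorphism of Lie algebras, for the bracket of
left-invariant vector fields on `g`. Its kernel is the Lie algebra of the stabilizer of `x`. -/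
def infAction (x : W) : GroupLieAlgebra (𝓡 d) G →ₗ[ℝ] TangentSpace I x where
  toFun ξ := -(mfderiv (𝓡 d) I (fun g : G => g • x) 1 ξ)
  map_add' ξ η := by
    rw [map_add]; exact neg_add _ _
  map_smul' c ξ := by
    rw [map_smul]; exact (smul_neg c _).symm

theorem contMDiff_infAction (ξ : GroupLieAlgebra (𝓡 d) G) :
    ContMDiff I I.tangent ∞ (fun x : W => (⟨x, infAction I x ξ⟩ : TangentBundle I W)) := by
  have hs : ContMDiff ((𝓡 d).prod I) I ∞ (fun p : G × W => p.1 • p.2) := contMDiff_smul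
  let F₁ : W → TangentBundle (𝓡 d) G × TangentBundle I W := fun x =>
    (⟨1, -ξ⟩, ⟨x, 0⟩)
  have S₁ : ContMDiff I ((𝓡 d).tangent.prod I.tangent) ∞ F₁ :=
    contMDiff_const.prodMk (Bundle.contMDiff_zeroSection ℝ (TangentSpace I : W → Type _))
  have S₂ := (contMDiff_equivTangentBundleProd_symm (I := 𝓡 d) (M := G) (I' := I) (M' := W)
    (n := ∞)).comp S₁
  have S₃ := (hs.contMDiff_tangentMap (m := ∞) le_rfl).comp S₂
  convert! S₃ with x
  · simp [F₁]
  · simp only [Function.comp_apply, tangentMap, F₁]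
    rw [mfderiv_prod_eq_add_apply (hs.mdifferentiableAt (by simp))]
    have h : -(mfderiv (𝓡 d) I (fun g : G => g • x) 1 ξ) =
        mfderiv (𝓡 d) I (fun g : G => g • x) 1 (-ξ) +
          mfderiv I I (fun z : W => (1 : G) • z) x 0 := by
      rw [map_neg, map_zero]
      exact (add_zero _).symm
    exact h

/-- The fundamental vector field of `ξ`. -/
def fundField (ξ : GroupLieAlgebra (𝓡 d) G) : VField I W :=
  ⟨fun x => infAction I x ξ, contMDiff_infAction I ξ⟩

theorem isInvertible_mfderiv_smul (g : G) (x : W) :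
    (mfderiv I I (Diffeomorph.smul (𝓡 d) I (M := W) ∞ g) x).IsInvertible :=
  ⟨(Diffeomorph.smul (𝓡 d) I (M := W) ∞ g).mfderivToContinuousLinearEquiv (by simp) x, rfl⟩

variable (d) in
/-- Pullback of a vector field under the diffeomorphism `x ↦ g • x`. -/
def pullField (g : G) (X : VField I W) : VField I W :=
  ⟨VectorField.mpullback I I (fun y : W => g • y) X,
    ContMDiff.mpullback_vectorField (n := ∞) X.contMDiff
     (ContMDiffSMul.contMDiff_const_smul (I := 𝓡 d) g)
     (isInvertible_mfderiv_smul (d := d) I g) le_rfl⟩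

variable (d) in
/-- Pullback of a function under `x ↦ g • x`. -/
def pullFn (g : G) (φ : Fn I W) : Fn I W :=
  ⟨fun x => φ (g • x), φ.contMDiff.comp (ContMDiffSMul.contMDiff_const_smul (I := 𝓡 d) g)⟩

theorem pullField_add (g : G) (X Y : VField I W) :
    pullField d I g (X + Y) = pullField d I g X + pullField d I g Y :=
  ContMDiffSection.ext fun x => map_add (mfderiv I I (fun y : W => g • y) x).inverse _ _

theorem pullField_smul (g : G) (φ : Fn I W) (X : VField I W) :
    pullField d I g (φ • X) = pullFn d I g φ • pullField d I g X :=
  ContMDiffSection.ext fun x => map_smul (mfderiv I I (fun y : W => g • y) x).inverse _ _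

theorem pullFn_inv_pullFn (g : G) (φ : Fn I W) : pullFn d I g⁻¹ (pullFn d I g φ) = φ :=
  ContMDiffMap.ext fun x => congrArg φ (smul_inv_smul g x)

variable (d W) in
/-- The action of `g` on differential forms, `g • α = (g⁻¹)^* α`. -/
def formAction (g : G) : Form (Fn I W) (VField I W) →ₗ[ℝ] Form (Fn I W) (VField I W) where
  toFun α := ⟨fun k =>
    { toFun := fun v => pullFn d I g⁻¹ (α k fun i => pullField d I g (v i))
      map_update_add' := fun v i X Y => by
        have h : ∀ Z, (fun j => pullField d I g (Function.update v i Z j)) =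
            Function.update (fun j => pullField d I g (v j)) i (pullField d I g Z) := fun Z => by
          funext j; simp only [Function.update_apply]; split_ifs <;> rfl
        rw [h, h, h, pullField_add, (α k).map_update_add]
        rfl
      map_update_smul' := fun v i φ X => by
        have h : ∀ Z, (fun j => pullField d I g (Function.update v i Z j)) =
            Function.update (fun j => pullField d I g (v j)) i (pullField d I g Z) := fun Z => by
          funext j; simp only [Function.update_apply]; split_ifs <;> rfl
        rw [h, h, pullField_smul, (α k).map_update_smul]
        conv_rhs => rw [← pullFn_inv_pullFn (d := d) I g φ]
        rfl
      map_eq_zero_of_eq' := fun v i j hv hij => by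
        rw [(α k).map_eq_zero_of_eq _ (congrArg (pullField d I g) hv) hij]
        rfl }⟩
  map_add' α β := rfl
  map_smul' c α := rfl

variable (d G W)

/-! ### The Cartan model of equivariant cohomology -/

/-- The algebra `S(g*)` of polynomials on the Lie algebra `g` of `G`. -/
def SymDual := SymmetricAlgebra ℝ (Module.Dual ℝ (GroupLieAlgebra (𝓡 d) G))

instance : CommRing (SymDual d G) :=
  inferInstanceAs (CommRing (SymmetricAlgebra ℝ (Module.Dual ℝ (GroupLieAlgebra (𝓡 d) G))))

instance : Algebra ℝ (SymDual d G) :=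
  inferInstanceAs (Algebra ℝ (SymmetricAlgebra ℝ (Module.Dual ℝ (GroupLieAlgebra (𝓡 d) G))))

/-- The inclusion `g* → S(g*)`. -/
def SymDual.gen : Module.Dual ℝ (GroupLieAlgebra (𝓡 d) G) →ₗ[ℝ] SymDual d G :=
  SymmetricAlgebra.ι ℝ _

variable {d G}

/-- The extension of a linear map from `g*` to a commutative algebra to an algebra homomorphism from
`S(g*)`. -/
def SymDual.lift {R : Type*} [CommRing R] [Algebra ℝ R]
    (φ : Module.Dual ℝ (GroupLieAlgebra (𝓡 d) G) →ₗ[ℝ] R) : SymDual d G →ₐ[ℝ] R :=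
  SymmetricAlgebra.lift φ

@[simp] theorem SymDual.lift_gen {R : Type*} [CommRing R] [Algebra ℝ R]
    (φ : Module.Dual ℝ (GroupLieAlgebra (𝓡 d) G) →ₗ[ℝ] R)
    (l : Module.Dual ℝ (GroupLieAlgebra (𝓡 d) G)) : SymDual.lift φ (SymDual.gen d G l) = φ l :=
  SymmetricAlgebra.lift_ι_apply _ l

variable (d G)

/-- The algebra `Ω(W)` of smooth differential forms on `W`. -/
def DiffForm (I : ModelWithCorners ℝ (EuclideanSpace ℝ (Fin n)) H) (W : Type*)
    [TopologicalSpace W] [ChartedSpace H W] [IsManifold I ∞ W] := Form (Fn I W) (VField I W)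

instance : Ring (DiffForm I W) := inferInstanceAs (Ring (Form (Fn I W) (VField I W)))

instance : Algebra ℝ (DiffForm I W) := inferInstanceAs (Algebra ℝ (Form (Fn I W) (VField I W)))

/-- The algebra `S(g*) ⊗ Ω(W)`. -/
abbrev SymForms := SymDual d G ⊗[ℝ] DiffForm I W

variable {d G}

/-- The element `s ⊗ α` of `S(g*) ⊗ Ω(W)`. -/
abbrev elem (s : SymDual d G) (α : DiffForm I W) : SymForms d I G W := s ⊗ₜ[ℝ] α

/-- The coadjoint action of `g` on `S(g*)`, which is `l ↦ l ∘ Ad g⁻¹` on `g*`. -/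
def coAd (g : G) : SymDual d G →ₐ[ℝ] SymDual d G :=
  SymDual.lift (SymDual.gen d G ∘ₗ (Ad g⁻¹).dualMap)

/-- The action of `g` on `S(g*) ⊗ Ω(W)`. -/
def symFormsAction (g : G) : SymForms d I G W →ₗ[ℝ] SymForms d I G W :=
  TensorProduct.map (coAd g).toLinearMap (formAction d I W g)

variable (d G)

/-- The algebra `S(g*)^G` of invariant polynomials. -/
def invPoly : Subalgebra ℝ (SymDual d G) :=
  ⨅ g : G, AlgHom.equalizer (coAd g) (AlgHom.id ℝ _)

/-- The equivariant differential forms `Ω_G(W) = (S(g*) ⊗ Ω(W))^G`. -/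
def equivForms : Submodule ℝ (SymForms d I G W) :=
  ⨅ g : G, LinearMap.eqLocus (symFormsAction I W g) LinearMap.id

variable {d G} {ι : Type*} [Fintype ι] (b : Module.Basis ι ℝ (GroupLieAlgebra (𝓡 d) G))

/-- The generators `Θ^a` of `S(g*)`, which form the basis of `g*` dual to the basis `b` of `g`. -/
def theta (a : ι) : SymDual d G := SymDual.gen d G (b.coord a)

/-- The Cartan differential `D = 1 ⊗ d - ∑_a Θ^a ⊗ ι_a`, where `ι_a` is the contraction with the
fundamental vector field of `b a`. -/
def cartanD : SymForms d I G W →ₗ[ℝ] SymForms d I G W :=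
  TensorProduct.map LinearMap.id (Form.extD ℝ) -
    ∑ a, TensorProduct.map (LinearMap.mulLeft ℝ (theta b a))
      ((Form.contract (fundField I (b a))).restrictScalars ℝ)

/-- The `D`-closed equivariant forms. -/
def cocycles : Submodule ℝ (SymForms d I G W) :=
  equivForms d I G W ⊓ LinearMap.ker (cartanD I W b)

/-- The forms `D β` with `β` equivariant. -/
def coboundaries : Submodule ℝ (SymForms d I G W) :=
  (equivForms d I G W).map (cartanD I W b)

/-- The equivariant cohomology `H_G(W)`, the cohomology of the complex `(Ω_G(W), D)`. -/
abbrev EquivCohomology := cocycles I W b ⧸ (coboundaries I W b).submoduleOf (cocycles I W b)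

/-- The map `S(g*)^G → H_G(W)` induced by a map `Φ : S(g*) → S(g*) ⊗ Ω(W)` that sends invariant
polynomials to closed equivariant forms. -/
def inducedMap (Φ : SymDual d G →ₐ[ℝ] SymForms d I G W)
    (hΦ : ∀ F ∈ invPoly d G, Φ F ∈ cocycles I W b) : invPoly d G →ₗ[ℝ] EquivCohomology I W b :=
  Submodule.mkQ _ ∘ₗ Φ.toLinearMap.restrict (p := Subalgebra.toSubmodule (invPoly d G)) hΦ

/-- The map `S(g*) → S(g*) ⊗ Ω(W)`, `F ↦ F ⊗ 1`. -/
def inclC : SymDual d G →ₐ[ℝ] SymForms d I G W := Algebra.TensorProduct.includeLeft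

/-! ### Degenerate principal bundles and the degenerate Chern-Weil map -/

variable (d G)

/-- The set `W^s` of the points whose stabilizer has positive dimension, that is, whose stabilizer
has a non-zero Lie algebra. -/
def singularSet : Set W :=
  {x | 0 < Module.finrank ℝ (LinearMap.ker (infAction (d := d) (G := G) I x))}

/-- The action of `G` on `W` is locally free on an open set that contains the boundary. -/
def IsDegeneratePrincipalBundle : Prop :=
  ∃ U : Set W, IsOpen U ∧ I.boundary W ⊆ U ∧ ∀ x ∈ U, x ∉ singularSet d I G W

/-- The `G`-invariant smooth functions `W → [0, 1]` that vanish on a neighbourhood of `W^s`. -/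
structure CutOff where
  /-- The underlying smooth function. -/
  toFn : Fn I W
  mem_Icc : ∀ x, toFn x ∈ Set.Icc (0 : ℝ) 1
  invariant : ∀ (g : G) (x : W), toFn (g • x) = toFn x
  vanish : ∃ U : Set W, IsOpen U ∧ singularSet d I G W ⊆ U ∧ ∀ x ∈ U, toFn x = 0

/-- The connections on the open subset `W \ W^s`, on which the action is locally free: the smooth
equivariant `g`-valued one-forms `ω` with `ω(X_ξ) = ξ`. Only the values of `form` at the points
outside `W^s` matter, and nothing is required of the others. -/
structure Connection where
  /-- The underlying pointwise one-form. -/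
  form : ∀ x : W, TangentSpace I x →ₗ[ℝ] GroupLieAlgebra (𝓡 d) G
  smooth : ∀ x ∉ singularSet d I G W, ∀ (X : VField I W)
    (l : Module.Dual ℝ (GroupLieAlgebra (𝓡 d) G)),
      ContMDiffAt I 𝓘(ℝ, ℝ) ∞ (fun y => l (form y (X y))) x
  equivariant : ∀ x ∉ singularSet d I G W, ∀ (g : G) (v : TangentSpace I x),
    form (g • x) (mfderiv I I (fun y : W => g • y) x v) = Ad g (form x v)
  vertical : ∀ x ∉ singularSet d I G W, ∀ ξ : GroupLieAlgebra (𝓡 d) G,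
    form x (infAction I x ξ) = ξ

variable {d I G W}

/-- The component `l(ω_f)` of `ω_f = f ω`, for `l` in `g*`, as a functional on the vector fields.
It is smooth on all of `W`, as `f` vanishes near `W^s`. -/
def cutOffForm (f : CutOff d I G W) (η : Connection d I G W)
    (l : Module.Dual ℝ (GroupLieAlgebra (𝓡 d) G)) : VField I W →ₗ[Fn I W] Fn I W where
  toFun X := ⟨fun x => f.toFn x * l (η.form x (X x)), fun x => by
    by_cases hx : x ∈ singularSet d I G W
    · obtain ⟨U, hU, hs, hf⟩ := f.vanish
      refine (contMDiffAt_const (c := (0 : ℝ))).congr_of_eventuallyEq ?_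
      filter_upwards [hU.mem_nhds (hs hx)] with y hy
      rw [hf y hy, zero_mul]
    · exact f.toFn.contMDiff.contMDiffAt.mul (η.smooth x hx X l)⟩
  map_add' X Y := ContMDiffMap.ext fun x => by
    change f.toFn x * l (η.form x (X x + Y x)) = _
    rw [map_add, map_add, mul_add]; rfl
  map_smul' φ X := ContMDiffMap.ext fun x => by
    change f.toFn x * l (η.form x (φ x • X x)) = _
    rw [map_smul, map_smul, smul_eq_mul, mul_left_comm]; rfl

variable (f : CutOff d I G W) (η : Connection d I G W)

/-- The components `ω_f^a` of `ω_f = f ω` in the basis `b`. -/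
def degConnection (a : ι) : Form (Fn I W) (VField I W) :=
  Form.ofOne (cutOffForm f η (b.coord a))

/-- The components of `dω_f + ½ [ω_f, ω_f]`, where
`[ω_f, ω_f] = ∑_{p,q} [b p, b q] ω_f^p ∧ ω_f^q`. -/
def degCurvatureForm (a : ι) : Form (Fn I W) (VField I W) :=
  Form.extD ℝ (degConnection b f η a) + (1 / 2 : ℝ) • ∑ p, ∑ q, b.repr ⁅b p, b q⁆ a •
    (degConnection b f η p * degConnection b f η q)

/-- The components of `Ω_f^G = dω_f + ½ [ω_f, ω_f] - (-1 + f) ∑_a ξ_a Θ^a`. -/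
def degCurvature (a : ι) : SymForms d I G W :=
  elem I W 1 (degCurvatureForm b f η a) - elem I W (theta b a) (Form.ofFun (-1 + f.toFn))

theorem degCurvatureForm_even (a : ι) :
    Form.sgn (degCurvatureForm b f η a) = degCurvatureForm b f η a := by
  have h : ∀ (c : ℝ) (α : Form (Fn I W) (VField I W)), Form.sgn (c • α) = c • Form.sgn α :=
    fun c α => map_smul (Form.sgn.restrictScalars ℝ) c α
  have h1 := Form.extD_sgn ℝ (degConnection b f η a)
  simp only [degCurvatureForm, degConnection, map_add, map_sum, h, Form.sgn_mul, Form.sgn_ofOne,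
    neg_mul_neg, map_neg, neg_inj] at h1 ⊢
  rw [← h1]

theorem degCurvature_mem_center (a : ι) :
    degCurvature b f η a ∈ Subalgebra.center ℝ (SymForms d I G W) := by
  have key : ∀ (s : SymDual d G) (α : DiffForm I W),
      Form.sgn (A := Fn I W) (L := VField I W) α = α →
      s ⊗ₜ[ℝ] α ∈ Subalgebra.center ℝ (SymForms d I G W) := by
    intro s α hα
    rw [Subalgebra.mem_center_iff]
    intro t
    induction t with
    | zero => rw [zero_mul, mul_zero]
    | add x y hx hy => rw [add_mul, mul_add, hx, hy]
    | tmul s' β =>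
      have h : α * β = β * α := Form.commute_of_even (A := Fn I W) (L := VField I W) hα β
      rw [Algebra.TensorProduct.tmul_mul_tmul, Algebra.TensorProduct.tmul_mul_tmul, mul_comm s, h]
  exact sub_mem (key _ _ (degCurvatureForm_even b f η a)) (key _ _ (Form.sgn_ofFun _))

/-- The degenerate Chern-Weil map `CW_f : F ↦ F(Ω_f^G)`, that is, the algebra homomorphism with
`Θ^a ↦ (Ω_f^G)^a`. These elements have even degree, so they are central, and the substitution makes
sense; see `chernWeil_theta`. -/
def chernWeil : SymDual d G →ₐ[ℝ] SymForms d I G W :=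
  (Subalgebra.center ℝ (SymForms d I G W)).val.comp <| SymDual.lift
    (∑ a, ((LinearMap.applyₗ (b a)).smulRight
      (⟨degCurvature b f η a, degCurvature_mem_center b f η a⟩ :
        Subalgebra.center ℝ (SymForms d I G W)) :
          Module.Dual ℝ (GroupLieAlgebra (𝓡 d) G) →ₗ[ℝ] _))

theorem chernWeil_theta (a : ι) : chernWeil b f η (theta b a) = degCurvature b f η a := by
  classical
  simp [chernWeil, theta, Finsupp.single_apply]

end Equivariant
end
end DegCW

/-! Write `R = S(g*) ⊗ Ω(W)` and let `A` be the `g`-valued odd element of `R` with components `A^a =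
1 ⊗ ω_f^a`. Contracting `ω_f^a` with the fundamental field of `ξ_b` gives `f` if `a = b` and zero
otherwise, so `D A^a = dω_f^a - f Θ^a`, and therefore `Ω_f^G = Θ + D A + ½[A, A]`. Replacing `A` by
`X A` only in the last two terms' natural weights gives the path `Ω_X = Θ + X D A + ½ X² [A, A]` in
`R[X]`. It runs from `Θ`, which produces `F ⊗ 1`, to `Ω_f^G`, which produces `CW_f(F)`. The theorem
is the Chern-Weil homotopy argument for this path.

Equivariance of `ω_f` gives `D² A = [Θ, A]`. Together with `[[A, A], A] = 0` this yields the Bianchi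
identity `D Ω_X = X [Ω_X, A]`. An invariant `F` is annihilated by the infinitesimal coadjoint
action, hence `D F(Ω_X) = 0` (`D_subst`) and `d/dX F(Ω_X) = D (∑_a ∂_a F(Ω_X) A^a)`
(`derivative_subst`). Integration over `[0, 1]` exhibits `CW_f(F) - F ⊗ 1` as `D` of an equivariant
form. All is polynomial in `X`, so integrating means dividing coefficients by `k + 1`
(`eval_one_sub_coeff_zero`).

The algebra needs only the data of `OddConnection`; the geometry enters through `cartanD_connForm`
and `cartanD_cartanD_connForm`. The latter rests on `L_ξ ω_f = -ad_ξ ω_f` (`lieD_ofOne_cutOffForm`),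
which is the equivariance of `ω` differentiated along a curve in `G` with velocity `-ξ`. For this
the bracket of vector fields has to be recognised as a derivative of pullbacks
(`hasDerivAt_of_mfderiv_apply_eq`). At points of `W^s` the pointwise identities for `ω_f` hold
because `f` vanishes there and is invariant. -/

namespace DegCW

noncomputable section

/-! ### The Lie bracket as the derivative of a pullback. -/

section Flow

open Set Filter Topology VectorField

/-- If `F t` is a family of maps with `F 0 = id` and velocity `X` at `t = 0`, then the pullback of a
vector field `Y` under `F t` has the derivative `[X, Y]` at `t = 0`. -/
theorem hasDerivAt_of_fderivWithin_apply_eq {E : Type*} [NormedAddCommGroup E] [NormedSpace ℝ E]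
    [CompleteSpace E] {s : Set E} (hs : UniqueDiffOn ℝ s) {y₀ : E} (hy : y₀ ∈ s)
    (hy' : y₀ ∈ closure (interior s)) {F : ℝ × E → E}
    (hF : ContDiffWithinAt ℝ 2 F (univ ×ˢ s) (0, y₀))
    (h0 : ∀ᶠ y in 𝓝[s] y₀, F (0, y) = y) (hmaps : ∀ᶠ t in 𝓝 (0 : ℝ), F (t, y₀) ∈ s)
    {X Y : E → E} (hX : ∀ᶠ y in 𝓝[s] y₀, HasDerivAt (fun t => F (t, y)) (X y) 0)
    (hY : DifferentiableWithinAt ℝ Y s y₀) {Z : ℝ → E}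
    (hZ : ∀ᶠ t in 𝓝 (0 : ℝ), fderivWithin ℝ (fun y => F (t, y)) s y₀ (Z t) = Y (F (t, y₀))) :
    HasDerivAt Z (lieBracketWithin ℝ X Y s y₀) 0 := by
  set S : Set (ℝ × E) := univ ×ˢ s with hS
  have hSu : UniqueDiffOn ℝ S := uniqueDiffOn_univ.prod hs
  have hmem : ((0 : ℝ), y₀) ∈ S := ⟨mem_univ _, hy⟩
  set G := fderivWithin ℝ F S with hG
  have hGd : DifferentiableWithinAt ℝ G S (0, y₀) :=
    (hF.fderivWithin_right hSu (m := 1) (by norm_num) hmem).differentiableWithinAt (by norm_num)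
  set G' := fderivWithin ℝ G S (0, y₀) with hG'
  have hGd' : HasFDerivWithinAt G G' S (0, y₀) := hGd.hasFDerivWithinAt
  -- The heart of the matter: the time derivative of `D_y F` equals the space derivative of the
  -- velocity `X`.
  have hsymm : IsSymmSndFDerivWithinAt ℝ F S (0, y₀) := by
    refine hF.isSymmSndFDerivWithinAt (by simp) hSu ?_ hmem
    rw [hS, interior_prod_eq, closure_prod_eq]
    exact ⟨by simp, hy'⟩
  have hdiff : ∀ᶠ p in 𝓝[S] (0, y₀), HasFDerivWithinAt F (G p) S p := by
    have := hF.eventually (by simp)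
    rw [insert_eq_of_mem hmem] at this
    filter_upwards [this] with p hp
    exact (hp.differentiableWithinAt (by norm_num)).hasFDerivWithinAt
  have ht : Tendsto (fun t : ℝ => (t, y₀)) (𝓝 0) (𝓝[S] (0, y₀)) :=
    tendsto_nhdsWithin_iff.2 ⟨(Continuous.prodMk_left y₀).tendsto 0,
      Eventually.of_forall fun t => ⟨mem_univ _, hy⟩⟩
  have hyt : Tendsto (fun y : E => ((0 : ℝ), y)) (𝓝[s] y₀) (𝓝[S] (0, y₀)) :=
    tendsto_nhdsWithin_iff.2 ⟨((Continuous.prodMk_right (0 : ℝ)).tendsto y₀).mono_left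
      nhdsWithin_le_nhds, eventually_mem_nhdsWithin.mono fun y h => ⟨mem_univ _, h⟩⟩
  -- the partial derivatives
  have hL : ∀ t, HasFDerivWithinAt F (G (t, y₀)) S (t, y₀) →
      HasFDerivWithinAt (fun y => F (t, y)) (G (t, y₀) ∘L ContinuousLinearMap.inr ℝ ℝ E) s y₀ :=
    fun t h => h.comp y₀ (hasFDerivAt_prodMk_right t y₀).hasFDerivWithinAt
      fun y hy => ⟨mem_univ _, hy⟩
  have hT : ∀ y ∈ s, ∀ t, HasFDerivWithinAt F (G (t, y)) S (t, y) →
      HasDerivAt (fun t => F (t, y)) (G (t, y) (1, 0)) t := by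
    intro y hy t h
    have := h.comp_hasDerivWithinAt (s := univ) t
      ((hasDerivAt_id t).prodMk (hasDerivAt_const t y)).hasDerivWithinAt
      (show MapsTo _ univ S from fun t _ => ⟨mem_univ _, hy⟩)
    exact hasDerivWithinAt_univ.1 this
  have hL0 : G (0, y₀) ∘L ContinuousLinearMap.inr ℝ ℝ E = ContinuousLinearMap.id ℝ E := by
    have h1 := hL 0 (hdiff.self_of_nhdsWithin hmem)
    have h2 : HasFDerivWithinAt (fun y => F (0, y)) (ContinuousLinearMap.id ℝ E) s y₀ :=
      (hasFDerivWithinAt_id y₀ s).congr_of_eventuallyEq h0 (h0.self_of_nhdsWithin hy)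
    exact (hs y₀ hy).eq h1 h2
  have hXG : X =ᶠ[𝓝[s] y₀] fun y => G (0, y) (1, 0) := by
    filter_upwards [hX, hyt.eventually hdiff, eventually_mem_nhdsWithin] with y h1 h2 h3
    exact h1.unique (hT y h3 0 h2)
  have hX' : ∀ v, fderivWithin ℝ X s y₀ v = G' (0, v) (1, 0) := by
    intro v
    have h1 : HasFDerivWithinAt (fun y => G (0, y)) (G' ∘L ContinuousLinearMap.inr ℝ ℝ E) s y₀ :=
      hGd'.comp y₀ (hasFDerivAt_prodMk_right (0 : ℝ) y₀).hasFDerivWithinAt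
        fun y hy => ⟨mem_univ _, hy⟩
    have h2 := h1.clm_apply (hasFDerivWithinAt_const ((1 : ℝ), (0 : E)) y₀ s)
    have h3 := h2.congr_of_eventuallyEq hXG (hXG.eq_of_nhdsWithin hy)
    rw [h3.fderivWithin (hs y₀ hy)]
    simp
  have hGt : HasDerivAt (fun t => G (t, y₀)) (G' (1, 0)) 0 := by
    have := hGd'.comp_hasDerivWithinAt (s := univ) (0 : ℝ)
      ((hasDerivAt_id (0 : ℝ)).prodMk (hasDerivAt_const (0 : ℝ) y₀)).hasDerivWithinAt
      (show MapsTo _ univ S from fun t _ => ⟨mem_univ _, hy⟩)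
    exact hasDerivWithinAt_univ.1 this
  set L : ℝ → E →L[ℝ] E := fun t => G (t, y₀) ∘L ContinuousLinearMap.inr ℝ ℝ E with hLdef
  have hLd : HasDerivAt L (G' (1, 0) ∘L ContinuousLinearMap.inr ℝ ℝ E) 0 := by
    have := hGt.clm_comp (hasDerivAt_const (0 : ℝ) (ContinuousLinearMap.inr ℝ ℝ E))
    simpa using this
  have hL00 : L 0 = ContinuousLinearMap.id ℝ E := hL0
  have hF0 : F (0, y₀) = y₀ := h0.self_of_nhdsWithin hy
  have hX0 : HasDerivAt (fun t => F (t, y₀)) (X y₀) 0 := hX.self_of_nhdsWithin hy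
  have hYF : HasDerivAt (fun t => Y (F (t, y₀))) (fderivWithin ℝ Y s y₀ (X y₀)) 0 := by
    -- `Y` is differentiable only within `s`, so the chain rule is applied on a neighbourhood of `0`
    -- on which the curve stays in `s`.
    obtain ⟨u, hu, hus⟩ := hmaps.exists_mem
    have hY1 : HasFDerivWithinAt Y (fderivWithin ℝ Y s y₀) s (F (0, y₀)) := by
      rw [hF0]; exact hY.hasFDerivWithinAt
    have := hY1.comp_hasDerivWithinAt (s := u) (0 : ℝ) hX0.hasDerivWithinAt hus
    exact this.hasDerivAt hu
  have hZL : ∀ᶠ t in 𝓝 (0 : ℝ), L t (Z t) = Y (F (t, y₀)) := by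
    filter_upwards [hZ, ht.eventually hdiff] with t h1 h2
    rw [← h1, (hL t h2).fderivWithin (hs y₀ hy)]
  -- `L 0` is the identity and invertibility is an open condition. So `Z` is `L⁻¹` applied to `Y ∘
  -- F` near `0`, which makes it differentiable.
  have hunit : ∀ᶠ t in 𝓝 (0 : ℝ), (L t).IsInvertible := by
    have h1 : (range ((↑) : (E ≃L[ℝ] E) → E →L[ℝ] E)) ∈ 𝓝 (L 0) := by
      rw [hL00]; exact ContinuousLinearEquiv.nhds (ContinuousLinearEquiv.refl ℝ E)
    exact hLd.continuousAt.eventually h1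
  have hZinv : Z =ᶠ[𝓝 0] fun t => (L t).inverse (Y (F (t, y₀))) := by
    filter_upwards [hZL, hunit] with t h1 h2
    obtain ⟨e, he⟩ := h2
    rw [← h1, ← he]; simp
  have hZd : DifferentiableAt ℝ Z 0 := by
    refine DifferentiableAt.congr_of_eventuallyEq ?_ hZinv
    refine DifferentiableAt.clm_apply ?_ hYF.differentiableAt
    have h1 : DifferentiableAt ℝ (ContinuousLinearMap.inverse : (E →L[ℝ] E) → _) (L 0) := by
      rw [hL00]
      exact (contDiffAt_map_inverse (n := 1) (ContinuousLinearEquiv.refl ℝ E)).differentiableAt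
        (by norm_num)
    exact h1.comp (0 : ℝ) hLd.differentiableAt
  have hZ0 : Z 0 = Y y₀ := by
    have := hZL.self_of_nhds
    rwa [hL00, hF0] at this
  -- Differentiating `L t (Z t) = Y (F (t, y₀))` at `0` gives `DX(Y) + Z' = DY(X)`, where symmetry
  -- turns `L' (Y)` into `DX(Y)`.
  have h1 := hLd.clm_apply hZd.hasDerivAt
  have h2 := (h1.congr_of_eventuallyEq (hZL.mono fun t h => h.symm)).unique hYF
  have h3 : deriv Z 0 = lieBracketWithin ℝ X Y s y₀ := by
    rw [lieBracketWithin, hX', ← h2, hZ0, hL00]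
    have := hsymm (1, 0) (0, Y y₀)
    simp only [ContinuousLinearMap.comp_apply, ContinuousLinearMap.inr_apply,
      ContinuousLinearMap.id_apply]
    rw [hG', this]
    abel
  rw [← h3]
  exact hZd.hasDerivAt

theorem hasDerivAt_of_hasMFDerivAt {E : Type*} [NormedAddCommGroup E] [NormedSpace ℝ E] {c : ℝ → E}
    {t : ℝ} {c' : ℝ →L[ℝ] E} (h : HasMFDerivAt 𝓘(ℝ, ℝ) 𝓘(ℝ, E) c t c') : HasDerivAt c (c' 1) t :=
  have h1 : HasFDerivAt c c' t := hasMFDerivAt_iff_hasFDerivAt.1 h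
  h1.hasDerivAt

/-- The Lie bracket `[X, Y]` on a manifold as the derivative of the pullback of `Y` under a family
of maps `Φ t` with `Φ 0 = id` and velocity `X` at `t = 0`. -/
theorem hasDerivAt_of_mfderiv_apply_eq {E : Type*} [NormedAddCommGroup E] [NormedSpace ℝ E]
    [CompleteSpace E] {H : Type*} [TopologicalSpace H] {I : ModelWithCorners ℝ E H} {M : Type*}
    [TopologicalSpace M] [ChartedSpace H M] [IsManifold I 2 M] {Φ : ℝ × M → M} {x₀ : M}
    (hΦ : ∀ᶠ t in 𝓝 (0 : ℝ), ∀ y, ContMDiffAt (𝓘(ℝ, ℝ).prod I) I 2 Φ (t, y))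
    (h0 : ∀ y, Φ (0, y) = y) {X Y : ∀ x : M, TangentSpace I x}
    (hX : ∀ y, (mfderiv 𝓘(ℝ, ℝ) I (fun t => Φ (t, y)) 0 (1 : ℝ) : E) = X y)
    (hY : MDifferentiableAt I I.tangent (fun x => (⟨x, Y x⟩ : TangentBundle I M)) x₀) {Z : ℝ → E}
    (hZ : ∀ᶠ t in 𝓝 (0 : ℝ), mfderiv I I (fun y => Φ (t, y)) x₀ (Z t) = Y (Φ (t, x₀))) :
    HasDerivAt Z (mlieBracket I X Y x₀ : E) 0 := by
  have : IsManifold I 1 M := IsManifold.of_le (n := 2) (by norm_num)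
  set φ := extChartAt I x₀ with hφ
  have hx₀ : x₀ ∈ φ.source := mem_extChartAt_source x₀
  have hy₀ : φ x₀ ∈ φ.target := mem_extChartAt_target x₀
  -- The derivatives of the chart and of its inverse are inverse to each other, so pulling back by
  -- `φ.symm` is pushing forward by `φ`.
  have hinv : ∀ (V : ∀ x : M, TangentSpace I x), ∀ y ∈ φ.target,
      mpullbackWithin 𝓘(ℝ, E) I φ.symm V (range I) y = mfderiv I 𝓘(ℝ, E) φ (φ.symm y)
        (V (φ.symm y)) := by
    intro V y hy
    rw [mpullbackWithin_apply, ContinuousLinearMap.inverse_eq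
      (mfderivWithin_extChartAt_symm_comp_mfderiv_extChartAt hy)
      (mfderiv_extChartAt_comp_mfderivWithin_extChartAt_symm hy)]
    rfl
  have hΦt : ∀ᶠ t in 𝓝 (0 : ℝ), Φ (t, x₀) ∈ φ.source := by
    have h1 : ContinuousAt (fun t => Φ (t, x₀)) 0 := by
      have := hΦ.self_of_nhds x₀
      exact this.continuousAt.comp (f := fun t : ℝ => (t, x₀))
        (Continuous.prodMk_left x₀).continuousAt
    have h2 : φ.source ∈ 𝓝 (Φ (0, x₀)) := by rw [h0]; exact extChartAt_source_mem_nhds x₀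
    exact h1.eventually h2
  have hd1 : ∀ᶠ t in 𝓝 (0 : ℝ), ∀ y, MDifferentiableAt 𝓘(ℝ, ℝ) I (fun t => Φ (t, y)) t := by
    filter_upwards [hΦ] with t ht y
    exact ((ht y).mdifferentiableAt (by norm_num)).comp (f := fun t : ℝ => (t, y)) t
      (mdifferentiableAt_id.prodMk mdifferentiableAt_const)
  have hd2 : ∀ᶠ t in 𝓝 (0 : ℝ), ∀ y, MDifferentiableAt I I (fun y => Φ (t, y)) y := by
    filter_upwards [hΦ] with t ht y
    exact ((ht y).mdifferentiableAt (by norm_num)).comp (f := fun y : M => (t, y)) y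
      (mdifferentiableAt_const.prodMk mdifferentiableAt_id)
  have hdφ : ∀ z ∈ φ.source, MDifferentiableAt I 𝓘(ℝ, E) φ z := fun z hz =>
    mdifferentiableAt_extChartAt (by rwa [hφ, extChartAt_source] at hz)
  -- The family read in the chart at `x₀`. Taking `range I` as the domain admits boundary points.
  -- The vector `Z t` needs no change of coordinates, as the chart has the identity as derivative at
  -- `x₀`.
  have key := hasDerivAt_of_fderivWithin_apply_eq (s := range I) (y₀ := φ x₀) (Z := Z)
    (F := fun p : ℝ × E => φ (Φ (p.1, φ.symm p.2)))
    (X := mpullbackWithin 𝓘(ℝ, E) I φ.symm X (range I))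
    (Y := mpullbackWithin 𝓘(ℝ, E) I φ.symm Y (range I)) I.uniqueDiffOn (mem_range_self _)
    (I.range_subset_closure_interior (mem_range_self _)) ?_ ?_ ?_ ?_ ?_ ?_
  · have h1 : mlieBracket I X Y x₀ = lieBracketWithin ℝ
        (mpullbackWithin 𝓘(ℝ, E) I φ.symm X (range I))
        (mpullbackWithin 𝓘(ℝ, E) I φ.symm Y (range I)) (range I) (φ x₀) := by
      rw [← mlieBracketWithin_univ, mlieBracketWithin_apply, preimage_univ, univ_inter]
      refine (congrArg (fun A : E →L[ℝ] E => A.inverse _) mfderiv_extChartAt_self).trans ?_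
      exact congrArg (fun A : E →L[ℝ] E => A _) ContinuousLinearMap.inverse_id
    rw [h1]
    exact key
  · have h1 : ContMDiffWithinAt (𝓘(ℝ, ℝ).prod 𝓘(ℝ, E)) I 2
        (fun p : ℝ × E => Φ (p.1, φ.symm p.2)) (univ ×ˢ range I) (0, φ x₀) := by
      have h2 : ContMDiffWithinAt 𝓘(ℝ, E) I 2 φ.symm (range I) (φ x₀) :=
        contMDiffWithinAt_extChartAt_symm_range x₀ hy₀
      have h3 : ContMDiffWithinAt (𝓘(ℝ, ℝ).prod 𝓘(ℝ, E)) (𝓘(ℝ, ℝ).prod I) 2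
          (fun p : ℝ × E => (p.1, φ.symm p.2)) (univ ×ˢ range I) (0, φ x₀) :=
        contMDiffWithinAt_fst.prodMk
          (h2.comp (f := Prod.snd) ((0 : ℝ), φ x₀) contMDiffWithinAt_snd fun p hp => hp.2)
      have h4 := hΦ.self_of_nhds x₀
      refine ContMDiffAt.comp_contMDiffWithinAt (g := Φ) _ ?_ h3
      rw [show φ.symm (φ x₀) = x₀ from φ.left_inv hx₀]
      exact h4
    have h2 : ContMDiffAt I 𝓘(ℝ, E) 2 φ (Φ (0, φ.symm (φ x₀))) := by
      rw [φ.left_inv hx₀, h0]; exact contMDiffAt_extChartAt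
    have h3 := h2.comp_contMDiffWithinAt (f := fun p : ℝ × E => Φ (p.1, φ.symm p.2))
      ((0 : ℝ), φ x₀) h1
    rw [← modelWithCornersSelf_prod, chartedSpaceSelf_prod] at h3
    exact contMDiffWithinAt_iff_contDiffWithinAt.1 h3
  · filter_upwards [extChartAt_target_mem_nhdsWithin x₀] with y hy
    rw [h0, φ.right_inv hy]
  · exact Eventually.of_forall fun t => ⟨_, rfl⟩
  · filter_upwards [extChartAt_target_mem_nhdsWithin x₀] with y hy
    have h1 := (hd1.self_of_nhds (φ.symm y)).hasMFDerivAt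
    have h2 : HasMFDerivAt I 𝓘(ℝ, E) φ (Φ (0, φ.symm y)) (mfderiv I 𝓘(ℝ, E) φ (φ.symm y)) := by
      rw [h0]; exact (hdφ _ (φ.map_target hy)).hasMFDerivAt
    have h3 := hasDerivAt_of_hasMFDerivAt (h2.comp (f := fun t => Φ (t, φ.symm y)) (0 : ℝ) h1)
    rw [hinv X y hy, ← hX]
    exact h3
  · have := MDifferentiableWithinAt.differentiableWithinAt_mpullbackWithin_vectorField
      (s := univ) hY.mdifferentiableWithinAt
    rwa [preimage_univ, univ_inter] at this
  · filter_upwards [hZ, hΦt, hd2] with t h1 h2 h3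
    have e : φ.symm (φ x₀) = x₀ := φ.left_inv hx₀
    have h4 : HasMFDerivWithinAt 𝓘(ℝ, E) I φ.symm (range I) (φ x₀)
        (ContinuousLinearMap.id ℝ E) := by
      have := (mdifferentiableWithinAt_extChartAt_symm (I := I) hy₀).hasMFDerivWithinAt
      rwa [mfderivWithin_range_extChartAt_symm] at this
    have h5 : HasMFDerivAt I I (fun y => Φ (t, y)) (φ.symm (φ x₀))
        (mfderiv I I (fun y => Φ (t, y)) x₀) := by
      rw [e]; exact (h3 x₀).hasMFDerivAt
    have h6 : HasMFDerivAt I 𝓘(ℝ, E) φ (Φ (t, φ.symm (φ x₀)))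
        (mfderiv I 𝓘(ℝ, E) φ (Φ (t, x₀))) := by
      rw [e]; exact (hdφ _ h2).hasMFDerivAt
    have h7 := (h6.comp (f := fun y => Φ (t, y)) _ h5).comp_hasMFDerivWithinAt (φ x₀) h4
    have h8 : HasFDerivWithinAt (fun y => φ (Φ (t, φ.symm y)))
        ((mfderiv I 𝓘(ℝ, E) φ (Φ (t, x₀)) ∘L mfderiv I I (fun y => Φ (t, y)) x₀ : E →L[ℝ] E))
        (range I) (φ x₀) := hasMFDerivWithinAt_iff_hasFDerivWithinAt.1 h7
    have h9 : fderivWithin ℝ (fun y => φ (Φ (t, φ.symm y))) (range I) (φ x₀) (Z t) =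
        mfderiv I 𝓘(ℝ, E) φ (Φ (t, x₀)) (mfderiv I I (fun y => Φ (t, y)) x₀ (Z t)) :=
      congrArg (fun A : E →L[ℝ] E => A (Z t))
        (h8.fderivWithin (I.uniqueDiffOn _ (mem_range_self _)))
    refine h9.trans ?_
    rw [h1]
    change _ = mpullbackWithin 𝓘(ℝ, E) I φ.symm Y (range I) (φ (Φ (t, φ.symm (φ x₀))))
    rw [e, hinv Y _ (φ.map_source h2), φ.left_inv h2]

end Flow

/-! ### Curves in the group, the adjoint representation and the action on vector fields. -/

section LieGroupCurves

open Set Filter Topology VectorField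

variable {d n : ℕ} {H : Type*} [TopologicalSpace H]
  (I : ModelWithCorners ℝ (EuclideanSpace ℝ (Fin n)) H)
  {G : Type*} [Group G] [TopologicalSpace G] [ChartedSpace (EuclideanSpace ℝ (Fin d)) G]
  [LieGroup (𝓡 d) ∞ G]
  {W : Type*} [TopologicalSpace W] [ChartedSpace H W] [IsManifold I ∞ W]
  [MulAction G W] [ContMDiffSMul (𝓡 d) I ∞ G W]

/-- `γ` is a curve through `1` that is smooth near `0` and has the velocity `ξ` at `0`. -/
structure IsCurve (γ : ℝ → G) (ξ : GroupLieAlgebra (𝓡 d) G) : Prop where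
  zero : γ 0 = 1
  smooth : ∀ᶠ t in 𝓝 (0 : ℝ), ContMDiffAt 𝓘(ℝ, ℝ) (𝓡 d) ∞ γ t
  velocity : (mfderiv 𝓘(ℝ, ℝ) (𝓡 d) γ 0 (1 : ℝ) : EuclideanSpace ℝ (Fin d)) = ξ

/-- A straight line in the chart at `1` will do, since the derivative of that chart at `1` is the
identity. Such a curve replaces `exp(tξ)`: only its first-order behaviour at `0` is ever needed. -/
theorem exists_isCurve (ξ : GroupLieAlgebra (𝓡 d) G) : ∃ γ : ℝ → G, IsCurve γ ξ := by
  set φ := extChartAt (𝓡 d) (1 : G) with hφ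
  let v : EuclideanSpace ℝ (Fin d) := ξ
  let c : ℝ → EuclideanSpace ℝ (Fin d) := fun t => φ 1 + t • v
  have hc : ContDiff ℝ ∞ c := contDiff_const.add (contDiff_id.smul contDiff_const)
  have hc0 : c 0 = φ 1 := by simp [c]
  have hcd : HasDerivAt c v 0 := by
    have h := ((hasDerivAt_id (0 : ℝ)).smul_const v).const_add (φ 1)
    rw [one_smul] at h
    exact h
  have ht : ∀ᶠ t in 𝓝 (0 : ℝ), c t ∈ φ.target := by
    refine hc.continuous.continuousAt.eventually (p := fun z => z ∈ φ.target) ?_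
    rw [hc0]
    exact extChartAt_target_mem_nhds (I := 𝓡 d) (1 : G)
  have hφt : ∀ y ∈ φ.target, ContMDiffAt 𝓘(ℝ, EuclideanSpace ℝ (Fin d)) (𝓡 d) ∞ φ.symm y := by
    intro y hy
    have := contMDiffWithinAt_extChartAt_symm_range (I := 𝓡 d) (n := ∞) (1 : G) hy
    rwa [ModelWithCorners.range_eq_univ, contMDiffWithinAt_univ] at this
  refine ⟨fun t => φ.symm (c t), ?_, ?_, ?_⟩
  · rw [hc0]; exact extChartAt_to_inv 1
  · filter_upwards [ht] with t h
    exact (hφt _ h).comp t hc.contMDiff.contMDiffAt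
  · have h1 : HasMFDerivAt 𝓘(ℝ, EuclideanSpace ℝ (Fin d)) (𝓡 d) φ.symm (c 0)
        (ContinuousLinearMap.id ℝ (EuclideanSpace ℝ (Fin d))) := by
      have h2 := ((hφt _ ht.self_of_nhds).mdifferentiableAt (by simp)).hasMFDerivAt
      have h3 := mfderivWithin_range_extChartAt_symm (I := 𝓡 d) (x := (1 : G))
      rw [ModelWithCorners.range_eq_univ, mfderivWithin_univ, ← hφ, ← hc0] at h3
      rwa [h3] at h2
    have h2 : HasMFDerivAt 𝓘(ℝ, ℝ) 𝓘(ℝ, EuclideanSpace ℝ (Fin d)) c 0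
        (ContinuousLinearMap.toSpanSingleton ℝ v) :=
      hcd.hasFDerivAt.hasMFDerivAt
    have h3 := (h1.comp (f := c) (0 : ℝ) h2).mfderiv
    have h4 := congrArg (fun A : ℝ →L[ℝ] EuclideanSpace ℝ (Fin d) => A 1) h3
    refine h4.trans ?_
    change (1 : ℝ) • v = v
    exact one_smul ℝ _

namespace IsCurve

variable {γ : ℝ → G} {ξ : GroupLieAlgebra (𝓡 d) G}

theorem mdifferentiableAt (hγ : IsCurve γ ξ) : MDifferentiableAt 𝓘(ℝ, ℝ) (𝓡 d) γ 0 :=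
  hγ.smooth.self_of_nhds.mdifferentiableAt (by simp)

theorem mfderiv_comp_apply {E : Type*} [NormedAddCommGroup E] [NormedSpace ℝ E] {H' : Type*}
    [TopologicalSpace H'] {J : ModelWithCorners ℝ E H'} {M : Type*} [TopologicalSpace M]
    [ChartedSpace H' M] (hγ : IsCurve γ ξ) {σ : G → M} (hσ : MDifferentiableAt (𝓡 d) J σ 1) :
    (mfderiv 𝓘(ℝ, ℝ) J (fun t => σ (γ t)) 0 (1 : ℝ) : E) = mfderiv (𝓡 d) J σ 1 ξ := by
  have h1 : HasMFDerivAt (𝓡 d) J σ (γ 0) (mfderiv (𝓡 d) J σ 1) := by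
    rw [hγ.zero]; exact hσ.hasMFDerivAt
  have h2 := (h1.comp (f := γ) (0 : ℝ) hγ.mdifferentiableAt.hasMFDerivAt).mfderiv
  have h3 := congrArg (fun A : ℝ →L[ℝ] E => A 1) h2
  refine h3.trans ?_
  rw [← hγ.velocity]
  rfl

end IsCurve

theorem contMDiff_conj (g : G) : ContMDiff (𝓡 d) (𝓡 d) ∞ (fun h : G => g * h * g⁻¹) :=
  (contMDiff_const.mul contMDiff_id).mul contMDiff_const

theorem mdifferentiable_of_contMDiff {f : G → G} (hf : ContMDiff (𝓡 d) (𝓡 d) ∞ f) (g : G) :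
    MDifferentiableAt (𝓡 d) (𝓡 d) f g :=
  hf.mdifferentiable (by simp) g

/-- The chain rule, with the middle point and the composite given up to a propositional equality.
This avoids rewriting inside types of tangent vectors. -/
theorem mfderiv_eq_comp {E E' E'' : Type*} [NormedAddCommGroup E] [NormedSpace ℝ E]
    [NormedAddCommGroup E'] [NormedSpace ℝ E'] [NormedAddCommGroup E''] [NormedSpace ℝ E'']
    {H H' H'' : Type*} [TopologicalSpace H] [TopologicalSpace H'] [TopologicalSpace H'']
    {I : ModelWithCorners ℝ E H} {I' : ModelWithCorners ℝ E' H'} {I'' : ModelWithCorners ℝ E'' H''}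
    {M M' M'' : Type*} [TopologicalSpace M] [ChartedSpace H M] [TopologicalSpace M']
    [ChartedSpace H' M'] [TopologicalSpace M''] [ChartedSpace H'' M''] {f : M → M'} {g : M' → M''}
    {h : M → M''} {x : M} {y : M'} (hy : f x = y) (hh : ∀ z, g (f z) = h z)
    (hg : MDifferentiableAt I' I'' g y) (hf : MDifferentiableAt I I' f x) (v : E) :
    (mfderiv I' I'' g y (mfderiv I I' f x v : E') : E'') = mfderiv I I'' h x v := by
  subst hy
  obtain rfl : g ∘ f = h := funext hh
  exact (congrArg (fun A : E →L[ℝ] E'' => A v) (mfderiv_comp x hg hf)).symm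

theorem Ad_one (ξ : GroupLieAlgebra (𝓡 d) G) : Ad (1 : G) ξ = ξ := by
  have : (fun h : G => 1 * h * 1⁻¹) = id := by ext; simp
  change mfderiv (𝓡 d) (𝓡 d) (fun h : G => 1 * h * 1⁻¹) 1 ξ = ξ
  have h := mfderiv_id (I := 𝓡 d) (x := (1 : G))
  rw [← this] at h
  exact congrArg (fun A : EuclideanSpace ℝ (Fin d) →L[ℝ] EuclideanSpace ℝ (Fin d) => A ξ) h

theorem Ad_mul (g h : G) (ξ : GroupLieAlgebra (𝓡 d) G) : Ad (g * h) ξ = Ad g (Ad h ξ) :=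
  (mfderiv_eq_comp (f := fun z => h * z * h⁻¹) (g := fun z => g * z * g⁻¹)
    (h := fun z => g * h * z * (g * h)⁻¹) (y := 1) (by simp)
    (fun z => by group) (mdifferentiable_of_contMDiff (contMDiff_conj g) _)
    (mdifferentiable_of_contMDiff (contMDiff_conj h) _) _).symm

theorem Ad_inv_Ad (g : G) (ξ : GroupLieAlgebra (𝓡 d) G) : Ad g⁻¹ (Ad g ξ) = ξ := by
  rw [← Ad_mul, inv_mul_cancel, Ad_one]

/-- The derivative of the adjoint representation is the Lie bracket. -/
theorem IsCurve.hasDerivAt_Ad {γ : ℝ → G} {ξ : GroupLieAlgebra (𝓡 d) G} (hγ : IsCurve γ ξ)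
    (η : GroupLieAlgebra (𝓡 d) G) :
    HasDerivAt (F := EuclideanSpace ℝ (Fin d)) (fun t => Ad (γ t) η)
      (⁅ξ, η⁆ : GroupLieAlgebra (𝓡 d) G) 0 := by
  have : IsManifold (𝓡 d) 2 G := IsManifold.of_le (n := ∞) (by exact ENat.LEInfty.out)
  -- Right translations by `γ t` have as velocity at `0` the left-invariant field of `ξ`. Pulling
  -- the left-invariant field of `η` back under them gives `Ad (γ t) η` at `1`.
  refine hasDerivAt_of_mfderiv_apply_eq (I := 𝓡 d) (Φ := fun p : ℝ × G => p.2 * γ p.1)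
    (X := mulInvariantVectorField ξ) (Y := mulInvariantVectorField η) (x₀ := (1 : G)) ?_ ?_ ?_ ?_ ?_
  · filter_upwards [hγ.smooth] with t ht y
    refine ContMDiffAt.of_le (n := ∞) ?_ ENat.LEInfty.out
    exact contMDiffAt_snd.mul (ht.comp (f := Prod.fst) (t, y) contMDiffAt_fst)
  · intro y; simp [hγ.zero]
  · intro y
    exact hγ.mfderiv_comp_apply (σ := fun g => y * g)
      (mdifferentiable_of_contMDiff contMDiff_mul_left _)
  · exact mdifferentiableAt_mulInvariantVectorField η
  -- Conjugation by `γ t` followed by right translation by `γ t` is left translation by `γ t`.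
  · refine Eventually.of_forall fun t => ?_
    have h := mfderiv_eq_comp (I := 𝓡 d) (I' := 𝓡 d) (I'' := 𝓡 d) (f := fun h => γ t * h * (γ t)⁻¹)
      (g := fun h => h * γ t) (h := fun h => γ t * h) (x := (1 : G)) (y := 1) (by simp)
      (fun z => by group) (mdifferentiable_of_contMDiff contMDiff_mul_right _)
      (mdifferentiable_of_contMDiff (contMDiff_conj _) _) η
    refine h.trans ?_
    change (mulInvariantVectorField η (γ t) : EuclideanSpace ℝ (Fin d)) =
      mulInvariantVectorField η (1 * γ t)
    rw [one_mul]

/-- Differentiate `Ad g (Ad (γ t) η) = Ad (g γ(t) g⁻¹) (Ad g η)` at `t = 0`; the conjugated curve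
has velocity `Ad g ξ`. -/
theorem Ad_lie (g : G) (ξ η : GroupLieAlgebra (𝓡 d) G) : Ad g ⁅ξ, η⁆ = ⁅Ad g ξ, Ad g η⁆ := by
  obtain ⟨γ, hγ⟩ := exists_isCurve ξ
  have hγ' : IsCurve (fun t => g * γ t * g⁻¹) (Ad g ξ) :=
    ⟨by simp [hγ.zero],
      hγ.smooth.mono fun t ht => (contMDiff_conj g).contMDiffAt.comp t ht,
      hγ.mfderiv_comp_apply (mdifferentiable_of_contMDiff (contMDiff_conj g) 1)⟩
  have h1 := hγ'.hasDerivAt_Ad (Ad g η)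
  let A : EuclideanSpace ℝ (Fin d) →L[ℝ] EuclideanSpace ℝ (Fin d) :=
    mfderiv (𝓡 d) (𝓡 d) (fun h : G => g * h * g⁻¹) 1
  have h2 := A.hasFDerivAt.comp_hasDerivAt (0 : ℝ) (hγ.hasDerivAt_Ad η)
  refine (h2.unique (h1.congr_of_eventuallyEq (Eventually.of_forall fun t => ?_)))
  change Ad g (Ad (γ t) η) = Ad (g * γ t * g⁻¹) (Ad g η)
  rw [← Ad_mul, ← Ad_mul]; simp

theorem mdifferentiable_orbit (g : G) (x : W) :
    MDifferentiableAt (𝓡 d) I (fun g : G => g • x) g := by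
  have h : ContMDiff (𝓡 d) I ∞ (fun g : G => g • x) :=
    (contMDiff_smul (I := 𝓡 d) (I' := I) (G := G) (M := W) (n := ∞)).comp
      (contMDiff_id.prodMk contMDiff_const)
  exact h.mdifferentiable (by simp) g

/-- The formal inverse in the definition of the pullback is a true inverse, because translations are
diffeomorphisms. -/
theorem mfderiv_pullField (g : G) (X : VField I W) (x : W) :
    (mfderiv I I (fun y : W => g • y) x (pullField d I g X x) : EuclideanSpace ℝ (Fin n)) =
      X (g • x) := by
  obtain ⟨e, he⟩ := isInvertible_mfderiv_smul (d := d) I g x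
  change mfderiv I I (fun y : W => g • y) x
    ((mfderiv I I (fun y : W => g • y) x).inverse (X (g • x))) = X (g • x)
  let e' : TangentSpace I x ≃L[ℝ] TangentSpace I (g • x) := e
  have he' : (e' : TangentSpace I x →L[ℝ] TangentSpace I (g • x)) =
    mfderiv I I (fun y : W => g • y) x := he
  rw [← he', ContinuousLinearMap.inverse_equiv]
  exact e'.apply_symm_apply _

namespace IsCurve

variable {γ : ℝ → G} {ξ : GroupLieAlgebra (𝓡 d) G}

/-- The velocity `-ξ` absorbs the sign in the fundamental vector field. -/
theorem mfderiv_smul (hγ : IsCurve γ (-ξ)) (x : W) :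
    (mfderiv 𝓘(ℝ, ℝ) I (fun t => γ t • x) 0 (1 : ℝ) : EuclideanSpace ℝ (Fin n)) =
      infAction I x ξ := by
  rw [hγ.mfderiv_comp_apply (σ := fun g : G => g • x) (mdifferentiable_orbit I 1 x)]
  exact map_neg (mfderiv (𝓡 d) I (fun g : G => g • x) 1) ξ

/-- The derivative of the pullback of vector fields along the action is the Lie bracket with the
fundamental vector field. -/
theorem hasDerivAt_pullField (hγ : IsCurve γ (-ξ)) (Y : VField I W) (x : W) :
    HasDerivAt (F := EuclideanSpace ℝ (Fin n)) (fun t => pullField d I (γ t) Y x)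
      (⁅(fundField I ξ : VField I W), Y⁆ x) 0 := by
  have : IsManifold I 2 W := IsManifold.of_le (n := ∞) (by exact ENat.LEInfty.out)
  refine hasDerivAt_of_mfderiv_apply_eq (I := I) (Φ := fun p : ℝ × W => γ p.1 • p.2)
    (X := fundField I ξ) (Y := Y) (x₀ := x) ?_ ?_ ?_ ?_ ?_
  · filter_upwards [hγ.smooth] with t ht y
    refine ContMDiffAt.of_le (n := ∞) ?_ ENat.LEInfty.out
    exact (ht.comp (f := Prod.fst) (t, y) contMDiffAt_fst).smul contMDiffAt_snd
  · intro y; simp [hγ.zero]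
  · intro y; exact hγ.mfderiv_smul I y
  · exact Y.mdifferentiableAt
  · exact Eventually.of_forall fun t => mfderiv_pullField I (γ t) Y x

theorem hasDerivAt_fn_smul (hγ : IsCurve γ (-ξ)) (φ : Fn I W) (x : W) :
    HasDerivAt (fun t => φ (γ t • x)) (⁅(fundField I ξ : VField I W), φ⁆ x) 0 := by
  have h0 : γ 0 • x = x := by rw [hγ.zero, one_smul]
  have h1 : MDifferentiableAt I 𝓘(ℝ, ℝ) φ (γ 0 • x) := VField.mdiffAt φ _
  have h2 : MDifferentiableAt 𝓘(ℝ, ℝ) I (fun t => γ t • x) 0 := by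
    have h3 : MDifferentiableAt (𝓡 d) I (fun g : G => g • x) (γ 0) := mdifferentiable_orbit I _ x
    exact h3.comp (0 : ℝ) hγ.mdifferentiableAt
  have h3 := hasDerivAt_of_hasMFDerivAt (h1.comp (f := fun t => γ t • x) (0 : ℝ) h2).hasMFDerivAt
  have h4 := mfderiv_eq_comp (I := 𝓘(ℝ, ℝ)) (I' := I) (I'' := 𝓘(ℝ, ℝ))
    (f := fun t => γ t • x) (g := φ) (x := (0 : ℝ)) h0 (fun z => rfl)
    (VField.mdiffAt φ x) h2 1
  rw [hγ.mfderiv_smul I] at h4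
  have h5 : ⁅(fundField I ξ : VField I W), φ⁆ x =
    mfderiv 𝓘(ℝ, ℝ) 𝓘(ℝ, ℝ) (fun t => φ (γ t • x)) 0 (1 : ℝ) := h4
  rw [h5]
  exact h3

end IsCurve

end LieGroupCurves

/-! ### The cut-off connection: values on fundamental fields and equivariance. -/

section ConnectionForms

open Set Filter Topology VectorField

variable {d n : ℕ} {H : Type*} [TopologicalSpace H]
  {I : ModelWithCorners ℝ (EuclideanSpace ℝ (Fin n)) H}
  {G : Type*} [Group G] [TopologicalSpace G] [ChartedSpace (EuclideanSpace ℝ (Fin d)) G]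
  [LieGroup (𝓡 d) ∞ G]
  {W : Type*} [TopologicalSpace W] [ChartedSpace H W] [IsManifold I ∞ W]
  [MulAction G W] [ContMDiffSMul (𝓡 d) I ∞ G W]

theorem CutOff.eq_zero (f : CutOff d I G W) {x : W} (hx : x ∈ singularSet d I G W) :
    f.toFn x = 0 := by
  obtain ⟨U, -, hs, hf⟩ := f.vanish
  exact hf x (hs hx)

variable (f : CutOff d I G W) (η : Connection d I G W)

theorem cutOffForm_apply (l : Module.Dual ℝ (GroupLieAlgebra (𝓡 d) G)) (X : VField I W) (x : W) :
    cutOffForm f η l X x = f.toFn x * l (η.form x (X x)) := rfl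

/-- Off `W^s` this is verticality of the connection; on `W^s` both sides vanish with `f`. -/
theorem cutOffForm_fundField (l : Module.Dual ℝ (GroupLieAlgebra (𝓡 d) G))
    (ξ : GroupLieAlgebra (𝓡 d) G) : cutOffForm f η l (fundField I ξ) = l ξ • f.toFn := by
  refine ContMDiffMap.ext fun x => ?_
  rw [cutOffForm_apply]
  change f.toFn x * l (η.form x (infAction I x ξ)) = l ξ * f.toFn x
  by_cases hx : x ∈ singularSet d I G W
  · rw [f.eq_zero hx, zero_mul, mul_zero]
  · rw [η.vertical x hx, mul_comm]

/-- Equivariance of the connection at `x` combined with invariance of `f`; at a singular `x` the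
factor `f` kills both sides. -/
theorem cutOffForm_pullField_apply (l : Module.Dual ℝ (GroupLieAlgebra (𝓡 d) G)) (g : G)
    (X : VField I W) (x : W) : cutOffForm f η l (pullField d I g X) x =
      f.toFn (g • x) * l (Ad g⁻¹ (η.form (g • x) (X (g • x)))) := by
  rw [cutOffForm_apply, f.invariant]
  by_cases hx : x ∈ singularSet d I G W
  · rw [f.eq_zero hx, zero_mul, zero_mul]
  · have h1 := η.equivariant x hx g (pullField d I g X x)
    have h2 : η.form (g • x) (mfderiv I I (fun y : W => g • y) x (pullField d I g X x)) =
      η.form (g • x) (X (g • x)) := congrArg (η.form (g • x)) (mfderiv_pullField I g X x)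
    rw [← h2, h1, Ad_inv_Ad]

theorem pullFn_cutOffForm_pullField (l : Module.Dual ℝ (GroupLieAlgebra (𝓡 d) G)) (g : G)
    (X : VField I W) : pullFn d I g⁻¹ (cutOffForm f η l (pullField d I g X)) =
      cutOffForm f η (l ∘ₗ Ad g⁻¹) X := by
  refine ContMDiffMap.ext fun x => ?_
  refine (cutOffForm_pullField_apply f η l g X (g⁻¹ • x)).trans ?_
  exact congrArg (fun z => f.toFn z * l (Ad g⁻¹ (η.form z (X z)))) (smul_inv_smul g x)

theorem pullFn_cutOff (g : G) : pullFn d I g f.toFn = f.toFn :=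
  ContMDiffMap.ext fun x => f.invariant g x

variable (d G) in
/-- The adjoint representation of the Lie algebra. -/
abbrev adLie (ξ : GroupLieAlgebra (𝓡 d) G) :
    GroupLieAlgebra (𝓡 d) G →ₗ[ℝ] GroupLieAlgebra (𝓡 d) G :=
  (LieAlgebra.ad ℝ (GroupLieAlgebra (𝓡 d) G) ξ : _)

/-- The product rule for the adjoint representation along a curve. -/
theorem IsCurve.hasDerivAt_Ad_apply {γ : ℝ → G} {ξ : GroupLieAlgebra (𝓡 d) G} (hγ : IsCurve γ ξ)
    {u : ℝ → GroupLieAlgebra (𝓡 d) G} {u' : GroupLieAlgebra (𝓡 d) G}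
    (hu : HasDerivAt (F := EuclideanSpace ℝ (Fin d)) u u' 0) :
    HasDerivAt (F := EuclideanSpace ℝ (Fin d)) (fun t => Ad (γ t) (u t)) (⁅ξ, u 0⁆ + u') 0 := by
  let v : ℝ → EuclideanSpace ℝ (Fin d) := u
  let v' : EuclideanSpace ℝ (Fin d) := u'
  have hv : HasDerivAt v v' 0 := hu
  -- The derivative of `Ad (γ t)` is known only on fixed vectors, so the moving vector is expanded
  -- in the standard basis.
  let e : Fin d → EuclideanSpace ℝ (Fin d) := fun i => EuclideanSpace.single i 1
  have he : ∀ w : EuclideanSpace ℝ (Fin d), w = ∑ i, w i • e i := fun w => by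
    ext j; simp [e, Finset.sum_apply, Pi.single_apply]
  let A : G → EuclideanSpace ℝ (Fin d) →ₗ[ℝ] EuclideanSpace ℝ (Fin d) := fun g => Ad g
  have h1 : ∀ i, HasDerivAt (fun t => v t i) (v' i) 0 := fun i =>
    (EuclideanSpace.proj (𝕜 := ℝ) i).hasFDerivAt.comp_hasDerivAt (0 : ℝ) hv
  have h2 := HasDerivAt.fun_sum (u := Finset.univ)
    fun i _ => (h1 i).fun_smul (hγ.hasDerivAt_Ad (e i))
  let B : EuclideanSpace ℝ (Fin d) →ₗ[ℝ] EuclideanSpace ℝ (Fin d) := adLie d G ξ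
  have hA : ∀ t, A (γ t) (v t) = ∑ i, v t i • A (γ t) (e i) := fun t => by
    conv_lhs => rw [he (v t), map_sum]
    simp only [map_smul]
  have hB : B (v 0) + v' = ∑ i, (v 0 i • B (e i) + v' i • A (γ 0) (e i)) := by
    have h0 : A (γ 0) = LinearMap.id := by
      rw [hγ.zero]; exact LinearMap.ext Ad_one
    rw [Finset.sum_add_distrib, h0]
    simp only [LinearMap.id_apply]
    rw [← he v']
    conv_lhs => rw [he (v 0), map_sum]
    simp only [map_smul]
  have h3 : HasDerivAt (fun t => A (γ t) (v t)) (B (v 0) + v') 0 := by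
    rw [hB]
    simp only [hA]
    exact h2
  exact h3

/-- Infinitesimal equivariance of `ω_f`, evaluated on a vector field. It comes from differentiating
`ω_f(Y)` along the orbit of `x`, following a curve in the group with velocity `-ξ`. -/
theorem lie_fundField_cutOffForm (l : Module.Dual ℝ (GroupLieAlgebra (𝓡 d) G))
    (ξ : GroupLieAlgebra (𝓡 d) G) (Y : VField I W) :
    ⁅(fundField I ξ : VField I W), cutOffForm f η l Y⁆ =
      cutOffForm f η l ⁅(fundField I ξ : VField I W), Y⁆ - cutOffForm f η (l ∘ₗ adLie d G ξ) Y := by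
  obtain ⟨γ, hγ⟩ := exists_isCurve (-ξ)
  refine ContMDiffMap.ext fun x => ?_
  have h1 := hγ.hasDerivAt_fn_smul I (cutOffForm f η l Y) x
  change _ = f.toFn x * l (η.form x (⁅(fundField I ξ : VField I W), Y⁆ x)) -
    f.toFn x * l (⁅ξ, η.form x (Y x)⁆)
  by_cases hx : x ∈ singularSet d I G W
  -- By invariance `f` vanishes on the whole orbit of a singular point, so the derivative along it
  -- is zero.
  · have h2 : ∀ t, cutOffForm f η l Y (γ t • x) = 0 := fun t => by
      rw [cutOffForm_apply, f.invariant, f.eq_zero hx, zero_mul]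
    simp only [h2] at h1
    rw [f.eq_zero hx, zero_mul, zero_mul, sub_zero]
    exact h1.unique (hasDerivAt_const 0 0)
  · let L : EuclideanSpace ℝ (Fin d) →L[ℝ] ℝ :=
      LinearMap.toContinuousLinearMap (E := EuclideanSpace ℝ (Fin d)) (F' := ℝ) l
    let N : EuclideanSpace ℝ (Fin n) →L[ℝ] EuclideanSpace ℝ (Fin d) :=
      LinearMap.toContinuousLinearMap (E := EuclideanSpace ℝ (Fin n))
        (F' := EuclideanSpace ℝ (Fin d)) (η.form x)
    have h2 := N.hasFDerivAt.comp_hasDerivAt (0 : ℝ) (hγ.hasDerivAt_pullField I Y x)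
    have h3 := (L.hasFDerivAt.comp_hasDerivAt (0 : ℝ) (hγ.hasDerivAt_Ad_apply h2)).const_mul
      (f.toFn x)
    -- Equivariance freezes the connection at `x`. The dependence on `t` is left in `Ad (γ t)` and
    -- in the pullback of `Y`, whose derivatives are both brackets, so the form itself is never
    -- differentiated.
    have h4 : ∀ t, cutOffForm f η l Y (γ t • x) =
        f.toFn x * l (Ad (γ t) (η.form x (pullField d I (γ t) Y x))) := fun t => by
      rw [cutOffForm_apply, f.invariant, ← η.equivariant x hx (γ t)]
      exact congrArg (fun w => f.toFn x * l (η.form (γ t • x) w))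
        (mfderiv_pullField I (γ t) Y x).symm
    have h0 : pullField d I (γ 0) Y x = Y x := by
      have h5 := mfderiv_pullField (d := d) I (γ 0) Y x
      have h6 : (fun y : W => γ 0 • y) = id := by ext; simp [hγ.zero]
      have h7 : Y (γ 0 • x) = (Y x : EuclideanSpace ℝ (Fin n)) := by rw [hγ.zero, one_smul]
      rw [h7] at h5
      have h8 := mfderiv_id (I := I) (x := x)
      rw [← h6] at h8
      exact (congrArg (fun A : EuclideanSpace ℝ (Fin n) →L[ℝ] EuclideanSpace ℝ (Fin n) =>
        A (pullField d I (γ 0) Y x)) h8).symm.trans h5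
    simp only [h4] at h1
    have h5 := h1.unique h3
    clear h1 h3
    refine h5.trans ?_
    change f.toFn x * l (⁅-ξ, η.form x (pullField d I (γ 0) Y x)⁆ +
      η.form x (⁅(fundField I ξ : VField I W), Y⁆ x)) = _
    rw [h0, map_add, neg_lie, map_neg]
    ring

end ConnectionForms

/-! ### Invariant polynomials on the Lie algebra and their infinitesimal invariance. -/

section InvariantPolynomials

open Set Filter Topology

variable {d : ℕ} {G : Type*} [Group G] [TopologicalSpace G]
  [ChartedSpace (EuclideanSpace ℝ (Fin d)) G] [LieGroup (𝓡 d) ∞ G]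
  {ι : Type*} [Fintype ι] (b : Module.Basis ι ℝ (GroupLieAlgebra (𝓡 d) G))

theorem gen_eq_sum (l : Module.Dual ℝ (GroupLieAlgebra (𝓡 d) G)) :
    SymDual.gen d G l = ∑ a, l (b a) • theta b a := by
  have h : l = ∑ a, l (b a) • b.coord a := b.ext fun c => by
    simp
  conv_lhs => rw [h, map_sum]
  simp only [map_smul]; rfl

theorem symDual_algHom_ext {B : Type*} [Semiring B] [Algebra ℝ B] {φ ψ : SymDual d G →ₐ[ℝ] B}
    (h : ∀ l, φ (SymDual.gen d G l) = ψ (SymDual.gen d G l)) : φ = ψ := by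
  refine AlgHom.ext fun F => ?_
  induction F using SymmetricAlgebra.induction with
  | algebraMap r => exact (φ.commutes r).trans (ψ.commutes r).symm
  | ι x => exact h x
  | mul x y hx hy =>
    exact (map_mul φ x y).trans ((congrArg₂ (· * ·) hx hy).trans (map_mul ψ x y).symm)
  | add x y hx hy =>
    exact (map_add φ x y).trans ((congrArg₂ (· + ·) hx hy).trans (map_add ψ x y).symm)

/-- Polynomials in the coordinates of `g`, as elements of `S(g*)`. -/
def ofPoly : MvPolynomial ι ℝ →ₐ[ℝ] SymDual d G := MvPolynomial.aeval (theta b)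

@[simp] theorem ofPoly_X (a : ι) : ofPoly b (MvPolynomial.X a) = theta b a :=
  MvPolynomial.aeval_X _ a

/-- Sending `l` to `∑_a l(b a) X_a` gives a section. This allows computing with honest polynomials
and their partial derivatives. -/
theorem ofPoly_surjective : Function.Surjective (ofPoly b) := by
  intro F
  have h : (ofPoly b).comp (SymDual.lift (∑ a, (LinearMap.applyₗ (b a)).smulRight
      (MvPolynomial.X a : MvPolynomial ι ℝ))) = AlgHom.id ℝ (SymDual d G) := by
    refine symDual_algHom_ext fun l => ?_
    rw [AlgHom.comp_apply, SymDual.lift_gen, AlgHom.id_apply, gen_eq_sum b]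
    simp
  exact ⟨_, congrArg (fun φ => φ F) h⟩

/-- Evaluation of a polynomial at a point of `g`. -/
def evalAt (x : GroupLieAlgebra (𝓡 d) G) : SymDual d G →ₐ[ℝ] ℝ :=
  SymDual.lift (LinearMap.applyₗ x)

theorem evalAt_ofPoly (x : GroupLieAlgebra (𝓡 d) G) (p : MvPolynomial ι ℝ) :
    evalAt x (ofPoly b p) = MvPolynomial.eval (fun a => b.coord a x) p := by
  have h : (evalAt x).comp (ofPoly b) = MvPolynomial.aeval (fun a => b.coord a x) :=
    MvPolynomial.algHom_ext fun a => by
      rw [AlgHom.comp_apply, ofPoly_X, MvPolynomial.aeval_X]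
      exact SymDual.lift_gen _ _
  exact congrArg (fun φ => φ p) h

theorem evalAt_coAd (g : G) (x : GroupLieAlgebra (𝓡 d) G) (F : SymDual d G) :
    evalAt x (coAd g F) = evalAt (Ad g⁻¹ x) F := by
  have h : (evalAt x).comp (coAd g) = evalAt (Ad g⁻¹ x) := symDual_algHom_ext fun l => by
    rw [AlgHom.comp_apply, coAd, SymDual.lift_gen]
    exact (SymDual.lift_gen _ _).trans (SymDual.lift_gen (LinearMap.applyₗ (Ad g⁻¹ x)) l).symm
  exact congrArg (fun φ => φ F) h

theorem mem_invPoly {F : SymDual d G} : F ∈ invPoly d G ↔ ∀ g : G, coAd g F = F := by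
  simp only [invPoly, Algebra.mem_iInf]; rfl

theorem hasDerivAt_eval {y : ι → ℝ → ℝ} {y' : ι → ℝ} (hy : ∀ a, HasDerivAt (y a) (y' a) 0)
    (p : MvPolynomial ι ℝ) : HasDerivAt (fun t => MvPolynomial.eval (fun a => y a t) p)
      (∑ a, MvPolynomial.eval (fun a => y a 0) (MvPolynomial.pderiv a p) * y' a) 0 := by
  classical
  induction p using MvPolynomial.induction_on with
  | C r => simpa using hasDerivAt_const 0 r
  | add p q hp hq =>
    simp only [map_add, add_mul, Finset.sum_add_distrib]
    exact hp.add hq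
  | mul_X p i hp =>
    simp only [map_mul, MvPolynomial.eval_X, Derivation.leibniz, MvPolynomial.pderiv_X, map_add,
      smul_eq_mul, Pi.single_apply]
    refine (hp.fun_mul (hy i)).congr_deriv ?_
    simp only [add_mul, Finset.sum_add_distrib, apply_ite (MvPolynomial.eval _), map_one, map_zero,
      mul_ite, mul_one, mul_zero, ite_mul, zero_mul, Finset.sum_ite_eq, Finset.mem_univ, if_true,
      Finset.sum_mul]
    rw [add_comm]
    congr 1
    exact Finset.sum_congr rfl fun a _ => by ring

/-- Invariant polynomials are annihilated by the infinitesimal coadjoint action. -/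
theorem sum_pderiv_mul_bracket_eq_zero {p : MvPolynomial ι ℝ} (hp : ofPoly b p ∈ invPoly d G)
    (k : ι) : ∑ a, MvPolynomial.pderiv a p *
      ∑ c, MvPolynomial.C (b.repr ⁅b k, b c⁆ a) * MvPolynomial.X c = 0 := by
  -- Over the infinite field `ℝ` a polynomial is zero as soon as its values are. At the point `x`
  -- with coordinates `y`, the value is the derivative of the constant function `t ↦ F (Ad (γ t)
  -- x)`.
  refine MvPolynomial.funext fun y => ?_
  obtain ⟨γ, hγ⟩ := exists_isCurve (b k)
  set x : GroupLieAlgebra (𝓡 d) G := ∑ c, y c • b c with hx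
  have hy : ∀ a, b.coord a x = y a := fun a => by
    classical
    simp [hx, Finsupp.single_apply]
  have h1 : ∀ a, HasDerivAt (fun t => b.coord a (Ad (γ t) x)) (b.coord a ⁅b k, x⁆) 0 := fun a =>
    let L : EuclideanSpace ℝ (Fin d) →L[ℝ] ℝ :=
      LinearMap.toContinuousLinearMap (E := EuclideanSpace ℝ (Fin d)) (F' := ℝ) (b.coord a)
    L.hasFDerivAt.comp_hasDerivAt (0 : ℝ) (hγ.hasDerivAt_Ad x)
  have h2 := hasDerivAt_eval h1 p
  have h3 : ∀ t, MvPolynomial.eval (fun a => b.coord a (Ad (γ t) x)) p =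
      evalAt x (ofPoly b p) := fun t => by
    rw [← evalAt_ofPoly]
    -- The coadjoint action of `g` is evaluation at `Ad g⁻¹ x`, hence the inverse.
    have := evalAt_coAd (γ t)⁻¹ x (ofPoly b p)
    rwa [mem_invPoly.1 hp, inv_inv, eq_comm] at this
  simp only [h3, hγ.zero, Ad_one, hy] at h2
  have h4 := h2.unique (hasDerivAt_const _ _)
  rw [map_sum, map_zero, ← h4]
  refine Finset.sum_congr rfl fun a _ => ?_
  rw [map_mul, map_sum]
  congr 1
  simp only [hx, lie_sum, lie_smul, map_sum, map_smul, map_mul, MvPolynomial.eval_C,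
    MvPolynomial.eval_X, smul_eq_mul, Module.Basis.coord_apply]
  exact Finset.sum_congr rfl fun c _ => mul_comm _ _

end InvariantPolynomials

/-! ### The Cartan calculus. -/

namespace Form

section CartanCalculus

variable {A L : Type*} [CommRing A] [LieRing L] [Module A L] [LieRingModule L A]
  [LieRinehartRing A L]

/-- This drives the inductions on the degree: a form of positive degree is tested by contracting it
with its first argument, and the commutation rules of contractions lead back to lower degree. -/
theorem apply_succ (α : Form A L) (n : ℕ) (v : Fin (n + 1) → L) :
    α (n + 1) v = contract (v 0) α n (fun i => v i.succ) :=
  congrArg (α (n + 1)) (Matrix.cons_head_tail v).symm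

theorem lieD_sgn (x : L) (α : Form A L) : lieD x (sgn α) = sgn (lieD x α) := by
  refine ext fun n v => ?_
  rw [lieD_apply, sgn_apply, sgn_apply, lieD_apply]
  rcases neg_one_pow_eq_or A n with h | h <;> simp [h]; ring

theorem lieD_zero_apply (x : L) (α : Form A L) (v : Fin 0 → L) : lieD x α 0 v = ⁅x, α 0 v⁆ := by
  rw [Subsingleton.elim v ![]]; rfl

/-- `[L_x, L_y] = L_[x,y]` -/
theorem lieD_lieD (x y : L) (α : Form A L) :
    lieD x (lieD y α) = lieD y (lieD x α) + lieD ⁅x, y⁆ α := by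
  refine ext fun n v => ?_
  induction n generalizing α with
  | zero =>
    simp only [lieD_zero_apply, add_apply]
    rw [leibniz_lie x y, add_comm]
  | succ n ih =>
    simp only [apply_succ, map_add, contract_lieD, map_sub, sub_apply, add_apply, ih]
    have h := lie_lie x y (v 0)
    rw [h, sub_eq_add_neg ⁅x, ⁅y, v 0⁆⁆, contract_add_left, contract_neg_left, add_apply, neg_apply]
    ring

/-- The Lie derivative is a derivation of the exterior product. -/
theorem lieD_mul (x : L) (α β : Form A L) :
    lieD x (α * β) = lieD x α * β + α * lieD x β := by
  refine ext fun n v => ?_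
  induction n generalizing α β with
  | zero =>
    simp only [lieD_zero_apply, add_apply, Subsingleton.elim v ![], mul_zero_apply]
    rw [LieRinehartRing.leibniz_mul_right, add_comm, smul_eq_mul]
  | succ n ih =>
    simp only [apply_succ, map_add, contract_lieD, contract_mul, sub_apply, add_apply, ih, lieD_sgn,
      sub_mul, mul_sub]
    ring

variable (K : Type*) [CommRing K] [Algebra K A] [LieAlgebra K L] [LieRinehartAlgebra K A L]

/-- After contraction, Cartan's formula and `[L_x, L_y] = L_[x,y]` reduce the claim to one degree
less. -/
theorem lieD_extD (x : L) (α : Form A L) : lieD x (extD K α) = extD K (lieD x α) := by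
  refine ext fun n v => ?_
  induction n generalizing α with
  | zero => simp only [lieD_zero_apply, extD_apply_zero, lie_zero]
  | succ n ih =>
    simp only [apply_succ, contract_lieD, contract_extD, map_sub, sub_apply, ih,
      lieD_lieD x (v 0), add_apply]
    ring

/-- `d² = 0` -/
theorem extD_extD (α : Form A L) : extD K (extD K α) = 0 := by
  refine ext fun n v => ?_
  induction n generalizing α with
  | zero => rfl
  | succ n ih =>
    simp only [apply_succ, contract_extD, map_sub, sub_apply, ih, lieD_extD, sub_zero, sub_self,
      map_zero, zero_apply]

/-- `d` is an antiderivation of the exterior product. -/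
theorem extD_mul (α β : Form A L) :
    extD K (α * β) = extD K α * β + sgn α * extD K β := by
  refine ext fun n v => ?_
  induction n generalizing α β with
  | zero =>
    simp only [Subsingleton.elim v ![], extD_apply_zero, add_apply, mul_zero_apply, zero_mul,
      mul_zero, add_zero]
  | succ n ih =>
    simp only [apply_succ, map_add, contract_extD, contract_mul, sub_apply, add_apply, ih, lieD_mul,
      extD_sgn, contract_sgn, sgn_sgn, sub_mul, mul_sub, neg_mul, neg_apply]
    ring

end CartanCalculus

end Form

/-! ### Compatibility of the group action with the calculus of forms. -/

section FormAction

variable {d n : ℕ} {H : Type*} [TopologicalSpace H]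
  {I : ModelWithCorners ℝ (EuclideanSpace ℝ (Fin n)) H}
  {G : Type*} [Group G] [TopologicalSpace G] [ChartedSpace (EuclideanSpace ℝ (Fin d)) G]
  [LieGroup (𝓡 d) ∞ G]
  {W : Type*} [TopologicalSpace W] [ChartedSpace H W] [IsManifold I ∞ W]
  [MulAction G W] [ContMDiffSMul (𝓡 d) I ∞ G W]

theorem pullField_lie (g : G) (X Y : VField I W) :
    pullField d I g ⁅X, Y⁆ = ⁅pullField d I g X, pullField d I g Y⁆ :=
  ContMDiffSection.ext fun x => by
    exact VectorField.mpullback_mlieBracket (n := ∞) (f := fun y : W => g • y) (x₀ := x)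
      X.mdifferentiableAt Y.mdifferentiableAt
      (ContMDiffSMul.contMDiff_const_smul (I := 𝓡 d) g).contMDiffAt
      (by rw [minSmoothness_of_isRCLikeNormedField]; exact ENat.LEInfty.out)

theorem lie_pullFn (g : G) (X : VField I W) (φ : Fn I W) :
    ⁅X, pullFn d I g⁻¹ φ⁆ = pullFn d I g⁻¹ ⁅pullField d I g X, φ⁆ := by
  have key : ∀ y : W, ⁅X, pullFn d I g⁻¹ φ⁆ (g • y) = ⁅pullField d I g X, φ⁆ y := by
    intro y
    have hd : ∀ (g : G) (x : W), MDifferentiableAt I I (fun y : W => g • y) x := fun g x =>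
      (ContMDiffSMul.contMDiff_const_smul (I := 𝓡 d) (n := ∞) g).mdifferentiable (by simp) x
    have h := mfderiv_eq_comp (I := I) (I' := I) (I'' := 𝓘(ℝ, ℝ)) (f := fun y : W => g • y)
      (g := pullFn d I g⁻¹ φ) (h := φ) (x := y) (y := g • y) rfl
      (fun z => congrArg φ (inv_smul_smul g z)) (VField.mdiffAt _ _) (hd g y)
      (pullField d I g X y)
    have h2 := mfderiv_pullField (d := d) I g X y
    exact (congrArg (mfderiv I 𝓘(ℝ, ℝ) (pullFn d I g⁻¹ φ) (g • y)) h2).symm.trans h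
  refine ContMDiffMap.ext fun x => ?_
  have h := key (g⁻¹ • x)
  rw [smul_inv_smul] at h
  exact h

theorem formAction_apply (g : G) (α : Form (Fn I W) (VField I W)) (k : ℕ)
    (v : Fin k → VField I W) : formAction d I W g α k v =
      pullFn d I g⁻¹ (α k fun i => pullField d I g (v i)) := rfl

/-- Once contraction is intertwined with the action, compatibility with products, Lie derivatives
and `d` follows by the same induction on the degree. -/
theorem contract_formAction (g : G) (X : VField I W) (α : Form (Fn I W) (VField I W)) :
    Form.contract X (formAction d I W g α) =
      formAction d I W g (Form.contract (pullField d I g X) α) := by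
  refine Form.ext fun k v => ?_
  rw [Form.contract_apply, formAction_apply, formAction_apply, Form.contract_apply]
  congr 2
  funext i
  induction i using Fin.cases <;> rfl

theorem formAction_sgn (g : G) (α : Form (Fn I W) (VField I W)) :
    formAction d I W g (Form.sgn α) = Form.sgn (formAction d I W g α) := by
  refine Form.ext fun k v => ?_
  rw [Form.sgn_apply, formAction_apply, formAction_apply, Form.sgn_apply]
  rcases neg_one_pow_eq_or (Fn I W) k with h | h <;> rw [h]
  · rw [one_mul, one_mul]
  · rw [neg_one_mul, neg_one_mul]; rfl

theorem formAction_mul (g : G) (α β : Form (Fn I W) (VField I W)) :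
    formAction d I W g (α * β) = formAction d I W g α * formAction d I W g β := by
  refine Form.ext fun k v => ?_
  induction k generalizing α β with
  | zero =>
    have e : (fun i => pullField d I g ((![] : Fin 0 → VField I W) i)) = ![] :=
      Subsingleton.elim _ _
    rw [Subsingleton.elim v ![], Form.mul_zero_apply, formAction_apply, formAction_apply,
      formAction_apply, e, Form.mul_zero_apply]
    rfl
  | succ k ih =>
    simp only [Form.apply_succ, contract_formAction, Form.contract_mul, map_add, Form.add_apply, ih,
      formAction_sgn]

theorem formAction_lieD (g : G) (X : VField I W) (α : Form (Fn I W) (VField I W)) :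
    Form.lieD X (formAction d I W g α) = formAction d I W g (Form.lieD (pullField d I g X) α) := by
  refine Form.ext fun k v => ?_
  induction k generalizing α with
  | zero =>
    rw [Form.lieD_zero_apply, formAction_apply, formAction_apply, Form.lieD_zero_apply, lie_pullFn]
  | succ k ih =>
    simp only [Form.apply_succ, contract_formAction, Form.contract_lieD, map_sub, Form.sub_apply,
      ih,
      pullField_lie]

theorem formAction_extD (g : G) (α : Form (Fn I W) (VField I W)) :
    formAction d I W g (Form.extD ℝ α) = Form.extD ℝ (formAction d I W g α) := by
  refine Form.ext fun k v => ?_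
  induction k generalizing α with
  | zero => rfl
  | succ k ih =>
    simp only [Form.apply_succ, contract_formAction, Form.contract_extD, map_sub, Form.sub_apply,
      ih,
      formAction_lieD]

theorem formAction_ofFun (g : G) (φ : Fn I W) :
    formAction d I W g (Form.ofFun φ) = Form.ofFun (pullFn d I g⁻¹ φ) :=
  Form.ext_contract rfl fun X => by
    rw [contract_formAction, Form.contract_ofFun, Form.contract_ofFun, map_zero]

theorem formAction_one (g : G) : formAction d I W g 1 = 1 :=
  formAction_ofFun g 1

theorem formAction_ofOne_cutOffForm (f : CutOff d I G W) (η : Connection d I G W) (g : G)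
    (l : Module.Dual ℝ (GroupLieAlgebra (𝓡 d) G)) :
    formAction d I W g (Form.ofOne (cutOffForm f η l)) =
      Form.ofOne (cutOffForm f η (l ∘ₗ Ad g⁻¹)) :=
  Form.ext_contract rfl fun X => by
    rw [contract_formAction, Form.contract_ofOne, Form.contract_ofOne, formAction_ofFun,
      pullFn_cutOffForm_pullField]

/-- The identity `L_ξ ω_f = -ad_ξ ω_f`, tested on vector fields through `lie_fundField_cutOffForm`.
-/
theorem lieD_ofOne_cutOffForm (f : CutOff d I G W) (η : Connection d I G W)
    (ξ : GroupLieAlgebra (𝓡 d) G) (l : Module.Dual ℝ (GroupLieAlgebra (𝓡 d) G)) :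
    Form.lieD (fundField I ξ) (Form.ofOne (cutOffForm f η l)) =
      -Form.ofOne (cutOffForm f η (l ∘ₗ adLie d G ξ)) := by
  have h : ∀ (X : VField I W) (φ : Fn I W), Form.lieD X (Form.ofFun φ) =
      (Form.ofFun ⁅X, φ⁆ : Form (Fn I W) (VField I W)) := fun X φ =>
    Form.ext_contract rfl fun Y => by
      rw [Form.contract_lieD, Form.contract_ofFun, Form.contract_ofFun, Form.contract_ofFun,
        map_zero, sub_zero]
  refine Form.ext_contract ?_ fun Y => ?_
  · exact (lie_zero (M := Fn I W) (fundField I ξ : VField I W)).trans neg_zero.symm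
  · rw [Form.contract_lieD, map_neg, Form.contract_ofOne, Form.contract_ofOne, Form.contract_ofOne,
      h, lie_fundField_cutOffForm, map_sub]
    abel

end FormAction

/-! ### Polynomials in a central parameter over a differential algebra. -/

section MapCoeff

open Polynomial

variable {R : Type*} [Ring R] [Algebra ℝ R]

/-- The extension of a linear endomorphism of `R` to `R[X]`, coefficient by coefficient. -/
def mapCoeff (D : R →ₗ[ℝ] R) : R[X] →ₗ[ℝ] R[X] :=
  Polynomial.lsum fun n => (monomial n).restrictScalars ℝ ∘ₗ D

@[simp] theorem mapCoeff_monomial (D : R →ₗ[ℝ] R) (n : ℕ) (r : R) :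
    mapCoeff D (monomial n r) = monomial n (D r) := by
  simp [mapCoeff, Polynomial.lsum_apply, sum_monomial_index]

@[simp] theorem coeff_mapCoeff (D : R →ₗ[ℝ] R) (p : R[X]) (n : ℕ) :
    (mapCoeff D p).coeff n = D (p.coeff n) := by
  induction p using Polynomial.induction_on' with
  | add p q hp hq => simp only [map_add, coeff_add, hp, hq]
  | monomial k r =>
    rw [mapCoeff_monomial, coeff_monomial, coeff_monomial]
    split_ifs <;> simp

theorem mapCoeff_C (D : R →ₗ[ℝ] R) (r : R) : mapCoeff D (C r) = C (D r) :=
  mapCoeff_monomial D 0 r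

/-- The parameter is even, central and `D`-closed, so the antiderivation rule passes through the
convolution of coefficients. -/
theorem mapCoeff_mul {D : R →ₗ[ℝ] R} {σ : R →ₐ[ℝ] R}
    (hD : ∀ x y, D (x * y) = D x * y + σ x * D y) (p q : R[X]) :
    mapCoeff D (p * q) = mapCoeff D p * q + mapAlgHom σ p * mapCoeff D q := by
  ext n
  simp only [coeff_mapCoeff, coeff_add, coeff_mul, map_sum, hD, Finset.sum_add_distrib,
    coe_mapAlgHom, coeff_map, RingHom.coe_coe]

theorem mapCoeff_X_mul (D : R →ₗ[ℝ] R) (p : R[X]) : mapCoeff D (X * p) = X * mapCoeff D p := by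
  ext n
  cases n <;> simp

/-- Integration of a derivative over `[0, 1]`, coefficient by coefficient. -/
theorem eval_one_sub_coeff_zero {D : R →ₗ[ℝ] R} {p q : R[X]} (h : derivative p = mapCoeff D q) :
    p.eval 1 - p.coeff 0 =
      D (∑ k ∈ Finset.range p.natDegree, ((k : ℝ) + 1)⁻¹ • q.coeff k) := by
  -- The range is cut at the degree of `p`, not of `q`: by `h`, the coefficients of `q` from that
  -- degree on are killed by `D`.
  rw [eval_eq_sum_range, Finset.sum_range_succ', map_sum]
  simp only [one_pow, mul_one, add_sub_cancel_right]
  refine Finset.sum_congr rfl fun k _ => ?_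
  rw [map_smul, ← coeff_mapCoeff, ← h, coeff_derivative]
  have h1 : p.coeff (k + 1) * ((k : R) + 1) = ((k : ℝ) + 1) • p.coeff (k + 1) := by
    rw [Algebra.smul_def, map_add, map_one, map_natCast]
    exact ((Nat.cast_commute k _).add_left (Commute.one_left _)).eq.symm
  rw [h1, smul_smul, inv_mul_cancel₀ (by positivity), one_smul]

end MapCoeff

/-! ### The chain rule and the infinitesimal coadjoint action. -/

section ChainRule

variable {ι : Type*} [Fintype ι]

open MvPolynomial

/-- A derivation along an algebra homomorphism `P` is determined by its values on the variables. -/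
theorem apply_eq_sum_pderiv {B : Type*} [Ring B] [Algebra ℝ B] {P : MvPolynomial ι ℝ →ₐ[ℝ] B}
    {δ : MvPolynomial ι ℝ →ₗ[ℝ] B} (hδ : ∀ F G, δ (F * G) = P F * δ G + P G * δ F)
    (F : MvPolynomial ι ℝ) : δ F = ∑ a, P (pderiv a F) * δ (X a) := by
  classical
  induction F using MvPolynomial.induction_on with
  | C r =>
    have h1 : δ 1 = 0 := by simpa using hδ 1 1
    have h2 : (C r : MvPolynomial ι ℝ) = r • 1 := by rw [smul_eq_C_mul, mul_one]
    rw [h2, map_smul, h1]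
    simp
  | add F G hF hG =>
    rw [map_add, hF, hG, ← Finset.sum_add_distrib]
    simp only [map_add, add_mul]
  | mul_X F i hF =>
    rw [hδ, hF]
    simp only [Derivation.leibniz, pderiv_X, map_add, smul_eq_mul, Pi.single_apply, map_mul,
      add_mul,
      Finset.sum_add_distrib, apply_ite P, map_zero, mul_ite, mul_one, mul_zero, ite_mul,
      zero_mul, Finset.sum_ite_eq, Finset.mem_univ, if_true, Finset.mul_sum, mul_assoc]

theorem pderiv_pderiv_comm (a e : ι) (F : MvPolynomial ι ℝ) :
    pderiv a (pderiv e F) = pderiv e (pderiv a F) := by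
  classical
  have h : ⁅pderiv (R := ℝ) a, pderiv e⁆ = 0 := MvPolynomial.derivation_ext fun i => by
    rw [Derivation.commutator_apply]
    simp [pderiv_X, Pi.single_apply, apply_ite (pderiv _)]
  have h1 := congrArg (fun δ => δ F) h
  rw [Derivation.commutator_apply] at h1
  exact sub_eq_zero.1 h1

/-- The infinitesimal coadjoint action of the basis vector `q`, for the structure constants `c`. -/
def coadPoly (c : ι → ι → ι → ℝ) (q : ι) (F : MvPolynomial ι ℝ) : MvPolynomial ι ℝ :=
  ∑ a, pderiv a F * ∑ p, C (c p q a) * X p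

/-- The extra sum comes from differentiating the linear coefficients of the coadjoint vector field.
For an `F` that the field annihilates, the formula says that the gradient of `F` is equivariant. -/
theorem pderiv_coadPoly (c : ι → ι → ι → ℝ) (q a : ι) (F : MvPolynomial ι ℝ) :
    pderiv a (coadPoly c q F) = coadPoly c q (pderiv a F) + ∑ e, c a q e • pderiv e F := by
  classical
  simp only [coadPoly, map_sum, Derivation.leibniz, pderiv_X, pderiv_C, smul_eq_mul, mul_zero,
    add_zero, Pi.single_apply, mul_ite, mul_one, Finset.sum_add_distrib, pderiv_pderiv_comm a]
  rw [add_comm]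
  congr 1
  · exact Finset.sum_congr rfl fun e _ => mul_comm _ _
  · refine Finset.sum_congr rfl fun e _ => ?_
    simp [smul_eq_C_mul, mul_comm]

end ChainRule

/-! ### The algebraic Chern-Weil argument. -/

section OddConnection

open Polynomial

/-- A `g`-valued odd element `A` of an algebra `R` with an antiderivation `D`, together with central
elements `Θ`, such that `D² A = [Θ, A]`. The structure constants of `g` are `c`. -/
structure OddConnection (ι R : Type*) [Fintype ι] [Ring R] [Algebra ℝ R] where
  /-- The grading involution. -/
  σ : R →ₐ[ℝ] R
  /-- The differential. -/
  D : R →ₗ[ℝ] R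
  leibniz : ∀ x y, D (x * y) = D x * y + σ x * D y
  /-- The structure constants, `[p, q] = ∑ a, c p q a • a`. -/
  c : ι → ι → ι → ℝ
  antisymm : ∀ p q a, c p q a = -c q p a
  jacobi : ∀ r s q a, ∑ p, (c r s p * c p q a + c s q p * c p r a + c q r p * c p s a) = 0
  /-- The generators of the symmetric algebra. -/
  Θ : ι → R
  /-- The components of the connection. -/
  A : ι → R
  Θ_comm : ∀ a x, Commute (Θ a) x
  σ_Θ : ∀ a, σ (Θ a) = Θ a
  D_Θ : ∀ a, D (Θ a) = 0
  σ_A : ∀ a, σ (A a) = -A a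
  A_anticomm : ∀ a b, A a * A b = -(A b * A a)
  A_mul_A_comm : ∀ a b x, Commute (A a * A b) x
  DA_comm : ∀ a x, Commute (D (A a)) x
  σ_DA : ∀ a, σ (D (A a)) = D (A a)
  D_DA : ∀ a, D (D (A a)) = ∑ p, ∑ q, c p q a • (Θ p * A q)

namespace OddConnection

variable {ι R : Type*} [Fintype ι] [Ring R] [Algebra ℝ R] (S : OddConnection ι R)

/-- The bracket `[A, A]`. -/
def bracket (a : ι) : R := ∑ p, ∑ q, S.c p q a • (S.A p * S.A q)

theorem bracket_comm (a : ι) (x : R) : Commute (S.bracket a) x :=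
  Commute.sum_left _ _ _ fun p _ => Commute.sum_left _ _ _ fun q _ =>
    (S.A_mul_A_comm p q x).smul_left _

theorem σ_bracket (a : ι) : S.σ (S.bracket a) = S.bracket a := by
  simp only [bracket, map_sum, map_smul, map_mul, S.σ_A, neg_mul_neg]

/-- The Leibniz rule gives two terms, which agree because `D A` is central and the structure
constants are antisymmetric. -/
theorem D_bracket (a : ι) :
    S.D (S.bracket a) = (2 : ℝ) • ∑ p, ∑ q, S.c p q a • (S.D (S.A p) * S.A q) := by
  have h1 : ∀ p q, S.D (S.A p * S.A q) = S.D (S.A p) * S.A q - S.D (S.A q) * S.A p := fun p q => by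
    rw [S.leibniz, S.σ_A, neg_mul, (S.DA_comm q (S.A p)).eq, sub_eq_add_neg]
  simp only [bracket, map_sum, map_smul, h1, smul_sub, Finset.sum_sub_distrib]
  rw [two_smul, sub_eq_add_neg]
  congr 1
  rw [Finset.sum_comm, ← Finset.sum_neg_distrib]
  refine Finset.sum_congr rfl fun p _ => ?_
  rw [← Finset.sum_neg_distrib]
  refine Finset.sum_congr rfl fun q _ => ?_
  rw [S.antisymm, neg_smul, neg_neg]

theorem sum_rotate (g : ι → ι → ι → R) :
    ∑ r, ∑ s, ∑ q, g r s q = ∑ r, ∑ s, ∑ q, g s q r := by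
  conv_rhs => rw [Finset.sum_comm]
  refine Finset.sum_congr rfl fun s _ => ?_
  conv_rhs => rw [Finset.sum_comm]

/-- `[[A, A], A] = 0` -/
theorem bracket_bracket (a : ι) : ∑ p, ∑ q, S.c p q a • (S.bracket p * S.A q) = 0 := by
  set K : ι → ι → ι → ℝ := fun r s q => ∑ p, S.c r s p * S.c p q a with hK
  set T : R := ∑ r, ∑ s, ∑ q, K r s q • (S.A r * S.A s * S.A q) with hT
  have h1 : ∑ p, ∑ q, S.c p q a • (S.bracket p * S.A q) = T := by
    simp only [bracket, hT, hK, Finset.sum_mul, Finset.smul_sum, Finset.sum_smul, smul_mul_assoc,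
      smul_smul]
    calc _ = ∑ p, ∑ r, ∑ s, ∑ q, (S.c p q a * S.c r s p) • (S.A r * S.A s * S.A q) := by
          refine Finset.sum_congr rfl fun p _ => ?_
          rw [Finset.sum_comm]
          refine Finset.sum_congr rfl fun r _ => ?_
          rw [Finset.sum_comm]
      _ = _ := by
          rw [Finset.sum_comm]
          refine Finset.sum_congr rfl fun r _ => ?_
          rw [Finset.sum_comm]
          refine Finset.sum_congr rfl fun s _ => ?_
          rw [Finset.sum_comm]
          refine Finset.sum_congr rfl fun q _ => Finset.sum_congr rfl fun p _ => ?_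
          rw [mul_comm]
  -- A product of two components is central, so a triple product is unchanged under cyclic
  -- permutation, without a sign.
  have hcyc : ∀ r s q, S.A s * S.A q * S.A r = S.A r * S.A s * S.A q := fun r s q => by
    rw [(S.A_mul_A_comm s q (S.A r)).eq, mul_assoc]
  have h2 : T = ∑ r, ∑ s, ∑ q, K s q r • (S.A r * S.A s * S.A q) := by
    rw [hT, sum_rotate]
    simp only [hcyc]
  have h3 : T = ∑ r, ∑ s, ∑ q, K q r s • (S.A r * S.A s * S.A q) := by
    rw [h2, sum_rotate]
    simp only [hcyc]
  -- Adding the three cyclic relabellings of the sum produces the Jacobi identity in the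
  -- coefficients.
  have h5 : (3 : ℝ) • T = 0 := by
    have : (3 : ℝ) • T = T + T + T := by
      rw [show (3 : ℝ) = 1 + 1 + 1 by norm_num, add_smul, add_smul, one_smul]
    rw [this]
    have h6 : T + T + T = ∑ r, ∑ s, ∑ q, K r s q • (S.A r * S.A s * S.A q) +
      ∑ r, ∑ s, ∑ q, K s q r • (S.A r * S.A s * S.A q) +
      ∑ r, ∑ s, ∑ q, K q r s • (S.A r * S.A s * S.A q) := by rw [← h2, ← h3]
    rw [h6]
    simp only [← Finset.sum_add_distrib, ← add_smul, hK]
    refine Finset.sum_eq_zero fun r _ => Finset.sum_eq_zero fun s _ =>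
      Finset.sum_eq_zero fun q _ => ?_
    rw [S.jacobi, zero_smul]
  rw [h1]
  exact (smul_eq_zero_iff_right (by norm_num : (3 : ℝ) ≠ 0)).1 h5

/-- The curvature of the connection `X • A`, a polynomial in the parameter `X`. -/
def curv (a : ι) : R[X] :=
  C (S.Θ a) + X * C (S.D (S.A a)) + X ^ 2 * C ((1 / 2 : ℝ) • S.bracket a)

theorem commute_of_coeff {p : R[X]} (h : ∀ n x, Commute (p.coeff n) x) (q : R[X]) :
    Commute p q := by
  ext n
  rw [coeff_mul, coeff_mul, ← Finset.Nat.sum_antidiagonal_swap]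
  exact Finset.sum_congr rfl fun x _ => h _ _

theorem C_comm {r : R} (h : ∀ x, Commute r x) (q : R[X]) : Commute (C r) q :=
  commute_of_coeff (fun n x => by
    rw [coeff_C]; split_ifs
    exacts [h x, Commute.zero_left x]) q

theorem curv_comm (a : ι) (q : R[X]) : Commute (S.curv a) q := by
  refine ((C_comm (S.Θ_comm a) q).add_left
    ((commute_X q).mul_left (C_comm (S.DA_comm a) q))).add_left
    (((commute_X q).pow_left 2).mul_left (C_comm (fun x => ?_) q))
  exact (S.bracket_comm a x).smul_left _

theorem σ_curv (a : ι) : mapAlgHom S.σ (S.curv a) = S.curv a := by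
  simp [curv, S.σ_Θ, S.σ_DA, S.σ_bracket]

/-- The identity of Bianchi. -/
theorem D_curv (a : ι) : mapCoeff S.D (S.curv a) =
    X * ∑ p, ∑ q, S.c p q a • (S.curv p * C (S.A q)) := by
  have h1 : ∀ p q, S.c p q a • (S.curv p * C (S.A q)) = C (S.c p q a • (S.Θ p * S.A q)) +
      X * C (S.c p q a • (S.D (S.A p) * S.A q)) +
      X ^ 2 * C (S.c p q a • (1 / 2 : ℝ) • (S.bracket p * S.A q)) := fun p q => by
    simp only [curv, add_mul, smul_add, ← smul_C, C_mul, mul_smul_comm, mul_assoc, smul_mul_assoc]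
  -- This is the term in `X³` on the right; the left side has none. The remaining two match by
  -- `D_DA` and `D_bracket`.
  have h2 : ∑ p, ∑ q, S.c p q a • (1 / 2 : ℝ) • (S.bracket p * S.A q) = 0 := by
    simp only [smul_comm _ (1 / 2 : ℝ), ← Finset.smul_sum, S.bracket_bracket, smul_zero]
  simp only [h1, Finset.sum_add_distrib, ← Finset.mul_sum, ← map_sum, h2]
  simp only [curv, map_add, mapCoeff_C, mapCoeff_X_mul, pow_two, mul_assoc, S.D_Θ, S.D_DA, map_smul,
    S.D_bracket, smul_smul, map_zero, zero_add, mul_zero, add_zero, mul_add]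
  norm_num

/-- Substitution of the curvature into a polynomial. -/
def subst : MvPolynomial ι ℝ →ₐ[ℝ] R[X] :=
  (Subalgebra.center ℝ R[X]).val.comp (MvPolynomial.aeval fun a =>
    (⟨S.curv a, Subalgebra.mem_center_iff.2 fun q => (S.curv_comm a q).eq.symm⟩ :
      Subalgebra.center ℝ R[X]))

@[simp] theorem subst_X (a : ι) : S.subst (MvPolynomial.X a) = S.curv a := by
  simp [subst]

theorem subst_comm (F : MvPolynomial ι ℝ) (q : R[X]) : Commute (S.subst F) q :=
  (Subalgebra.mem_center_iff.1 (Subtype.prop _) q).symm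

theorem σ_subst (F : MvPolynomial ι ℝ) : mapAlgHom S.σ (S.subst F) = S.subst F := by
  have h : (mapAlgHom S.σ).comp S.subst = S.subst := MvPolynomial.algHom_ext fun a => by
    rw [AlgHom.comp_apply, subst_X, σ_curv]
  exact congrArg (fun φ => φ F) h

/-- Curvatures are even and central, so `D` after substitution is a derivation and obeys the chain
rule. The Bianchi identity then assembles the coadjoint action on `F`. -/
theorem D_subst (F : MvPolynomial ι ℝ) : mapCoeff S.D (S.subst F) =
    X * ∑ q, S.subst (coadPoly S.c q F) * C (S.A q) := by
  have h := apply_eq_sum_pderiv (P := S.subst) (δ := mapCoeff S.D ∘ₗ S.subst.toLinearMap)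
    (fun F G => by
      simp only [LinearMap.comp_apply, AlgHom.toLinearMap_apply, map_mul, mapCoeff_mul S.leibniz,
        σ_subst]
      rw [add_comm, ((S.subst_comm G) _).eq]) F
  refine h.trans ?_
  simp only [LinearMap.comp_apply, AlgHom.toLinearMap_apply, subst_X, D_curv, coadPoly, map_sum,
    map_mul, Finset.sum_mul, Finset.mul_sum, MvPolynomial.C_eq_smul_one, map_smul,
    smul_mul_assoc, one_mul, mul_smul_comm]
  rw [Finset.sum_congr rfl fun a _ => Finset.sum_comm, Finset.sum_comm]
  refine Finset.sum_congr rfl fun q _ => Finset.sum_congr rfl fun a _ =>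
    Finset.sum_congr rfl fun p _ => ?_
  rw [← mul_assoc, ← (commute_X (S.subst _)).eq]
  simp only [mul_assoc]

/-- The transgression form. -/
def transgression : MvPolynomial ι ℝ →ₗ[ℝ] R[X] :=
  ∑ a, LinearMap.mulRight ℝ (C (S.A a)) ∘ₗ S.subst.toLinearMap ∘ₗ
    (MvPolynomial.pderiv a).toLinearMap

theorem transgression_apply (F : MvPolynomial ι ℝ) :
    S.transgression F = ∑ a, S.subst (MvPolynomial.pderiv a F) * C (S.A a) := by
  simp [transgression]

theorem transgression_X (a : ι) : S.transgression (MvPolynomial.X a) = C (S.A a) := by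
  classical
  simp [transgression_apply, MvPolynomial.pderiv_X, Pi.single_apply, apply_ite S.subst]

/-- Being a derivation along `subst`, the transgression is determined by its values on the
variables; `map_transgression` uses this. -/
theorem transgression_mul (F G : MvPolynomial ι ℝ) :
    S.transgression (F * G) = S.subst F * S.transgression G + S.subst G * S.transgression F := by
  simp only [transgression_apply, Derivation.leibniz, map_add, smul_eq_mul, map_mul, add_mul,
    Finset.sum_add_distrib, Finset.mul_sum, mul_assoc]

variable {S} {F : MvPolynomial ι ℝ} (hF : ∀ q, coadPoly S.c q F = 0)
include hF

theorem D_subst_eq_zero : mapCoeff S.D (S.subst F) = 0 := by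
  simp [D_subst, hF]

/-- By the chain rule the left side is `∑_a ∂_a F(Ω_X) (D A^a + X [A, A]^a)`. On the right, `D`
falling on `A^a` gives the first part. By Bianchi and the equivariance of the gradient, `D` falling
on `∂_a F(Ω_X)` gives the second. -/
theorem derivative_subst :
    derivative (S.subst F) = mapCoeff S.D (S.transgression F) := by
  have h1 := apply_eq_sum_pderiv (P := S.subst)
    (δ := (derivative.restrictScalars ℝ : R[X] →ₗ[ℝ] R[X]) ∘ₗ S.subst.toLinearMap)
    (fun F G => by
      simp only [LinearMap.comp_apply, AlgHom.toLinearMap_apply, map_mul,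
        LinearMap.restrictScalars_apply, derivative_mul]
      rw [add_comm, ((S.subst_comm G) _).eq]) F
  refine h1.trans ?_
  have h2 : ∀ a, derivative (S.curv a) = C (S.D (S.A a)) + X * C (S.bracket a) := fun a => by
    have h3 : (2 : R[X]) * C ((1 / 2 : ℝ) • S.bracket a) = C (S.bracket a) := by
      rw [← smul_C, mul_smul_comm, two_mul, ← two_smul ℝ, smul_smul]; norm_num
    simp only [curv, derivative_add, derivative_C, derivative_mul, derivative_X, zero_add, one_mul,
      mul_zero, add_zero, derivative_X_pow]
    rw [← h3]
    simp [← mul_assoc, (commute_X (2 : R[X])).eq, show C (2 : R) = 2 from map_ofNat C 2]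
  -- Equivariance of the gradient of an invariant polynomial, from `pderiv_coadPoly`.
  have h4 : ∀ a q, S.subst (coadPoly S.c q (MvPolynomial.pderiv a F)) =
      -∑ e, S.c a q e • S.subst (MvPolynomial.pderiv e F) := fun a q => by
    have h5 := pderiv_coadPoly S.c q a F
    rw [hF, map_zero] at h5
    rw [eq_neg_of_add_eq_zero_left h5.symm, map_neg, map_sum]
    simp only [map_smul]
  simp only [LinearMap.comp_apply, AlgHom.toLinearMap_apply, LinearMap.restrictScalars_apply,
    subst_X, h2, transgression_apply, map_sum, mapCoeff_mul S.leibniz, σ_subst, D_subst, h4,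
    mapCoeff_C, mul_add, Finset.sum_add_distrib]
  rw [add_comm]
  congr 1
  simp only [neg_mul, Finset.sum_neg_distrib, Finset.sum_mul, Finset.mul_sum, mul_neg, bracket,
    map_sum, ← smul_C, C_mul, smul_mul_assoc, mul_smul_comm]
  -- The sign of this exchange cancels the one in `h4`.
  have h6 : ∀ a q, C (S.A q) * C (S.A a) = -(C (S.A a) * C (S.A q)) := fun a q => by
    rw [← C_mul, S.A_anticomm, map_neg, C_mul]
  refine (sum_rotate fun a q e => S.c a q e • (S.subst (MvPolynomial.pderiv e F) *
    (X * (C (S.A a) * C (S.A q))))).symm.trans ?_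
  simp only [← Finset.sum_neg_distrib]
  refine Finset.sum_congr rfl fun a _ => Finset.sum_congr rfl fun q _ =>
    Finset.sum_congr rfl fun e _ => ?_
  rw [mul_assoc X, mul_assoc (S.subst _) (C (S.A q)), h6 a q, mul_neg, mul_neg, smul_neg, neg_neg,
    ← mul_assoc (S.subst _) X, ← mul_assoc X, (commute_X (S.subst _)).eq]

omit hF

/-! ### The two ends of the path. -/

section Endpoints

/-- Evaluation at `X = 1` as a homomorphism of algebras. -/
def evalOne : R[X] →ₐ[ℝ] R :=
  { eval₂RingHom' (RingHom.id R) 1 (fun _ => Commute.one_right _) with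
    commutes' := fun r => (eval_C (x := (1 : R)) (a := algebraMap ℝ R r)) }

theorem evalOne_apply (p : R[X]) : evalOne p = p.eval 1 := rfl

theorem eval_one_mapCoeff (D : R →ₗ[ℝ] R) (p : R[X]) : (mapCoeff D p).eval 1 = D (p.eval 1) := by
  induction p using Polynomial.induction_on' with
  | add p q hp hq => simp only [map_add, eval_add, hp, hq]
  | monomial k r => simp

/-- Evaluation at `1` is multiplicative because `1` is central, so comparing the values on the
variables suffices. -/
theorem eval_one_subst {φ : MvPolynomial ι ℝ →ₐ[ℝ] R}
    (hφ : ∀ a, φ (MvPolynomial.X a) = S.Θ a + S.D (S.A a) + (1 / 2 : ℝ) • S.bracket a)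
    (F : MvPolynomial ι ℝ) : (S.subst F).eval 1 = φ F := by
  have h : evalOne.comp S.subst = φ := MvPolynomial.algHom_ext fun a => by
    rw [AlgHom.comp_apply, subst_X, hφ, evalOne_apply, curv, (commute_X _).eq,
      ((commute_X _).pow_left 2).eq]
    simp only [eval_add, eval_C, eval_mul_X, eval_mul_X_pow, one_pow, mul_one]
  exact congrArg (fun ψ => ψ F) h

theorem coeff_zero_subst {φ : MvPolynomial ι ℝ →ₐ[ℝ] R} (hφ : ∀ a, φ (MvPolynomial.X a) = S.Θ a)
    (F : MvPolynomial ι ℝ) : (S.subst F).coeff 0 = φ F := by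
  have h : (constantCoeff : R[X] →+* R).comp S.subst.toRingHom = φ.toRingHom := by
    refine MvPolynomial.ringHom_ext (fun r => ?_) fun a => ?_
    · change (S.subst (algebraMap ℝ _ r)).coeff 0 = φ (algebraMap ℝ _ r)
      rw [AlgHom.commutes, AlgHom.commutes]
      exact coeff_C_zero
    · change (S.subst (MvPolynomial.X a)).coeff 0 = φ (MvPolynomial.X a)
      rw [subst_X, hφ]
      simp [curv, pow_two, mul_assoc]
  exact congrArg (fun ψ => ψ F) h

end Endpoints

/-! ### Equivariance of the curvature and of the transgression. -/

section Equivariance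

variable {ρ : R →ₐ[ℝ] R} {m : ι → ι → ℝ} (hΘ : ∀ a, ρ (S.Θ a) = ∑ e, m a e • S.Θ e)
  (hA : ∀ a, ρ (S.A a) = ∑ e, m a e • S.A e)
  (hDA : ∀ a, ρ (S.D (S.A a)) = ∑ e, m a e • S.D (S.A e))
  (hbr : ∀ a, ρ (S.bracket a) = ∑ e, m a e • S.bracket e)
include hΘ hDA hbr

/-- All three coefficients of the curvature transform by the same matrix `m`, hence so does the
curvature. -/
theorem map_subst (F : MvPolynomial ι ℝ) : mapAlgHom ρ (S.subst F) =
    S.subst (MvPolynomial.aeval (fun a => ∑ e, m a e • MvPolynomial.X e) F) := by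
  have h : (mapAlgHom ρ).comp S.subst = S.subst.comp
      (MvPolynomial.aeval (fun a => ∑ e, m a e • MvPolynomial.X e)) :=
    MvPolynomial.algHom_ext fun a => by
      rw [AlgHom.comp_apply, AlgHom.comp_apply, subst_X, MvPolynomial.aeval_X, map_sum]
      simp only [map_smul, subst_X, curv, map_add, map_mul, map_pow, coe_mapAlgHom, map_X, map_C,
        RingHom.coe_coe, hΘ, hDA, hbr, smul_add, Finset.sum_add_distrib, Finset.smul_sum, map_sum,
        Finset.mul_sum, ← smul_C, mul_smul_comm, smul_comm (1 / 2 : ℝ)]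
  exact congrArg (fun ψ => ψ F) h

include hA

/-- The right side is a derivation along `subst` after the change of variables. The chain rule
expands it into partial derivatives, and the terms match those of the left side one by one. -/
theorem map_transgression (F : MvPolynomial ι ℝ) : mapAlgHom ρ (S.transgression F) =
    S.transgression (MvPolynomial.aeval (fun a => ∑ e, m a e • MvPolynomial.X e) F) := by
  set κ : MvPolynomial ι ℝ →ₐ[ℝ] MvPolynomial ι ℝ :=
    MvPolynomial.aeval (fun a => ∑ e, m a e • MvPolynomial.X e) with hκ
  have h := apply_eq_sum_pderiv (P := S.subst.comp κ) (δ := S.transgression ∘ₗ κ.toLinearMap)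
    (fun F G => by
      simp only [LinearMap.comp_apply, AlgHom.toLinearMap_apply, map_mul, transgression_mul,
        AlgHom.comp_apply]) F
  refine Eq.trans ?_ h.symm
  rw [transgression_apply, map_sum]
  refine Finset.sum_congr rfl fun a _ => ?_
  rw [map_mul, map_subst hΘ hDA hbr]
  congr 1
  simp only [LinearMap.comp_apply, AlgHom.toLinearMap_apply, hκ, MvPolynomial.aeval_X, map_sum,
    map_smul, transgression_X, coe_mapAlgHom, map_C, RingHom.coe_coe, hA, smul_C]

end Equivariance

end OddConnection

end OddConnection

/-! ### The cut-off connection in the Cartan model and the conclusion. -/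

section CartanModel

variable {d n : ℕ} {H : Type*} [TopologicalSpace H]
  {I : ModelWithCorners ℝ (EuclideanSpace ℝ (Fin n)) H}
  {G : Type*} [Group G] [TopologicalSpace G] [ChartedSpace (EuclideanSpace ℝ (Fin d)) G]
  [LieGroup (𝓡 d) ∞ G]
  {W : Type*} [TopologicalSpace W] [ChartedSpace H W] [IsManifold I ∞ W]
  [MulAction G W] [ContMDiffSMul (𝓡 d) I ∞ G W]
  {ι : Type*} [Fintype ι] (b : Module.Basis ι ℝ (GroupLieAlgebra (𝓡 d) G))

variable (I W) in
/-- The exterior derivative of differential forms. -/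
def dForm : DiffForm I W →ₗ[ℝ] DiffForm I W :=
  (Form.extD ℝ : Form (Fn I W) (VField I W) →ₗ[ℝ] Form (Fn I W) (VField I W))

/-- The contraction of differential forms with a fundamental vector field. -/
def iotaForm (ξ : GroupLieAlgebra (𝓡 d) G) : DiffForm I W →ₗ[ℝ] DiffForm I W :=
  ((Form.contract (fundField I ξ)).restrictScalars ℝ :
    Form (Fn I W) (VField I W) →ₗ[ℝ] Form (Fn I W) (VField I W))

variable (I W) in
/-- The grading involution of differential forms as a homomorphism of algebras. -/
def sgnForm : DiffForm I W →ₐ[ℝ] DiffForm I W :=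
  AlgHom.ofLinearMap ((Form.sgn.restrictScalars ℝ :
    Form (Fn I W) (VField I W) →ₗ[ℝ] Form (Fn I W) (VField I W))) (Form.sgn_ofFun 1) Form.sgn_mul

variable (d I W) in
/-- The action of `g` on differential forms as a homomorphism of algebras. -/
def actForm (g : G) : DiffForm I W →ₐ[ℝ] DiffForm I W :=
  AlgHom.ofLinearMap (formAction d I W g) (formAction_one g) (formAction_mul g)

/-- The functions as differential forms. -/
def fnForm (φ : Fn I W) : DiffForm I W := (Form.ofFun φ : Form (Fn I W) (VField I W))

theorem dForm_mul (α β : DiffForm I W) :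
    dForm I W (α * β) = dForm I W α * β + sgnForm I W α * dForm I W β := Form.extD_mul ℝ α β

theorem iotaForm_mul (ξ : GroupLieAlgebra (𝓡 d) G) (α β : DiffForm I W) :
    iotaForm ξ (α * β) = iotaForm ξ α * β + sgnForm I W α * iotaForm ξ β :=
  Form.contract_mul (fundField I ξ) α β

theorem sgnForm_dForm (α : DiffForm I W) : sgnForm I W (dForm I W α) = -dForm I W (sgnForm I W α) :=
  (neg_eq_iff_eq_neg.2 (Form.extD_sgn ℝ α)).symm

theorem cartanD_tmul (s : SymDual d G) (α : DiffForm I W) :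
    cartanD I W b (s ⊗ₜ[ℝ] α) =
      s ⊗ₜ[ℝ] dForm I W α - ∑ a, (theta b a * s) ⊗ₜ[ℝ] iotaForm (b a) α := by
  have h : cartanD I W b = TensorProduct.map LinearMap.id (dForm I W) -
      ∑ a, TensorProduct.map (LinearMap.mulLeft ℝ (theta b a)) (iotaForm (b a)) := rfl
  rw [h, LinearMap.sub_apply, LinearMap.sum_apply]
  rfl

variable (d I G W) in
/-- The grading involution of `S(g*) ⊗ Ω(W)`. -/
def sgnSymForms : SymForms d I G W →ₐ[ℝ] SymForms d I G W :=
  Algebra.TensorProduct.map (AlgHom.id ℝ _) (sgnForm I W)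

variable (I W) in
/-- The action of `g` on `S(g*) ⊗ Ω(W)` as a homomorphism of algebras. -/
def actSymForms (g : G) : SymForms d I G W →ₐ[ℝ] SymForms d I G W :=
  Algebra.TensorProduct.map (coAd g) (actForm d I W g)

theorem symFormsAction_eq (g : G) (t : SymForms d I G W) :
    symFormsAction I W g t = actSymForms I W g t := by
  induction t using TensorProduct.induction_on with
  | zero => rw [map_zero, map_zero]
  | add x y hx hy => rw [map_add, map_add, hx, hy]
  | tmul s α => rfl

theorem cartanD_mul (x y : SymForms d I G W) : cartanD I W b (x * y) =
    cartanD I W b x * y + sgnSymForms d I G W x * cartanD I W b y := by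
  induction x using TensorProduct.induction_on with
  | zero => simp only [zero_mul, map_zero, add_zero]
  | add x x' hx hx' => simp only [add_mul, map_add, hx, hx']; abel
  | tmul s α =>
    induction y using TensorProduct.induction_on with
    | zero => simp only [mul_zero, map_zero, add_zero]
    | add y y' hy hy' => simp only [mul_add, map_add, hy, hy']; abel
    | tmul s' β =>
      simp only [Algebra.TensorProduct.tmul_mul_tmul, cartanD_tmul, sgnSymForms,
        Algebra.TensorProduct.map_tmul, AlgHom.id_apply, dForm_mul, iotaForm_mul,
        TensorProduct.tmul_add, sub_mul, mul_sub, Finset.sum_mul, Finset.mul_sum,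
        Finset.sum_add_distrib, mul_assoc, mul_left_comm s]
      abel

theorem tmul_comm (s : SymDual d G) {α : DiffForm I W} (hα : sgnForm I W α = α)
    (x : SymForms d I G W) : Commute (s ⊗ₜ[ℝ] α) x := by
  induction x using TensorProduct.induction_on with
  | zero => exact Commute.zero_right _
  | add x y hx hy => exact hx.add_right hy
  | tmul s' β =>
    have h : α * β = β * α := Form.commute_of_even (A := Fn I W) (L := VField I W) hα β
    change _ * _ = _ * _
    rw [Algebra.TensorProduct.tmul_mul_tmul, Algebra.TensorProduct.tmul_mul_tmul, mul_comm s, h]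

theorem mem_equivForms {t : SymForms d I G W} :
    t ∈ equivForms d I G W ↔ ∀ g : G, actSymForms I W g t = t := by
  simp only [equivForms, Submodule.mem_iInf, LinearMap.mem_eqLocus, symFormsAction_eq,
    LinearMap.id_apply]

variable (f : CutOff d I G W) (η : Connection d I G W)

/-- The component `l(ω_f)` of `ω_f` as a differential form. -/
def connForm (l : Module.Dual ℝ (GroupLieAlgebra (𝓡 d) G)) : DiffForm I W :=
  (Form.ofOne (cutOffForm f η l) : Form (Fn I W) (VField I W))

/-- By linearity in `l`. It turns composition with `Ad g⁻¹` or `ad_ξ` into matrices acting on the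
components of `ω_f`. -/
theorem connForm_eq_sum (l : Module.Dual ℝ (GroupLieAlgebra (𝓡 d) G)) :
    connForm f η l = ∑ a, l (b a) • connForm f η (b.coord a) := by
  let A : Module.Dual ℝ (GroupLieAlgebra (𝓡 d) G) →ₗ[ℝ] DiffForm I W :=
    { toFun := connForm f η
      map_add' := fun l m => Form.ext_contract (A := Fn I W) (L := VField I W)
        (add_zero (0 : Fn I W)).symm fun X => by
          refine (Form.contract_ofOne X _).trans (Eq.trans ?_
            (map_add (Form.contract X) (Form.ofOne (cutOffForm f η l))
              (Form.ofOne (cutOffForm f η m))).symm)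
          rw [Form.contract_ofOne, Form.contract_ofOne, ← map_add]
          exact congrArg Form.ofFun (ContMDiffMap.ext fun x => mul_add _ _ _)
      map_smul' := fun c l => Form.ext_contract (A := Fn I W) (L := VField I W)
        (smul_zero (A := Fn I W) c).symm fun X => by
          refine (Form.contract_ofOne X _).trans (Eq.trans ?_
            (map_smul ((Form.contract X).restrictScalars ℝ) c
              (Form.ofOne (cutOffForm f η l))).symm)
          refine Eq.trans ?_ (congrArg (c • ·) (Form.contract_ofOne X _)).symm
          refine Eq.trans ?_ (map_smul (Form.ofFun.restrictScalars ℝ) c _)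
          exact congrArg Form.ofFun (ContMDiffMap.ext fun x => mul_left_comm _ _ _) }
  have h : l = ∑ a, l (b a) • b.coord a := b.ext fun c => by
    simp
  change A l = ∑ a, l (b a) • A (b.coord a)
  conv_lhs => rw [h, map_sum]
  simp only [map_smul]

theorem sgnForm_connForm (l : Module.Dual ℝ (GroupLieAlgebra (𝓡 d) G)) :
    sgnForm I W (connForm f η l) = -connForm f η l := Form.sgn_ofOne _

theorem sgnForm_fnForm (φ : Fn I W) : sgnForm I W (fnForm φ) = fnForm φ := Form.sgn_ofFun φ

theorem iotaForm_fnForm (ξ : GroupLieAlgebra (𝓡 d) G) (φ : Fn I W) :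
    iotaForm ξ (fnForm φ) = 0 := Form.contract_ofFun (fundField I ξ) φ

theorem iotaForm_connForm (ξ : GroupLieAlgebra (𝓡 d) G)
    (l : Module.Dual ℝ (GroupLieAlgebra (𝓡 d) G)) :
    iotaForm ξ (connForm f η l) = l ξ • fnForm f.toFn := by
  refine (Form.contract_ofOne _ _).trans ?_
  rw [cutOffForm_fundField]
  exact map_smul (Form.ofFun.restrictScalars ℝ) (l ξ) f.toFn

/-- Cartan's formula together with `L_ξ ω_f = -ad_ξ ω_f`. The term in `df` appears because `ω_f(X_ξ)
= f ξ` is not constant. -/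
theorem iotaForm_dForm_connForm (ξ : GroupLieAlgebra (𝓡 d) G)
    (l : Module.Dual ℝ (GroupLieAlgebra (𝓡 d) G)) :
    iotaForm ξ (dForm I W (connForm f η l)) =
      -connForm f η (l ∘ₗ adLie d G ξ) - l ξ • dForm I W (fnForm f.toFn) := by
  have h : iotaForm ξ (dForm I W (connForm f η l)) = -connForm f η (l ∘ₗ adLie d G ξ) -
      dForm I W (iotaForm ξ (connForm f η l)) :=
    (Form.contract_extD ℝ (fundField I ξ) (Form.ofOne (cutOffForm f η l))).trans
      (congrArg (· - _) (lieD_ofOne_cutOffForm f η ξ l))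
  rw [h, iotaForm_connForm, map_smul]

theorem connForm_anticomm (l m : Module.Dual ℝ (GroupLieAlgebra (𝓡 d) G)) :
    connForm f η l * connForm f η m = -(connForm f η m * connForm f η l) := by
  have h : connForm f η l * connForm f η m = sgnForm I W (connForm f η m) * connForm f η l :=
    Form.ext (A := Fn I W) (L := VField I W) fun k => (Form.mul_comm_of_even_odd k _ _).2
      (Form.sgn_ofOne _)
  rw [h, sgnForm_connForm, neg_mul]

theorem sgnForm_connForm_mul (l m : Module.Dual ℝ (GroupLieAlgebra (𝓡 d) G)) :
    sgnForm I W (connForm f η l * connForm f η m) = connForm f η l * connForm f η m := by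
  rw [map_mul, sgnForm_connForm, sgnForm_connForm, neg_mul_neg]

theorem sgnForm_dForm_connForm (l : Module.Dual ℝ (GroupLieAlgebra (𝓡 d) G)) :
    sgnForm I W (dForm I W (connForm f η l)) = dForm I W (connForm f η l) := by
  rw [sgnForm_dForm, sgnForm_connForm, map_neg, neg_neg]

theorem actForm_connForm (g : G) (l : Module.Dual ℝ (GroupLieAlgebra (𝓡 d) G)) :
    actForm d I W g (connForm f η l) = connForm f η (l ∘ₗ Ad g⁻¹) :=
  formAction_ofOne_cutOffForm f η g l

theorem actForm_dForm (g : G) (α : DiffForm I W) :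
    actForm d I W g (dForm I W α) = dForm I W (actForm d I W g α) := formAction_extD g α

theorem actForm_fnForm_cutOff (g : G) : actForm d I W g (fnForm f.toFn) = fnForm f.toFn :=
  (formAction_ofFun g f.toFn).trans (congrArg Form.ofFun (pullFn_cutOff f g⁻¹))

theorem coAd_gen (g : G) (l : Module.Dual ℝ (GroupLieAlgebra (𝓡 d) G)) :
    coAd g (SymDual.gen d G l) = SymDual.gen d G (l ∘ₗ Ad g⁻¹) := SymDual.lift_gen _ _

/-- The contractions in `D` produce the summand `-f Θ` of the degenerate curvature. -/
theorem cartanD_connForm (l : Module.Dual ℝ (GroupLieAlgebra (𝓡 d) G)) :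
    cartanD I W b ((1 : SymDual d G) ⊗ₜ[ℝ] connForm f η l) =
      (1 : SymDual d G) ⊗ₜ[ℝ] dForm I W (connForm f η l) -
        SymDual.gen d G l ⊗ₜ[ℝ] fnForm f.toFn := by
  rw [cartanD_tmul, gen_eq_sum b l, TensorProduct.sum_tmul]
  simp only [iotaForm_connForm, mul_one, TensorProduct.tmul_smul, TensorProduct.smul_tmul']

theorem cartanD_cartanD_connForm (l : Module.Dual ℝ (GroupLieAlgebra (𝓡 d) G)) :
    cartanD I W b (cartanD I W b ((1 : SymDual d G) ⊗ₜ[ℝ] connForm f η l)) =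
      ∑ p, theta b p ⊗ₜ[ℝ] connForm f η (l ∘ₗ adLie d G (b p)) := by
  have hdd : dForm I W (dForm I W (connForm f η l)) = 0 := Form.extD_extD ℝ _
  rw [cartanD_connForm, map_sub, cartanD_tmul, cartanD_tmul, hdd, TensorProduct.tmul_zero]
  simp only [iotaForm_fnForm, TensorProduct.tmul_zero, Finset.sum_const_zero, sub_zero, mul_one,
    iotaForm_dForm_connForm, TensorProduct.tmul_sub, TensorProduct.tmul_neg, Finset.sum_sub_distrib,
    Finset.sum_neg_distrib, TensorProduct.tmul_smul]
  -- The `df` terms from `D (dω_f)` and from `D (f Θ)` cancel, leaving `[Θ, A]`.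
  have h : SymDual.gen d G l ⊗ₜ[ℝ] dForm I W (fnForm f.toFn) =
      ∑ a, l (b a) • theta b a ⊗ₜ[ℝ] dForm I W (fnForm f.toFn) := by
    rw [gen_eq_sum b l, TensorProduct.sum_tmul]
    simp only [TensorProduct.smul_tmul']
  rw [h]
  abel

theorem sum_repr_mul_repr_lie (u v : GroupLieAlgebra (𝓡 d) G) (a : ι) :
    b.repr ⁅u, v⁆ a = ∑ p, b.repr u p * b.repr ⁅b p, v⁆ a := by
  conv_lhs => rw [← b.sum_repr u, sum_lie, map_sum, Finset.sum_apply']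
  refine Finset.sum_congr rfl fun p _ => ?_
  rw [smul_lie, map_smul]; rfl

/-- The form `ω_f` as an odd connection in `S(g*) ⊗ Ω(W)`. -/
def oddConnection : OddConnection ι (SymForms d I G W) where
  σ := sgnSymForms d I G W
  D := cartanD I W b
  leibniz := cartanD_mul b
  c p q a := b.repr ⁅b p, b q⁆ a
  antisymm p q a := by rw [← lie_skew, map_neg]; rfl
  jacobi r s q a := by
    simp only [Finset.sum_add_distrib, ← sum_repr_mul_repr_lie]
    have h : ⁅⁅b r, b s⁆, b q⁆ + ⁅⁅b s, b q⁆, b r⁆ + ⁅⁅b q, b r⁆, b s⁆ = 0 := by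
      have := lie_jacobi (b r) (b s) (b q)
      rw [← lie_skew (b r) ⁅b s, b q⁆, ← lie_skew (b s) ⁅b q, b r⁆,
        ← lie_skew (b q) ⁅b r, b s⁆] at this
      rw [← neg_eq_zero, ← this]
      abel
    rw [← Finsupp.add_apply, ← Finsupp.add_apply, ← map_add, ← map_add, h, map_zero]
    rfl
  Θ a := theta b a ⊗ₜ[ℝ] 1
  A a := 1 ⊗ₜ[ℝ] connForm f η (b.coord a)
  Θ_comm a := tmul_comm _ (map_one _)
  σ_Θ a := by rw [sgnSymForms, Algebra.TensorProduct.map_tmul, map_one, AlgHom.id_apply]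
  D_Θ a := by
    have h1 : dForm I W 1 = 0 := by
      have := dForm_mul (1 : DiffForm I W) 1
      rw [map_one (sgnForm I W), one_mul, mul_one, one_mul] at this
      exact left_eq_add.1 this
    have h2 : ∀ ξ : GroupLieAlgebra (𝓡 d) G, iotaForm ξ (1 : DiffForm I W) = 0 := fun ξ =>
      iotaForm_fnForm ξ 1
    rw [cartanD_tmul, h1]
    simp only [h2, TensorProduct.tmul_zero, Finset.sum_const_zero, sub_zero]
  σ_A a := by
    rw [sgnSymForms, Algebra.TensorProduct.map_tmul, sgnForm_connForm, map_one,
      TensorProduct.tmul_neg]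
  A_anticomm p q := by
    rw [Algebra.TensorProduct.tmul_mul_tmul, Algebra.TensorProduct.tmul_mul_tmul,
      connForm_anticomm, TensorProduct.tmul_neg]
  A_mul_A_comm p q := by
    rw [Algebra.TensorProduct.tmul_mul_tmul]
    exact tmul_comm _ (sgnForm_connForm_mul f η _ _)
  DA_comm a x := by
    rw [cartanD_connForm]
    exact (tmul_comm _ (sgnForm_dForm_connForm f η _) x).sub_left
      (tmul_comm _ (sgnForm_fnForm _) x)
  σ_DA a := by
    rw [cartanD_connForm, map_sub, sgnSymForms, Algebra.TensorProduct.map_tmul,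
      Algebra.TensorProduct.map_tmul, sgnForm_dForm_connForm, sgnForm_fnForm]
    rfl
  D_DA a := by
    rw [cartanD_cartanD_connForm]
    refine Finset.sum_congr rfl fun p _ => ?_
    rw [connForm_eq_sum b, TensorProduct.tmul_sum]
    refine Finset.sum_congr rfl fun q _ => ?_
    rw [Algebra.TensorProduct.tmul_mul_tmul, mul_one, one_mul, TensorProduct.tmul_smul]
    rfl

theorem oddConnection_bracket (a : ι) : (oddConnection b f η).bracket a =
    (1 : SymDual d G) ⊗ₜ[ℝ] ∑ p, ∑ q, b.repr ⁅b p, b q⁆ a •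
      (connForm f η (b.coord p) * connForm f η (b.coord q)) := by
  simp only [OddConnection.bracket, oddConnection, Algebra.TensorProduct.tmul_mul_tmul, mul_one,
    TensorProduct.tmul_sum, TensorProduct.tmul_smul]

/-- The factor `1 - f` of `Θ` splits into `Θ` itself and the part `-f Θ` contained in `D A`. -/
theorem degCurvature_eq (a : ι) : degCurvature b f η a = (oddConnection b f η).Θ a +
    (oddConnection b f η).D ((oddConnection b f η).A a) +
      (1 / 2 : ℝ) • (oddConnection b f η).bracket a := by
  have h1 : degCurvature b f η a = (1 : SymDual d G) ⊗ₜ[ℝ] (dForm I W (connForm f η (b.coord a)) +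
      (1 / 2 : ℝ) • ∑ p, ∑ q, b.repr ⁅b p, b q⁆ a •
        (connForm f η (b.coord p) * connForm f η (b.coord q))) -
      theta b a ⊗ₜ[ℝ] fnForm (-1 + f.toFn) := rfl
  have h2 : (fnForm (-1 + f.toFn) : DiffForm I W) = -1 + fnForm f.toFn := by
    refine (map_add Form.ofFun (-1) f.toFn).trans ?_
    rw [map_neg]; rfl
  have h3 : (oddConnection b f η).D ((oddConnection b f η).A a) =
      (1 : SymDual d G) ⊗ₜ[ℝ] dForm I W (connForm f η (b.coord a)) -
        theta b a ⊗ₜ[ℝ] fnForm f.toFn := cartanD_connForm b f η (b.coord a)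
  have h4 : (oddConnection b f η).Θ a = theta b a ⊗ₜ[ℝ] (1 : DiffForm I W) := rfl
  rw [h1, h2, h3, h4, oddConnection_bracket, TensorProduct.tmul_add, TensorProduct.tmul_add,
    TensorProduct.tmul_neg, TensorProduct.tmul_smul]
  abel

/-- The matrix of the coadjoint action of `g` in the dual basis. -/
def coAdMatrix (g : G) (a e : ι) : ℝ := b.coord a (Ad g⁻¹ (b e))

theorem coAd_theta (g : G) (a : ι) :
    coAd g (theta b a) = ∑ e, coAdMatrix b g a e • theta b e :=
  (coAd_gen g _).trans (gen_eq_sum b _)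

theorem ofPoly_injective : Function.Injective (ofPoly b) := by
  have h : (SymDual.lift (∑ a, (LinearMap.applyₗ (b a)).smulRight
      (MvPolynomial.X a : MvPolynomial ι ℝ))).comp (ofPoly b) = AlgHom.id ℝ _ := by
    classical
    refine MvPolynomial.algHom_ext fun a => ?_
    rw [AlgHom.comp_apply, ofPoly_X, theta, SymDual.lift_gen]
    simp [Finsupp.single_apply]
  exact Function.LeftInverse.injective fun p => congrArg (fun φ => φ p) h

/-- Invariance in `S(g*)` becomes invariance of the polynomial under a linear substitution, since
`ofPoly` is injective. -/
theorem aeval_coAdMatrix_eq {p : MvPolynomial ι ℝ} (hp : ofPoly b p ∈ invPoly d G) (g : G) :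
    MvPolynomial.aeval (fun a => ∑ e, coAdMatrix b g a e • (MvPolynomial.X e : MvPolynomial ι ℝ)) p
      = p := by
  refine ofPoly_injective b ?_
  have h : (ofPoly b).comp (MvPolynomial.aeval
      (fun a => ∑ e, coAdMatrix b g a e • (MvPolynomial.X e : MvPolynomial ι ℝ))) =
        (coAd g).comp (ofPoly b) := MvPolynomial.algHom_ext fun a => by
    simp only [AlgHom.comp_apply, MvPolynomial.aeval_X, map_sum, map_smul, ofPoly_X, coAd_theta]
  exact (congrArg (fun φ => φ p) h).trans (mem_invPoly.1 hp g)

theorem actSymForms_Θ (g : G) (a : ι) : actSymForms I W g ((oddConnection b f η).Θ a) =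
    ∑ e, coAdMatrix b g a e • (oddConnection b f η).Θ e := by
  change actSymForms I W g (theta b a ⊗ₜ[ℝ] 1) = ∑ e, coAdMatrix b g a e • theta b e ⊗ₜ[ℝ] 1
  rw [actSymForms, Algebra.TensorProduct.map_tmul, map_one, coAd_theta, TensorProduct.sum_tmul]
  simp only [TensorProduct.smul_tmul']

theorem actForm_connForm_coord (g : G) (a : ι) : actForm d I W g (connForm f η (b.coord a)) =
    ∑ e, coAdMatrix b g a e • connForm f η (b.coord e) :=
  (actForm_connForm f η g _).trans (connForm_eq_sum b f η _)

theorem actSymForms_A (g : G) (a : ι) : actSymForms I W g ((oddConnection b f η).A a) =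
    ∑ e, coAdMatrix b g a e • (oddConnection b f η).A e := by
  change actSymForms I W g (1 ⊗ₜ[ℝ] connForm f η (b.coord a)) =
    ∑ e, coAdMatrix b g a e • 1 ⊗ₜ[ℝ] connForm f η (b.coord e)
  rw [actSymForms, Algebra.TensorProduct.map_tmul, map_one, actForm_connForm_coord,
    TensorProduct.tmul_sum]
  simp only [TensorProduct.tmul_smul]

theorem actSymForms_D_A (g : G) (a : ι) :
    actSymForms I W g ((oddConnection b f η).D ((oddConnection b f η).A a)) =
      ∑ e, coAdMatrix b g a e • (oddConnection b f η).D ((oddConnection b f η).A e) := by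
  have h : ∀ e, (oddConnection b f η).D ((oddConnection b f η).A e) =
      (1 : SymDual d G) ⊗ₜ[ℝ] dForm I W (connForm f η (b.coord e)) -
        theta b e ⊗ₜ[ℝ] fnForm f.toFn := fun e => cartanD_connForm b f η (b.coord e)
  simp only [h]
  rw [map_sub, actSymForms, Algebra.TensorProduct.map_tmul, Algebra.TensorProduct.map_tmul,
    map_one, actForm_dForm, actForm_fnForm_cutOff, actForm_connForm_coord, coAd_theta, map_sum,
    TensorProduct.tmul_sum, TensorProduct.sum_tmul, ← Finset.sum_sub_distrib]
  simp only [map_smul, TensorProduct.tmul_smul, TensorProduct.smul_tmul', smul_sub]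

/-- That `Ad g⁻¹` preserves the bracket, in structure constants. -/
theorem sum_coAdMatrix_mul (g : G) (a r s : ι) :
    ∑ p, ∑ q, b.repr ⁅b p, b q⁆ a * (coAdMatrix b g p r * coAdMatrix b g q s) =
      ∑ e, coAdMatrix b g a e * b.repr ⁅b r, b s⁆ e := by
  have h1 : ∑ e, coAdMatrix b g a e * b.repr ⁅b r, b s⁆ e = b.coord a (Ad g⁻¹ ⁅b r, b s⁆) := by
    conv_rhs => rw [← b.sum_repr ⁅b r, b s⁆, map_sum, map_sum]
    refine Finset.sum_congr rfl fun e _ => ?_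
    rw [map_smul, map_smul, smul_eq_mul, mul_comm]; rfl
  have h2 : ∀ u v : GroupLieAlgebra (𝓡 d) G, b.repr ⁅u, v⁆ a =
      ∑ p, ∑ q, b.repr ⁅b p, b q⁆ a * (b.repr u p * b.repr v q) := fun u v => by
    rw [sum_repr_mul_repr_lie]
    refine Finset.sum_congr rfl fun p _ => ?_
    rw [← lie_skew, map_neg, Finsupp.neg_apply, sum_repr_mul_repr_lie, ← Finset.sum_neg_distrib,
      Finset.mul_sum]
    refine Finset.sum_congr rfl fun q _ => ?_
    rw [← lie_skew, map_neg, Finsupp.neg_apply]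
    ring
  rw [h1, Ad_lie]
  exact (h2 _ _).symm

theorem actSymForms_bracket (g : G) (a : ι) :
    actSymForms I W g ((oddConnection b f η).bracket a) =
      ∑ e, coAdMatrix b g a e • (oddConnection b f η).bracket e := by
  have h : ∀ e, (oddConnection b f η).bracket e = ∑ p, ∑ q, b.repr ⁅b p, b q⁆ e •
    ((oddConnection b f η).A p * (oddConnection b f η).A q) := fun _ => rfl
  simp only [h, map_sum, map_smul, map_mul, actSymForms_A, Finset.sum_mul, Finset.mul_sum,
    Finset.smul_sum, smul_mul_smul_comm, smul_smul]
  calc _ = ∑ r, ∑ s, ∑ p, ∑ q, (b.repr ⁅b p, b q⁆ a * (coAdMatrix b g p r * coAdMatrix b g q s)) •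
        ((oddConnection b f η).A r * (oddConnection b f η).A s) := by
        conv_rhs => rw [Finset.sum_comm]
        rw [Finset.sum_congr rfl fun p _ => Finset.sum_comm, Finset.sum_comm]
        refine Finset.sum_congr rfl fun s _ => ?_
        rw [Finset.sum_congr rfl fun p _ => Finset.sum_comm, Finset.sum_comm]
    _ = ∑ r, ∑ s, ∑ e, (coAdMatrix b g a e * b.repr ⁅b r, b s⁆ e) •
        ((oddConnection b f η).A r * (oddConnection b f η).A s) := by
        simp only [← Finset.sum_smul, sum_coAdMatrix_mul]
    _ = _ := by
        rw [Finset.sum_congr rfl fun r _ => Finset.sum_comm, Finset.sum_comm]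

/-- Up to the sign from antisymmetry, this is the infinitesimal invariance obtained by
differentiating along a curve in `G`. -/
theorem coadPoly_eq_zero {p : MvPolynomial ι ℝ} (hp : ofPoly b p ∈ invPoly d G) (q : ι) :
    coadPoly (oddConnection b f η).c q p = 0 := by
  have h : coadPoly (oddConnection b f η).c q p = -∑ a, MvPolynomial.pderiv a p *
      ∑ c, MvPolynomial.C (b.repr ⁅b q, b c⁆ a) * MvPolynomial.X c := by
    rw [coadPoly, ← Finset.sum_neg_distrib]
    refine Finset.sum_congr rfl fun a _ => ?_
    rw [← mul_neg, ← Finset.sum_neg_distrib]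
    refine congrArg _ (Finset.sum_congr rfl fun c _ => ?_)
    rw [(oddConnection b f η).antisymm, map_neg, neg_mul]
    rfl
  rw [h, sum_pderiv_mul_bracket_eq_zero b hp, neg_zero]

theorem mapAlgHom_subst {p : MvPolynomial ι ℝ} (hp : ofPoly b p ∈ invPoly d G) (g : G) :
    Polynomial.mapAlgHom (actSymForms I W g) ((oddConnection b f η).subst p) =
      (oddConnection b f η).subst p := by
  rw [OddConnection.map_subst (actSymForms_Θ b f η g) (actSymForms_D_A b f η g)
    (actSymForms_bracket b f η g), aeval_coAdMatrix_eq b hp]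

theorem mapAlgHom_transgression {p : MvPolynomial ι ℝ} (hp : ofPoly b p ∈ invPoly d G) (g : G) :
    Polynomial.mapAlgHom (actSymForms I W g) ((oddConnection b f η).transgression p) =
      (oddConnection b f η).transgression p := by
  rw [OddConnection.map_transgression (actSymForms_Θ b f η g) (actSymForms_A b f η g)
    (actSymForms_D_A b f η g) (actSymForms_bracket b f η g), aeval_coAdMatrix_eq b hp]

theorem coeff_mem_equivForms {P : Polynomial (SymForms d I G W)}
    (hP : ∀ g : G, Polynomial.mapAlgHom (actSymForms I W g) P = P) (k : ℕ) :
    P.coeff k ∈ equivForms d I G W :=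
  mem_equivForms.2 fun g => by
    conv_rhs => rw [← hP g]
    exact (Polynomial.coeff_map _ _).symm

theorem chernWeil_ofPoly (p : MvPolynomial ι ℝ) :
    chernWeil b f η (ofPoly b p) = ((oddConnection b f η).subst p).eval 1 :=
  (OddConnection.eval_one_subst (φ := (chernWeil b f η).comp (ofPoly b)) (fun a => by
    rw [AlgHom.comp_apply, ofPoly_X, chernWeil_theta, degCurvature_eq]) p).symm

theorem inclC_ofPoly (p : MvPolynomial ι ℝ) :
    inclC I W (ofPoly b p) = ((oddConnection b f η).subst p).coeff 0 :=
  (OddConnection.coeff_zero_subst (φ := (inclC I W).comp (ofPoly b)) (fun a => by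
    rw [AlgHom.comp_apply, ofPoly_X]; rfl) p).symm

/-- The value at `X = 1` is the sum of the coefficients of `F(Ω_X)`, each of which is equivariant;
closedness holds along the whole path. -/
theorem chernWeil_mem_cocycles {F : SymDual d G} (hF : F ∈ invPoly d G) :
    chernWeil b f η F ∈ cocycles I W b := by
  obtain ⟨p, rfl⟩ := ofPoly_surjective b F
  rw [chernWeil_ofPoly]
  refine Submodule.mem_inf.2 ⟨?_, LinearMap.mem_ker.2 ?_⟩
  · rw [Polynomial.eval_eq_sum_range]
    simp only [one_pow, mul_one]
    exact Submodule.sum_mem _ fun k _ => coeff_mem_equivForms (mapAlgHom_subst b f η hF) k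
  · exact (OddConnection.eval_one_mapCoeff (oddConnection b f η).D _).symm.trans (by
      rw [OddConnection.D_subst_eq_zero (coadPoly_eq_zero b f η hF), Polynomial.eval_zero])

-- `F ⊗ 1` is the constant coefficient of `F(Ω_X)`, so it inherits closedness and equivariance from
-- the path.
include f η in
theorem inclC_mem_cocycles {F : SymDual d G} (hF : F ∈ invPoly d G) :
    inclC I W F ∈ cocycles I W b := by
  obtain ⟨p, rfl⟩ := ofPoly_surjective b F
  rw [inclC_ofPoly b f η]
  refine Submodule.mem_inf.2 ⟨coeff_mem_equivForms (mapAlgHom_subst b f η hF) 0,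
    LinearMap.mem_ker.2 ?_⟩
  exact (coeff_mapCoeff (oddConnection b f η).D _ _).symm.trans (by
    rw [OddConnection.D_subst_eq_zero (coadPoly_eq_zero b f η hF), Polynomial.coeff_zero])

/-- The primitive is the integral of the transgression over `[0, 1]`, a real combination of its
equivariant coefficients. -/
theorem chernWeil_sub_inclC_mem_coboundaries {F : SymDual d G} (hF : F ∈ invPoly d G) :
    chernWeil b f η F - inclC I W F ∈ coboundaries I W b := by
  obtain ⟨p, rfl⟩ := ofPoly_surjective b F
  rw [chernWeil_ofPoly, inclC_ofPoly b f η, eval_one_sub_coeff_zero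
    (OddConnection.derivative_subst (coadPoly_eq_zero b f η hF))]
  exact Submodule.mem_map_of_mem (Submodule.sum_mem _ fun k _ => Submodule.smul_mem _ _
    (coeff_mem_equivForms (mapAlgHom_transgression b f η hF) k))

end CartanModel

end

end DegCW

theorem theorem2p6 {d n : ℕ} {H : Type*} [TopologicalSpace H]
    (I : ModelWithCorners ℝ (EuclideanSpace ℝ (Fin n)) H)
    (G : Type*) [Group G] [TopologicalSpace G] [ChartedSpace (EuclideanSpace ℝ (Fin d)) G]
    [LieGroup (𝓡 d) ∞ G] [T2Space G] [CompactSpace G] [ConnectedSpace G]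
    (W : Type*) [TopologicalSpace W] [ChartedSpace H W] [IsManifold I ∞ W]
    [T2Space W] [CompactSpace W] [MulAction G W] [ContMDiffSMul (𝓡 d) I ∞ G W]
    (hW : DegCW.IsDegeneratePrincipalBundle d I G W)
    {ι : Type*} [Fintype ι] (b : Module.Basis ι ℝ (GroupLieAlgebra (𝓡 d) G))
    (f : DegCW.CutOff d I G W) (η : DegCW.Connection d I G W) :
    ∃ (hcw : ∀ F ∈ DegCW.invPoly d G, DegCW.chernWeil b f η F ∈ DegCW.cocycles I W b)
      (hic : ∀ F ∈ DegCW.invPoly d G, DegCW.inclC I W F ∈ DegCW.cocycles I W b),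
      DegCW.inducedMap I W b (DegCW.chernWeil b f η) hcw =
        DegCW.inducedMap I W b (DegCW.inclC I W) hic := by
  refine ⟨fun F hF => DegCW.chernWeil_mem_cocycles b f η hF,
    fun F hF => DegCW.inclC_mem_cocycles b f η hF, LinearMap.ext fun F => ?_⟩
  exact (Submodule.Quotient.eq _).2 (DegCW.chernWeil_sub_inclC_mem_coboundaries b f η F.2)
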